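/- **Setting.** Consider the untyped lambda calculus with symbols (unbound names, which evaluate to themselves), variables, abstractions, applications, and stochastic choices $\mathsf{Dist}_k(e)$. For every parameter value $v$ (taken up to renaming of bound variables and up to identifiers), $\mathsf{Dist}_k(v,\cdot)$ is a discrete probability distribution with density $\mathsf{pdf}_k(v,\cdot)$ on expressions, concentrated on expressions without stochastic choices. There are countably many symbols and distribution names. A program $p$ is a finite sequence of statements $\mathsf{assume}\ x=e$ and $\mathsf{observe}(\mathsf{Dist}_k(e)=d)$. Executing $p$ call by value, where a choice $\mathsf{Dist}_k(e)$ with parameter value $v$ returns the value of some expression $d$ with $\mathsf{pdf}_k(v,d)>0$, yields the valid traces of $p$; a trace records all evaluated subexpressions, including the bodies of applied closures and the evaluated sampled expressions, and $\mathsf{Program}(t)$ is the program a trace $t$ executes. The unnormalized density of $t$ is the product of $\mathsf{pdf}_k(v,d)$ over all its stochastic choices and observations. Let $T_p$ be the set of valid traces of $p$ of positive density, identified up to the choice of unique identifiers, with all subsets measurable, and, when the sum $Z_p$ of the densities over $T_p$ satisfies $0<Z_p<\infty$, let $\mu_p$ be the normalized distribution on $T_p$ (the posterior). A Markov kernel $K$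 on a probability space $(T,\pi)$ is *$\pi$-irreducible* if for all $t$ and all measurable $A$ with $\pi(A)>0$ there is $n\ge1$ with $K^n(t,A)>0$. It is *periodic* if for some $d\ge2$ there is a partition of $T$ into nonempty measurable sets $E_0,\dots,E_{d-1}$ and a $\pi$-null set $N$ such that $K(t,E_{i+1\bmod d})=1$ for all $t\in E_i$, and *aperiodic* otherwise. A *generalized Markov kernel* assigns to every program $p$ with a posterior a Markov kernel on $T_p$ that is $\mu_p$-irreducible, aperiodic, and has stationary distribution $\mu_p$. **Subproblems.** The dependence graph of a trace $t$ has as nodes the evaluated subexpressions and the stochastic choices and observations (the sample nodes). Its data edges lead from each node to the nodes whose value, or parameter, directly uses it. It has existential edges from the operator of each application of a closure to all nodes in the evaluation of the body, and from each stochastic choice to all nodes in the evaluation of the sampled expression. A *valid subproblem* of $t$ is a set $S$ of nodes that no existential edge leaves and such that every data edge leaving $S$ ends at a sample node. $S\vdash t\equiv t'$ means that $t$ and $t'$ agree except in the bodies of applications whose operator is in $S$, in the outcomes of stochastic choices in $S$, and in values. $\mathsf{ExtractTrace}(t,S)$ is the trace obtained by inlining, as $\mathsf{assume}$ statements, the applications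 of closures whose operator is not in $S$, and replacing the stochastic choices not in $S$ by $\mathsf{observe}$ statements followed by the evaluated sampled expression. $\mathsf{StitchTrace}(t,t_s',S)$ is the inverse operation, which puts a trace $t_s'$ of $\mathsf{Program}(\mathsf{ExtractTrace}(t,S))$ back into $t$. A *subproblem selection strategy* $\mathsf{SS}$ assigns to each valid trace a valid subproblem of it; $\mathsf{SS}\vdash t\equiv t'$ abbreviates $\mathsf{SS}(t)\vdash t\equiv t'$. On a program $p$, it is * *reversible* if $\mathsf{SS}\vdash t_i\equiv t_{i+1}$ for $1\le i<n$ implies $\mathsf{SS}\vdash t_n\equiv t_1$, for all $n\geq 1$ and $t_1,\dots,t_n\in T_p$; * *consistent* if, whenever $t,t'\in T_p$ and $\mathsf{SS}\vdash t\equiv t'$, each node $q$ of $t$ that has an outgoing existential edge in $t$, but no incoming existential edge from $\mathsf{SS}(t)$, lies in $\mathsf{SS}(t)$ if and only if it lies in $\mathsf{SS}(t')$. Let $f_{\mathsf{SS}}(t)=\{t'\in T_p:\mathsf{SS}\vdash t\equiv t'\}$ and, for $A\subseteq T_p$, let $\bar A^{\mathsf{SS}}=f_{\mathsf{SS}}^{-1}(f_{\mathsf{SS}}(A))$.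 Strategies $\mathsf{SS}_1,\dots,\mathsf{SS}_k$ *connect* $T_p$ if, for every nonempty $A\subseteq T_p$, whenever $\mu_p\big(\bar A^{\mathsf{SS}_i}\setminus\bar A^{\mathsf{SS}_j}\big)=0$ for all $i,j$, then $\mu_p\big(T_p\setminus\bar A^{\mathsf{SS}_i}\big)=0$ for some $i$. **Metaprograms.** An inference metaprogram is either a black box generalized Markov kernel $b$, or a set $\{w_1\,\mathsf{infer}(\mathsf{SS}_1,ip_1),\dots,w_k\,\mathsf{infer}(\mathsf{SS}_k,ip_k)\}$ with strategies $\mathsf{SS}_i$, inference metaprograms $ip_i$ and probabilities $w_i>0$, $\sum_iw_i=1$. On a trace $t$, the latter draws $i$ with probability $w_i$, runs $ip_i$ on $t_s=\mathsf{ExtractTrace}(t,\mathsf{SS}_i(t))$ to obtain $t_s'$, and returns $\mathsf{StitchTrace}(t,t_s',\mathsf{SS}_i(t))$. The metaprogram is *admissible* on $p$ if it is a black box, or if all $\mathsf{SS}_i$ are reversible and consistent on $p$, together connect $T_p$, and, for all $i$ and all $t\in T_p$, $ip_i$ is admissible on $\mathsf{Program}(\mathsf{ExtractTrace}(t,\mathsf{SS}_i(t)))$.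 **Theorem.** Let $ip$ be an inference metaprogram. For every program $p$ with a posterior on which $ip$ is admissible, $ip$ induces a Markov kernel on $T_p$ that is $\mu_p$-irreducible, aperiodic, and has $\mu_p$ as stationary distribution. In particular, if $ip$ is admissible on every program with a posterior, then $ip$ implements a generalized Markov kernel. -/

import Mathlib

open MeasureTheory ProbabilityTheory
open scoped ENNReal

namespace InferMeta

/-! ## The probabilistic lambda calculus

`C` is the type of symbols (the free variables of the calculus, which evaluate to themselves) and
`D` the type of distribution names.  Terms are taken up to renaming of variables: a variable bound
by an `assume` statement is referred to by name, a variable bound by a lambda (and, inside a sampled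
expression, a listed program variable) by its de Bruijn index. -/

/-- Identifiers of evaluated subexpressions and of stochastic choices.  The identifier of a node of
a trace is its position in the trace, so that identifiers are unique and a trace is determined up to
the choice of identifiers.  Names of program variables are drawn from the same set. -/
abbrev Addr := List ℕ

inductive Var where
  | glob (x : Addr)
  | loc (i : ℕ)
  deriving DecidableEq

def Var.shift : Var → Var
  | .glob x => .glob x
  | .loc i => .loc (i + 1)

def Var.unshift : Var → Option Var
  | .glob x => some (.glob x)
  | .loc 0 => none
  | .loc (i + 1) => some (.loc i)

/-- The renaming `ρ` carried under a lambda. -/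
def Var.under (ρ : Var → Var) : Var → Var
  | .glob x => (ρ (.glob x)).shift
  | .loc 0 => .loc 0
  | .loc (i + 1) => (ρ (.loc i)).shift

/-- Expressions.  `dist k xs e` is `Dist_k(e)`, where `xs` lists the variables of the program that
the expressions sampled from it may mention; a sampled expression refers to the `i`-th of them
as `loc i`. -/
inductive Expr (C D : Type) where
  | sym (c : C)
  | var (x : Var)
  | lam (b : Expr C D)
  | dist (k : D) (xs : List Var) (e : Expr C D)
  | app (e₁ e₂ : Expr C D)

section Calculus

variable {C D : Type}

namespace Expr

/-- The expressions `E_v`, which contain no `Dist`. -/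
def IsPure : Expr C D → Prop
  | .sym _ => True
  | .var _ => True
  | .lam b => b.IsPure
  | .dist _ _ _ => False
  | .app e₁ e₂ => e₁.IsPure ∧ e₂.IsPure

def rename (ρ : Var → Var) : Expr C D → Expr C D
  | .sym c => .sym c
  | .var x => .var (ρ x)
  | .lam b => .lam (b.rename (Var.under ρ))
  | .dist k xs e => .dist k (xs.map ρ) (e.rename ρ)
  | .app e₁ e₂ => .app (e₁.rename ρ) (e₂.rename ρ)

/-- The free variables. -/
def free : Expr C D → List Var
  | .sym _ => []
  | .var x => [x]
  | .lam b => b.free.filterMap Var.unshift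
  | .dist _ xs e => e.free ++ xs
  | .app e₁ e₂ => e₁.free ++ e₂.free

end Expr

mutual

/-- Values: symbols, stuck applications, and closures.  A closure holds the body of the lambda and
the environment restricted to the free variables of the lambda, in the order given by `Expr.free`;
in the body, `loc 0` is the argument and `loc (i + 1)` the `i`-th captured variable. -/
inductive Val (C D A : Type) where
  | sym (c : C)
  | app (v w : Val C D A)
  | clo (b : Expr C D) (ρ : VEnv C D A)

/-- Captured environments; `cons a v ρ` captures the value `v`, assigned by the expression with
identifier `a`. -/
inductive VEnv (C D A : Type) where
  | nil
  | cons (a : A) (v : Val C D A) (ρ : VEnv C D A)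

end

/-- Values without identifiers. -/
abbrev BareVal (C D : Type) := Val C D Unit

mutual

def Val.bare {A : Type} : Val C D A → BareVal C D
  | .sym c => .sym c
  | .app v w => .app v.bare w.bare
  | .clo b ρ => .clo b ρ.bare

def VEnv.bare {A : Type} : VEnv C D A → VEnv C D Unit
  | .nil => .nil
  | .cons _ v ρ => .cons () v.bare ρ.bare

end

/-- Environments: the value of each variable together with the identifier of the expression that
assigned it. -/
abbrev Env (C D : Type) := Var → Option (Addr × Val C D Addr)

def VEnv.get : VEnv C D Addr → ℕ → Option (Addr × Val C D Addr)
  | .nil, _ => none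
  | .cons a v _, 0 => some (a, v)
  | .cons _ _ ρ, i + 1 => ρ.get i

/-- The environment in which exactly the listed captured variables are bound, as `loc 0, loc 1, …`. -/
def VEnv.toEnv (ρ : VEnv C D Addr) : Env C D
  | .glob _ => none
  | .loc i => ρ.get i

def Env.empty : Env C D := fun _ => none

def Env.assign (σ : Env C D) (x a : Addr) (v : Val C D Addr) : Env C D :=
  Function.update σ (.glob x) (some (a, v))

/-- The restriction of an environment to a list of variables (all of which are bound whenever this
is used in a valid trace). -/
def Env.capture (σ : Env C D) : List Var → VEnv C D Addr
  | [] => .nil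
  | x :: xs =>
    match σ x with
    | some (a, v) => .cons a v (σ.capture xs)
    | none => σ.capture xs

/-- The value of `λ. b`. -/
def Env.closure (σ : Env C D) (b : Expr C D) : Val C D Addr :=
  let xs := (Expr.lam b).free.dedup
  .clo (b.rename (Var.under fun x => .loc (xs.idxOf x))) (σ.capture xs)

/-- The family of distributions: for each parameter value a probability distribution on expressions,
concentrated on `E_v`. -/
structure DistFamily (C D : Type) where
  pmf : D → BareVal C D → PMF (Expr C D)
  isPure : ∀ k v d, d ∈ (pmf k v).support → d.IsPure

/-! ## Programs and traces -/

/-- `assume x = e` and `observe (Dist_k(e) = d)`; in `d`, the variables `xs` are `loc 0, loc 1, …`. -/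
inductive Stmt (C D ε : Type) where
  | assume (x : Addr) (e : ε)
  | observe (k : D) (xs : List Var) (e : ε) (d : Expr C D)

/-- Augmented expressions: `neut a₁ a₂` is `(a₁ a₂)⊥`, `beta a₁ a₂ a₃` is `(a₁ a₂)x = a₃`, and
`dist k xs a a'` is `Dist_k(a) = a'`.  The identifier of a node at position `π` is `π` itself (its
children are at `1 :: π`, `2 :: π`, `3 :: π`), and the identifier of the stochastic choice made by a
`dist` node at `π` is `0 :: π`.  Values are determined by the rest of the trace, see `AExpr.val`. -/
inductive AExpr (C D : Type) where
  | sym (c : C)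
  | var (x : Var)
  | lam (b : Expr C D)
  | neut (a₁ a₂ : AExpr C D)
  | beta (a₁ a₂ a₃ : AExpr C D)
  | dist (k : D) (xs : List Var) (a a' : AExpr C D)

abbrev Program (C D : Type) := List (Stmt C D (Expr C D))

abbrev Trace (C D : Type) := List (Stmt C D (AExpr C D))

/-- Rolling an augmented expression back to the expression it evaluates. -/
def AExpr.expr : AExpr C D → Expr C D
  | .sym c => .sym c
  | .var x => .var x
  | .lam b => .lam b
  | .neut a₁ a₂ => .app a₁.expr a₂.expr
  | .beta a₁ a₂ _ => .app a₁.expr a₂.expr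
  | .dist k xs a _ => .dist k xs a.expr

def Stmt.roll : Stmt C D (AExpr C D) → Stmt C D (Expr C D)
  | .assume x a => .assume x a.expr
  | .observe k xs a d => .observe k xs a.expr d

/-- `Program(t)`. -/
def Trace.program (t : Trace C D) : Program C D := t.map Stmt.roll

/-- The value of an augmented expression at position `π` in the environment `σ`.  The last branch of
`beta` does not occur in valid traces. -/
def AExpr.val : AExpr C D → Env C D → Addr → Val C D Addr
  | .sym c, _, _ => .sym c
  | .var x, σ, _ =>
    match σ x with
    | some (_, v) => v
    | none => .clo (.var x) .nil
  | .lam b, σ, _ => σ.closure b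
  | .neut a₁ a₂, σ, π => .app (a₁.val σ (1 :: π)) (a₂.val σ (2 :: π))
  | .beta a₁ a₂ a₃, σ, π =>
    match a₁.val σ (1 :: π) with
    | .clo _ ρ => a₃.val (VEnv.cons (2 :: π) (a₂.val σ (2 :: π)) ρ).toEnv (3 :: π)
    | v => v
  | .dist _ xs _ a', σ, π => a'.val (σ.capture xs).toEnv (2 :: π)

/-- `Exec F σ π e a`: executing `e` at position `π` in the environment `σ` (call by value, no
execution under lambdas) can produce the augmented expression `a`. -/
inductive Exec (F : DistFamily C D) : Env C D → Addr → Expr C D → AExpr C D → Prop where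
  | sym {σ π} (c) : Exec F σ π (.sym c) (.sym c)
  | var {σ π} (x) : (σ x).isSome → Exec F σ π (.var x) (.var x)
  | lam {σ π} (b) : (∀ x ∈ (Expr.lam b).free, (σ x).isSome) → Exec F σ π (.lam b) (.lam b)
  | neut {σ π e₁ e₂ a₁ a₂} :
      Exec F σ (1 :: π) e₁ a₁ → Exec F σ (2 :: π) e₂ a₂ →
      (∀ b ρ, a₁.val σ (1 :: π) ≠ .clo b ρ) →
      Exec F σ π (.app e₁ e₂) (.neut a₁ a₂)
  | beta {σ π e₁ e₂ a₁ a₂ b ρ a₃} :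
      Exec F σ (1 :: π) e₁ a₁ → Exec F σ (2 :: π) e₂ a₂ →
      a₁.val σ (1 :: π) = .clo b ρ →
      Exec F (VEnv.cons (2 :: π) (a₂.val σ (2 :: π)) ρ).toEnv (3 :: π) b a₃ →
      Exec F σ π (.app e₁ e₂) (.beta a₁ a₂ a₃)
  | dist {σ π k xs e a d a'} :
      Exec F σ (1 :: π) e a →
      xs.Nodup → (∀ x ∈ xs, (σ x).isSome) →
      d ∈ (F.pmf k (a.val σ (1 :: π)).bare).support →
      Exec F (σ.capture xs).toEnv (2 :: π) d a' →
      Exec F σ π (.dist k xs e) (.dist k xs a a')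

/-- Executing the program `p`, whose first statement has number `j`, in the environment `σ`. -/
inductive ExecProg (F : DistFamily C D) : Env C D → ℕ → Program C D → Trace C D → Prop where
  | nil {σ j} : ExecProg F σ j [] []
  | assume {σ j x e a p t} :
      Exec F σ [j] e a → ExecProg F (σ.assign x [j] (a.val σ [j])) (j + 1) p t →
      ExecProg F σ j (.assume x e :: p) (.assume x a :: t)
  | observe {σ j k xs e a d p t} :
      Exec F σ [1, j] e a → ExecProg F σ (j + 1) p t →
      ExecProg F σ j (.observe k xs e d :: p) (.observe k xs a d :: t)

/-- `t ∈ Traces(p)`. -/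
def IsTrace (F : DistFamily C D) (p : Program C D) (t : Trace C D) : Prop :=
  ExecProg F Env.empty 0 p t

/-! ## Dependence graphs and subproblems -/

/-- `nodes` is the domain of the node map, `samples` lists the nodes that make a stochastic choice,
`data` and `exist` are the data dependence and the existential edges. -/
structure DepGraph where
  nodes : List Addr
  samples : List Addr
  data : List (Addr × Addr)
  exist : List (Addr × Addr)

def DepGraph.union (G H : DepGraph) : DepGraph :=
  ⟨G.nodes ++ H.nodes, G.samples ++ H.samples, G.data ++ H.data, G.exist ++ H.exist⟩

def AExpr.graph : AExpr C D → Env C D → Addr → DepGraph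
  | .sym _, _, π => ⟨[π], [], [], []⟩
  | .var x, σ, π =>
    match σ x with
    | some (a, _) => ⟨[π], [], [(a, π)], []⟩
    | none => ⟨[π], [], [], []⟩
  | .lam _, _, π => ⟨[π], [], [], []⟩
  | .neut a₁ a₂, σ, π =>
    ((a₁.graph σ (1 :: π)).union (a₂.graph σ (2 :: π))).union
      ⟨[π], [], [(1 :: π, π), (2 :: π, π)], []⟩
  | .beta a₁ a₂ a₃, σ, π =>
    let ρ := match a₁.val σ (1 :: π) with
      | .clo _ ρ => ρ
      | _ => .nil
    let G := a₃.graph (VEnv.cons (2 :: π) (a₂.val σ (2 :: π)) ρ).toEnv (3 :: π)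
    (((a₁.graph σ (1 :: π)).union (a₂.graph σ (2 :: π))).union G).union
      ⟨[π], [], [(1 :: π, π), (3 :: π, π)], G.nodes.map fun n => (1 :: π, n)⟩
  | .dist _ xs a a', σ, π =>
    let G := a'.graph (σ.capture xs).toEnv (2 :: π)
    ((a.graph σ (1 :: π)).union G).union
      ⟨[π, 0 :: π], [0 :: π], [(1 :: π, 0 :: π), (2 :: π, π), (0 :: π, π)],
        G.nodes.map fun n => (0 :: π, n)⟩

def graphFrom (σ : Env C D) (j : ℕ) : Trace C D → DepGraph
  | [] => ⟨[], [], [], []⟩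
  | .assume x a :: t =>
    (a.graph σ [j]).union (graphFrom (σ.assign x [j] (a.val σ [j])) (j + 1) t)
  | .observe _ _ a _ :: t =>
    ((a.graph σ [1, j]).union ⟨[[0, j]], [[0, j]], [([1, j], [0, j])], []⟩).union
      (graphFrom σ (j + 1) t)

/-- `Graph(t)`. -/
def Trace.graph (t : Trace C D) : DepGraph := graphFrom Env.empty 0 t

/-- `S` is a valid subproblem of `t`: no existential edge leaves `S`, and every data dependence edge
that leaves `S` ends at a stochastic choice. -/
structure ValidSubproblem (t : Trace C D) (S : Finset Addr) : Prop where
  subset : ∀ q ∈ S, q ∈ t.graph.nodes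
  exist : ∀ q ∈ S, ∀ r, (q, r) ∈ t.graph.exist → r ∈ S
  data : ∀ q ∈ S, ∀ r, (q, r) ∈ t.graph.data → r ∉ S → r ∈ t.graph.samples

/-- `Sim S π a a'`: the augmented expressions `a` and `a'`, both at position `π`, differ only in the
subproblem `S`. -/
inductive Sim (S : Finset Addr) : Addr → AExpr C D → AExpr C D → Prop where
  | sym {π} (c) : Sim S π (.sym c) (.sym c)
  | var {π} (x) : Sim S π (.var x) (.var x)
  | lam {π} (b) : Sim S π (.lam b) (.lam b)
  | neut {π a₁ a₂ b₁ b₂} :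
      1 :: π ∉ S → Sim S (1 :: π) a₁ b₁ → Sim S (2 :: π) a₂ b₂ →
      Sim S π (.neut a₁ a₂) (.neut b₁ b₂)
  | beta {π a₁ a₂ a₃ b₁ b₂ b₃} :
      1 :: π ∉ S → Sim S (1 :: π) a₁ b₁ → Sim S (2 :: π) a₂ b₂ → Sim S (3 :: π) a₃ b₃ →
      Sim S π (.beta a₁ a₂ a₃) (.beta b₁ b₂ b₃)
  | neut_neut {π a₁ a₂ b₁ b₂} :
      1 :: π ∈ S → Sim S (1 :: π) a₁ b₁ → Sim S (2 :: π) a₂ b₂ →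
      Sim S π (.neut a₁ a₂) (.neut b₁ b₂)
  | neut_beta {π a₁ a₂ b₁ b₂ b₃} :
      1 :: π ∈ S → Sim S (1 :: π) a₁ b₁ → Sim S (2 :: π) a₂ b₂ →
      Sim S π (.neut a₁ a₂) (.beta b₁ b₂ b₃)
  | beta_neut {π a₁ a₂ a₃ b₁ b₂} :
      1 :: π ∈ S → Sim S (1 :: π) a₁ b₁ → Sim S (2 :: π) a₂ b₂ →
      Sim S π (.beta a₁ a₂ a₃) (.neut b₁ b₂)
  | beta_beta {π a₁ a₂ a₃ b₁ b₂ b₃} :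
      1 :: π ∈ S → Sim S (1 :: π) a₁ b₁ → Sim S (2 :: π) a₂ b₂ →
      Sim S π (.beta a₁ a₂ a₃) (.beta b₁ b₂ b₃)
  | dist_out {π k xs a a' b b'} :
      0 :: π ∉ S → Sim S (1 :: π) a b → Sim S (2 :: π) a' b' →
      Sim S π (.dist k xs a a') (.dist k xs b b')
  | dist_in {π k xs a a' b b'} :
      0 :: π ∈ S → Sim S (1 :: π) a b →
      Sim S π (.dist k xs a a') (.dist k xs b b')

inductive SimFrom (S : Finset Addr) : ℕ → Trace C D → Trace C D → Prop where
  | nil {j} : SimFrom S j [] []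
  | assume {j x a b t u} :
      Sim S [j] a b → SimFrom S (j + 1) t u →
      SimFrom S j (.assume x a :: t) (.assume x b :: u)
  | observe {j k xs a b d t u} :
      Sim S [1, j] a b → SimFrom S (j + 1) t u →
      SimFrom S j (.observe k xs a d :: t) (.observe k xs b d :: u)

/-- `S ⊢ t ≡ t'`. -/
def SimTrace (S : Finset Addr) (t t' : Trace C D) : Prop := SimFrom S 0 t t'

/-! ## Extraction and stitching -/

/-- Refer to a variable by the identifier of the expression that assigned it. -/
def Env.toName (σ : Env C D) (x : Var) : Var :=
  match σ x with
  | some (a, _) => .glob a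
  | none => x

/-- Extraction of an augmented expression at position `π` in the environment `σ`: the statements
emitted and the extracted augmented expression.  The bodies of the applications whose operator is
not in `S` are inlined and the stochastic choices not in `S` become `observe` statements.  An
introduced variable is named by the identifier of the expression assigned to it; these names are
distinct, and inlined code refers to its variables by them. -/
def AExpr.extract (S : Finset Addr) : AExpr C D → Env C D → Addr → Trace C D × AExpr C D
  | .sym c, _, _ => ([], .sym c)
  | .var x, σ, _ => ([], .var (σ.toName x))
  | .lam b, σ, _ => ([], .lam (b.rename (Var.under σ.toName)))
  | .neut a₁ a₂, σ, π =>
    let r₁ := a₁.extract S σ (1 :: π)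
    let r₂ := a₂.extract S σ (2 :: π)
    (r₁.1 ++ r₂.1, .neut r₁.2 r₂.2)
  | .beta a₁ a₂ a₃, σ, π =>
    let r₁ := a₁.extract S σ (1 :: π)
    let r₂ := a₂.extract S σ (2 :: π)
    let ρ := match a₁.val σ (1 :: π) with
      | .clo _ ρ => ρ
      | _ => .nil
    let r₃ := a₃.extract S (VEnv.cons (2 :: π) (a₂.val σ (2 :: π)) ρ).toEnv (3 :: π)
    if 1 :: π ∈ S then (r₁.1 ++ r₂.1, .beta r₁.2 r₂.2 a₃)
    else (r₁.1 ++ .assume (1 :: π) r₁.2 :: (r₂.1 ++ .assume (2 :: π) r₂.2 :: r₃.1), r₃.2)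
  | .dist k xs a a', σ, π =>
    let r := a.extract S σ (1 :: π)
    let r' := a'.extract S (σ.capture xs).toEnv (2 :: π)
    if 0 :: π ∈ S then (r.1, .dist k (xs.map σ.toName) r.2 a')
    else (r.1 ++ .observe k (xs.map σ.toName) r.2 a'.expr :: r'.1, r'.2)

def extractFrom (S : Finset Addr) (σ : Env C D) (j : ℕ) : Trace C D → Trace C D
  | [] => []
  | .assume x a :: t =>
    let r := a.extract S σ [j]
    r.1 ++ .assume [j] r.2 :: extractFrom S (σ.assign x [j] (a.val σ [j])) (j + 1) t
  | .observe k xs a d :: t =>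
    let r := a.extract S σ [1, j]
    r.1 ++ .observe k (xs.map σ.toName) r.2 d :: extractFrom S σ (j + 1) t

/-- `ExtractTrace(t, S)`. -/
def extractTrace (t : Trace C D) (S : Finset Addr) : Trace C D := extractFrom S Env.empty 0 t

/-- The number of statements emitted by the extraction of an augmented expression. -/
def AExpr.emitted (S : Finset Addr) : AExpr C D → Addr → ℕ
  | .sym _, _ => 0
  | .var _, _ => 0
  | .lam _, _ => 0
  | .neut a₁ a₂, π => a₁.emitted S (1 :: π) + a₂.emitted S (2 :: π)
  | .beta a₁ a₂ a₃, π =>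
    if 1 :: π ∈ S then a₁.emitted S (1 :: π) + a₂.emitted S (2 :: π)
    else a₁.emitted S (1 :: π) + 1 + (a₂.emitted S (2 :: π) + 1 + a₃.emitted S (3 :: π))
  | .dist _ _ a a', π =>
    if 0 :: π ∈ S then a.emitted S (1 :: π)
    else a.emitted S (1 :: π) + 1 + a'.emitted S (2 :: π)

/-- Stitching the extracted augmented expression `b`, with emitted statements `s`, back into the
augmented expression at position `π`.  (If the shapes do not match, which does not happen for a
trace of the subprogram, the original is returned.) -/
def AExpr.stitch (S : Finset Addr) : AExpr C D → Addr → Trace C D → AExpr C D → AExpr C D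
  | .sym c, _, _, _ => .sym c
  | .var x, _, _, _ => .var x
  | .lam b, _, _, _ => .lam b
  | .neut a₁ a₂, π, s, b =>
    let n := a₁.emitted S (1 :: π)
    match b with
    | .neut b₁ b₂ =>
      .neut (a₁.stitch S (1 :: π) (s.take n) b₁) (a₂.stitch S (2 :: π) (s.drop n) b₂)
    | .beta b₁ b₂ b₃ =>
      if 1 :: π ∈ S then
        .beta (a₁.stitch S (1 :: π) (s.take n) b₁) (a₂.stitch S (2 :: π) (s.drop n) b₂) b₃
      else .neut a₁ a₂
    | _ => .neut a₁ a₂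
  | .beta a₁ a₂ a₃, π, s, b =>
    let n := a₁.emitted S (1 :: π)
    if 1 :: π ∈ S then
      match b with
      | .neut b₁ b₂ =>
        .neut (a₁.stitch S (1 :: π) (s.take n) b₁) (a₂.stitch S (2 :: π) (s.drop n) b₂)
      | .beta b₁ b₂ b₃ =>
        .beta (a₁.stitch S (1 :: π) (s.take n) b₁) (a₂.stitch S (2 :: π) (s.drop n) b₂) b₃
      | _ => .beta a₁ a₂ a₃
    else
      match s.drop n with
      | .assume _ b₁ :: s' =>
        let n' := a₂.emitted S (2 :: π)
        match s'.drop n' with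
        | .assume _ b₂ :: s'' =>
          .beta (a₁.stitch S (1 :: π) (s.take n) b₁) (a₂.stitch S (2 :: π) (s'.take n') b₂)
            (a₃.stitch S (3 :: π) s'' b)
        | _ => .beta a₁ a₂ a₃
      | _ => .beta a₁ a₂ a₃
  | .dist k xs a a', π, s, b =>
    let n := a.emitted S (1 :: π)
    if 0 :: π ∈ S then
      match b with
      | .dist _ _ b₁ b' => .dist k xs (a.stitch S (1 :: π) s b₁) b'
      | _ => .dist k xs a a'
    else
      match s.drop n with
      | .observe _ _ b₁ _ :: s' =>
        .dist k xs (a.stitch S (1 :: π) (s.take n) b₁) (a'.stitch S (2 :: π) s' b)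
      | _ => .dist k xs a a'

def stitchFrom (S : Finset Addr) (j : ℕ) : Trace C D → Trace C D → Trace C D
  | [], _ => []
  | .assume x a :: t, s =>
    let n := a.emitted S [j]
    match s.drop n with
    | .assume _ b :: s' => .assume x (a.stitch S [j] (s.take n) b) :: stitchFrom S (j + 1) t s'
    | _ => .assume x a :: t
  | .observe k xs a d :: t, s =>
    let n := a.emitted S [1, j]
    match s.drop n with
    | .observe _ _ b _ :: s' =>
      .observe k xs (a.stitch S [1, j] (s.take n) b) d :: stitchFrom S (j + 1) t s'
    | _ => .observe k xs a d :: t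

/-- `StitchTrace(t, s, S)`. -/
def stitchTrace (t s : Trace C D) (S : Finset Addr) : Trace C D := stitchFrom S 0 t s

end Calculus

/-! ## Markov kernels -/

section Markov

variable {T : Type*} [MeasurableSpace T]

/-- `π`-irreducibility: every set of positive measure is reached with positive probability in some
positive number of steps, from every state. -/
def PiIrreducible (κ : Kernel T T) (π : Measure T) : Prop :=
  ∀ t A, MeasurableSet A → 0 < π A → ∃ n : ℕ, 1 ≤ n ∧ 0 < (κ ^ n) t A

/-- `E 0, …, E (d - 1)` and the null set `N` partition the space, and the kernel moves `E i` to
`E (i + 1 mod d)` with probability one. -/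
structure IsCycle (κ : Kernel T T) (π : Measure T) (d : ℕ) (E : ℕ → Set T) (N : Set T) : Prop where
  measurable : ∀ i < d, MeasurableSet (E i)
  measurable_null : MeasurableSet N
  nonempty : ∀ i < d, (E i).Nonempty
  disjoint : ∀ i < d, ∀ j < d, i ≠ j → Disjoint (E i) (E j)
  disjoint_null : ∀ i < d, Disjoint (E i) N
  cover : (⋃ i < d, E i) ∪ N = Set.univ
  step : ∀ i < d, ∀ t ∈ E i, κ t (E ((i + 1) % d)) = 1
  null : π N = 0

def Aperiodic (κ : Kernel T T) (π : Measure T) : Prop :=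
  ¬ ∃ d E N, 2 ≤ d ∧ IsCycle κ π d E N

/-- A Markov transition kernel that is `π`-irreducible, aperiodic, and has stationary
distribution `π`. -/
structure IsErgodicFor (κ : Kernel T T) (π : Measure T) : Prop where
  markov : IsMarkovKernel κ
  irreducible : PiIrreducible κ π
  aperiodic : Aperiodic κ π
  stationary : κ.Invariant π

end Markov

/-! ## The posterior distribution on traces -/

section Posterior

variable {C D : Type}

/-- The factor contributed by an augmented expression to the unnormalized density of a trace. -/
noncomputable def AExpr.density (F : DistFamily C D) : AExpr C D → Env C D → Addr → ℝ≥0∞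
  | .sym _, _, _ => 1
  | .var _, _, _ => 1
  | .lam _, _, _ => 1
  | .neut a₁ a₂, σ, π => a₁.density F σ (1 :: π) * a₂.density F σ (2 :: π)
  | .beta a₁ a₂ a₃, σ, π =>
    let ρ := match a₁.val σ (1 :: π) with
      | .clo _ ρ => ρ
      | _ => .nil
    a₁.density F σ (1 :: π) * a₂.density F σ (2 :: π) *
      a₃.density F (VEnv.cons (2 :: π) (a₂.val σ (2 :: π)) ρ).toEnv (3 :: π)
  | .dist k xs a a', σ, π =>
    a.density F σ (1 :: π) * a'.density F (σ.capture xs).toEnv (2 :: π) *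
      F.pmf k (a.val σ (1 :: π)).bare a'.expr

noncomputable def densityFrom (F : DistFamily C D) (σ : Env C D) (j : ℕ) : Trace C D → ℝ≥0∞
  | [] => 1
  | .assume x a :: t =>
    a.density F σ [j] * densityFrom F (σ.assign x [j] (a.val σ [j])) (j + 1) t
  | .observe k _ a d :: t =>
    F.pmf k (a.val σ [1, j]).bare d * a.density F σ [1, j] * densityFrom F σ (j + 1) t

/-- The unnormalized density of a trace. -/
noncomputable def Trace.density (F : DistFamily C D) (t : Trace C D) : ℝ≥0∞ :=
  densityFrom F Env.empty 0 t

/-- The trace space of `p`: the valid traces of `p` that have positive density. -/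
def TraceSpace (F : DistFamily C D) (p : Program C D) : Type :=
  {t : Trace C D // IsTrace F p t ∧ t.density F ≠ 0}

instance (F : DistFamily C D) (p : Program C D) : MeasurableSpace (TraceSpace F p) := ⊤

/-- The normalizing constant. -/
noncomputable def partition (F : DistFamily C D) (p : Program C D) : ℝ≥0∞ :=
  ∑' t : TraceSpace F p, t.1.density F

/-- The posterior distribution of `p` is defined. -/
def HasPosterior (F : DistFamily C D) (p : Program C D) : Prop :=
  partition F p ≠ 0 ∧ partition F p ≠ ∞

/-- The posterior distribution `μ_p`. -/
noncomputable def posterior (F : DistFamily C D) (p : Program C D) : Measure (TraceSpace F p) :=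
  Measure.sum fun t => (t.1.density F / partition F p) • Measure.dirac t

/-! ## Inference metaprograms -/

/-- The kernel on the trace space of `p` given by a random map on traces. -/
noncomputable def kernelOn (F : DistFamily C D) (K : Trace C D → PMF (Trace C D))
    (p : Program C D) : Kernel (TraceSpace F p) (TraceSpace F p) where
  toFun t := Measure.sum fun u : TraceSpace F p => (K t.1 u.1) • Measure.dirac u
  measurable' := measurable_from_top

/-- Generalized Markov kernels: inference algorithms that, on the trace space of every program
whose posterior distribution is defined, are Markov kernels that are irreducible and aperiodic and
have the posterior as stationary distribution.  (The program is part of the input as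
`Trace.program`.) -/
def IsGeneralizedMarkovKernel (F : DistFamily C D) (K : Trace C D → PMF (Trace C D)) : Prop :=
  ∀ p, HasPosterior F p → IsErgodicFor (kernelOn F K p) (posterior F p)

/-- Subproblem selection strategies: they return a valid subproblem of every valid trace. -/
structure Strategy (F : DistFamily C D) where
  sel : Trace C D → Finset Addr
  valid : ∀ p t, IsTrace F p t → ValidSubproblem t (sel t)

/-- `SS ⊢ t ≡ t'`. -/
def Strategy.Rel {F : DistFamily C D} (SS : Strategy F) (t t' : Trace C D) : Prop :=
  SimTrace (SS.sel t) t t'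

/-- `SS` is reversible on the traces of `p`: a chain of changes within the selected subproblems can
be undone by one change within the subproblem selected at its end. -/
def Strategy.Reversible {F : DistFamily C D} (SS : Strategy F) (p : Program C D) : Prop :=
  ∀ (n : ℕ) (t : ℕ → TraceSpace F p),
    (∀ i < n, SS.Rel (t i).1 (t (i + 1)).1) → SS.Rel (t n).1 (t 0).1

/-- `SS` makes the same selection in equivalent traces: if `SS ⊢ t ≡ t'`, then every node of `t`
that controls the existence of other nodes, and that does not itself depend existentially on the
subproblem selected in `t` (so that it is a node of `t'` as well), is selected in both of `t`, `t'`
or in neither. -/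
def Strategy.Consistent {F : DistFamily C D} (SS : Strategy F) (p : Program C D) : Prop :=
  ∀ t t' : TraceSpace F p, SS.Rel t.1 t'.1 →
    ∀ q, (∃ r, (q, r) ∈ t.1.graph.exist) → (¬ ∃ s ∈ SS.sel t.1, (s, q) ∈ t.1.graph.exist) →
      (q ∈ SS.sel t.1 ↔ q ∈ SS.sel t'.1)

/-- The first component `f_x` of the class function of `SS`: the equivalence class of a trace. -/
def Strategy.cls {F : DistFamily C D} (SS : Strategy F) (p : Program C D)
    (t : TraceSpace F p) : Set (TraceSpace F p) :=
  {t' | SS.Rel t.1 t'.1}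

/-- The class functions `f_1, …, f_k` of the strategies connect the probability space of `p`:
if a nonempty set `A` is such that the sets `f_i⁻¹(f_i(A))` all agree up to null sets, then they have
full measure. -/
def Connects {F : DistFamily C D} {k : ℕ} (SS : Fin k → Strategy F) (p : Program C D) : Prop :=
  ∀ A : Set (TraceSpace F p), A.Nonempty →
    (∀ i j, posterior F p
      ((SS i).cls p ⁻¹' ((SS i).cls p '' A) ∩ (SS j).cls p ⁻¹' ((SS j).cls p '' A)ᶜ) = 0) →
    ∃ i, posterior F p ((SS i).cls p ⁻¹' ((SS i).cls p '' A)ᶜ) = 0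

/-- Inference metaprograms: a black box generalized Markov kernel, or
`{w_1 infer(SS_1, ip_1), …, w_k infer(SS_k, ip_k)}` with positive probabilities `w_i` of sum one. -/
inductive MetaProg (F : DistFamily C D) where
  | blackBox (K : Trace C D → PMF (Trace C D)) (hK : IsGeneralizedMarkovKernel F K)
  | infer (k : ℕ) (w : PMF (Fin k)) (hw : ∀ i, w i ≠ 0) (SS : Fin k → Strategy F)
      (ip : Fin k → MetaProg F)

/-- Execution of an inference metaprogram: choose a statement at random, extract the selected
subtrace, run the inner metaprogram on it, and stitch the result back. -/
noncomputable def MetaProg.run {F : DistFamily C D} : MetaProg F → Trace C D → PMF (Trace C D)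
  | .blackBox K _, t => K t
  | .infer _ w _ SS ip, t =>
    w.bind fun i =>
      ((ip i).run (extractTrace t ((SS i).sel t))).map fun s => stitchTrace t s ((SS i).sel t)

/-- All strategies used when the metaprogram is run on `p` are reversible and consistent on, and
(those of each set of `infer` statements together) connect, the trace space of the program they are
applied to: `p` for the outermost ones, and the extracted subprograms for the nested ones. -/
def MetaProg.Admissible {F : DistFamily C D} : MetaProg F → Program C D → Prop
  | .blackBox _ _, _ => True
  | .infer _ _ _ SS ip, p =>
    (∀ i, (SS i).Reversible p ∧ (SS i).Consistent p) ∧ Connects SS p ∧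
      ∀ i, ∀ t : TraceSpace F p,
        (ip i).Admissible (Trace.program (extractTrace t.1 ((SS i).sel t.1)))

end Posterior

end InferMeta

-- Fix a strategy that is reversible and consistent on `p`. Reversibility makes `SS.Rel` an
-- equivalence relation on the trace space. Everything rests on one fact: on each class, extraction
-- is a density-preserving bijection onto the trace space of a single subprogram, with stitching as
-- its inverse (`Strategy.classEquiv`, `Strategy.density_sub`). Consistency enters only through
-- `Strategy.sub_eq_extract`: every member of a class can be extracted with the subproblem selected
-- at one fixed member, so a single set `S` serves the whole class.
--
-- For a fixed `S` the bijection is an induction over augmented expressions. Extraction changes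
-- positions and variable names, so values are compared after erasing identifiers (`Val.bare`),
-- which is all that the densities see. Data edges leaving `S` end at sample nodes only; hence an
-- expression node outside `S` gets its value along nodes outside `S`. An operator outside `S` is
-- therefore a closure whose captured variables all have names in the extracted program, so its body
-- can be inlined there (`AExpr.extract_spec`), and it has the same code in every equivalent trace
-- (`Sim.transfer`), so equivalent traces extract to the same program (`Sim.program_extract`).
-- `Sim.stitch_extract` and `AExpr.stitch_spec` show that stitching and extraction are mutually
-- inverse.
--
-- On a class, the lifted kernel is the inner kernel transported along this bijection. It thus
-- connects any two members of the class, admits no cyclic function, and preserves the density; the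
-- different normalizing constants do not matter because stationarity is homogeneous. Every trace
-- has positive mass, so null sets are empty and ergodicity becomes a property of a transition
-- matrix (`isErgodicFor_iff`). For the mixture, stationarity is linear in the kernel, and a cyclic
-- function would be cyclic for each component. The set reachable from a trace is a union of classes
-- of every strategy, so each of its saturations equals the set itself, and the connecting condition
-- makes it the whole space. Induction on the metaprogram finishes the proof; the subprogram has a
-- posterior because its normalizing constant is the sum of the densities over a class.

namespace InferMeta

-- Renaming of variables in expressions

section Renaming

variable {C D : Type}

theorem Var.unshift_shift (x : Var) : x.shift.unshift = some x := by
  cases x <;> rfl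

theorem Var.under_under (f g : Var → Var) (x : Var) :
    Var.under f (Var.under g x) = Var.under (fun y => f (g y)) x := by
  rcases x with x | (_ | i)
  · simp only [Var.under]; cases g (.glob x) <;> rfl
  · rfl
  · simp only [Var.under]; cases g (.loc i) <;> rfl

theorem Var.unshift_under (f : Var → Var) (x : Var) :
    (Var.under f x).unshift = x.unshift.map f := by
  rcases x with x | (_ | i)
  · exact Var.unshift_shift _
  · rfl
  · exact Var.unshift_shift _

theorem Var.under_congr {f g : Var → Var} {x : Var} (h : ∀ y, x.unshift = some y → f y = g y) :
    Var.under f x = Var.under g x := by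
  rcases x with x | (_ | i)
  · simp [Var.under, h _ rfl]
  · rfl
  · simp [Var.under, h _ rfl]

theorem Expr.rename_rename (e : Expr C D) (f g : Var → Var) :
    (e.rename g).rename f = e.rename fun x => f (g x) := by
  induction e generalizing f g with
  | sym c => rfl
  | var x => rfl
  | lam b ih => simp only [Expr.rename, ih, Var.under_under]
  | dist k xs e ih => simp [Expr.rename, ih, Function.comp_def]
  | app e₁ e₂ ih₁ ih₂ => simp only [Expr.rename, ih₁, ih₂]

theorem Expr.rename_congr (e : Expr C D) {f g : Var → Var} (h : ∀ x ∈ e.free, f x = g x) :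
    e.rename f = e.rename g := by
  induction e generalizing f g with
  | sym c => rfl
  | var x => simp [Expr.rename, h x (by simp [Expr.free])]
  | lam b ih =>
    simp only [Expr.rename, Expr.lam.injEq]
    exact ih fun x hx => Var.under_congr fun y hy =>
      h y (List.mem_filterMap.2 ⟨x, hx, hy⟩)
  | dist k xs e ih =>
    simp only [Expr.free, List.mem_append] at h
    simp only [Expr.rename, Expr.dist.injEq, true_and]
    exact ⟨List.map_congr_left fun x hx => h x (.inr hx), ih fun x hx => h x (.inl hx)⟩
  | app e₁ e₂ ih₁ ih₂ =>
    simp only [Expr.free, List.mem_append] at h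
    simp only [Expr.rename, Expr.app.injEq]
    exact ⟨ih₁ fun x hx => h x (.inl hx), ih₂ fun x hx => h x (.inr hx)⟩

theorem Expr.free_rename (e : Expr C D) (f : Var → Var) : (e.rename f).free = e.free.map f := by
  induction e generalizing f with
  | sym c => rfl
  | var x => rfl
  | lam b ih =>
    simp only [Expr.rename, Expr.free, ih, List.filterMap_map, List.map_filterMap]
    congr 1
    funext x
    simp [Var.unshift_under]
  | dist k xs e ih => simp [Expr.rename, Expr.free, ih]
  | app e₁ e₂ ih₁ ih₂ => simp [Expr.rename, Expr.free, ih₁, ih₂]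

theorem dedup_map_of_injOn {α β : Type*} [DecidableEq α] [DecidableEq β] {f : α → β} {l : List α}
    (h : ∀ x ∈ l, ∀ y ∈ l, f x = f y → x = y) : (l.map f).dedup = l.dedup.map f := by
  induction l with
  | nil => rfl
  | cons a l ih =>
    have ih := ih fun x hx y hy => h x (by simp [hx]) y (by simp [hy])
    by_cases ha : a ∈ l
    · rw [List.map_cons, List.dedup_cons_of_mem ha,
        List.dedup_cons_of_mem (List.mem_map_of_mem ha), ih]
    · have : f a ∉ l.map f := by
        intro hf
        obtain ⟨b, hb, hab⟩ := List.mem_map.1 hf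
        exact ha (h b (by simp [hb]) a (by simp) hab ▸ hb)
      rw [List.map_cons, List.dedup_cons_of_notMem ha, List.dedup_cons_of_notMem this, ih,
        List.map_cons]

theorem idxOf_map_of_injOn {α β : Type*} [DecidableEq α] [DecidableEq β] {f : α → β} {l : List α}
    {a : α} (h : ∀ x ∈ l, f x = f a → x = a) : (l.map f).idxOf (f a) = l.idxOf a := by
  induction l with
  | nil => rfl
  | cons b l ih =>
    have ih := ih fun x hx => h x (by simp [hx])
    by_cases hb : b = a
    · subst hb; simp
    · have : f b ≠ f a := fun e => hb (h b (by simp) e)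
      rw [List.map_cons, List.idxOf_cons_ne _ this, List.idxOf_cons_ne _ hb, ih]

end Renaming

-- Values and validity up to identifiers

section Bare

variable {C D : Type}

/-- The values bound by an environment, without identifiers. -/
def Env.bares (σ : Env C D) (x : Var) : Option (BareVal C D) := (σ x).map fun p => p.2.bare

theorem Env.isSome_of_bares {σ τ : Env C D} {x y : Var} (h : σ.bares x = τ.bares y)
    (hx : (σ x).isSome) : (τ y).isSome := by
  have : (τ.bares y).isSome := by rw [← h]; simpa [Env.bares] using hx
  simpa [Env.bares] using this

theorem VEnv.get_bare : ∀ {ρ ρ' : VEnv C D Addr}, ρ.bare = ρ'.bare → ∀ i,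
    (ρ.get i).map (fun p => p.2.bare) = (ρ'.get i).map fun p => p.2.bare
  | .nil, .nil, _, _ => rfl
  | .nil, .cons _ _ _, h, _ => by simp [VEnv.bare] at h
  | .cons _ _ _, .nil, h, _ => by simp [VEnv.bare] at h
  | .cons a v ρ, .cons a' v' ρ', h, i => by
    simp only [VEnv.bare, VEnv.cons.injEq, true_and] at h
    cases i with
    | zero => simp [VEnv.get, h.1]
    | succ i => exact VEnv.get_bare h.2 i

theorem VEnv.toEnv_bares {ρ ρ' : VEnv C D Addr} (h : ρ.bare = ρ'.bare) :
    ρ.toEnv.bares = ρ'.toEnv.bares := by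
  funext x
  cases x with
  | glob x => rfl
  | loc i => exact VEnv.get_bare h i

theorem Env.capture_map_bare {σ τ : Env C D} {f : Var → Var} {xs : List Var}
    (h : ∀ x ∈ xs, τ.bares (f x) = σ.bares x) :
    (τ.capture (xs.map f)).bare = (σ.capture xs).bare := by
  induction xs with
  | nil => rfl
  | cons x xs ih =>
    have ih := ih fun y hy => h y (by simp [hy])
    have hx := h x (by simp)
    simp only [Env.bares] at hx
    simp only [List.map_cons, Env.capture]
    rcases h₁ : σ x with _ | ⟨a, v⟩ <;> rcases h₂ : τ (f x) with _ | ⟨a', v'⟩ <;>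
      simp_all [VEnv.bare]

theorem Env.capture_bare {σ τ : Env C D} (h : σ.bares = τ.bares) (xs : List Var) :
    (σ.capture xs).bare = (τ.capture xs).bare := by
  simpa using Env.capture_map_bare (σ := τ) (τ := σ) (f := id) (xs := xs) fun x _ => by simp [h]

theorem Env.closure_bare {σ τ : Env C D} (h : σ.bares = τ.bares) (b : Expr C D) :
    (σ.closure b).bare = (τ.closure b).bare := by
  simp [Env.closure, Val.bare, Env.capture_bare h]

/-- A closure stores its free variables as indices into their deduplicated list. A renaming that is
injective on these variables preserves the indices; one that merged two of them would shorten the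
list and change the stored body. This is why environments must bind distinct identifiers. -/
theorem Env.closure_rename_bare {σ τ : Env C D} {f : Var → Var} {b : Expr C D}
    (h : ∀ x ∈ (Expr.lam b).free, τ.bares (f x) = σ.bares x)
    (hf : ∀ x ∈ (Expr.lam b).free, ∀ y ∈ (Expr.lam b).free, f x = f y → x = y) :
    (τ.closure (b.rename (Var.under f))).bare = (σ.closure b).bare := by
  have hfree : (Expr.lam (b.rename (Var.under f))).free = (Expr.lam b).free.map f :=
    Expr.free_rename (Expr.lam b) f
  simp only [Env.closure, Val.bare, Val.clo.injEq]
  rw [hfree, dedup_map_of_injOn hf]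
  refine ⟨?_, Env.capture_map_bare fun x hx => h x (List.mem_dedup.1 hx)⟩
  rw [Expr.rename_rename]
  refine Expr.rename_congr _ fun x hx => ?_
  rw [Var.under_under]
  refine Var.under_congr fun y hy => ?_
  have hy : y ∈ (Expr.lam b).free := List.mem_filterMap.2 ⟨x, hx, hy⟩
  rw [idxOf_map_of_injOn fun x hx => hf x (List.mem_dedup.1 hx) y hy]

theorem Val.clo_of_bare {v : Val C D Addr} {b : Expr C D} {ρ : VEnv C D Unit}
    (h : v.bare = .clo b ρ) : ∃ ρ', v = .clo b ρ' ∧ ρ'.bare = ρ := by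
  cases v <;> simp_all [Val.bare]

/-- Evaluation passes identifiers along but never inspects them, and positions enter a value only as
identifiers. -/
theorem AExpr.val_bare (a : AExpr C D) {σ τ : Env C D} (h : σ.bares = τ.bares) (π ϖ : Addr) :
    (a.val σ π).bare = (a.val τ ϖ).bare := by
  induction a generalizing σ τ π ϖ with
  | sym c => rfl
  | var x =>
    have hx := congrFun h x
    simp only [Env.bares] at hx
    simp only [AExpr.val]
    rcases h₁ : σ x with _ | ⟨a, v⟩ <;> rcases h₂ : τ x with _ | ⟨a', v'⟩ <;> simp_all
  | lam b => exact Env.closure_bare h b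
  | neut a₁ a₂ ih₁ ih₂ => simp only [AExpr.val, Val.bare, ih₁ h (1 :: π) (1 :: ϖ),
      ih₂ h (2 :: π) (2 :: ϖ)]
  | beta a₁ a₂ a₃ ih₁ ih₂ ih₃ =>
    have h₁ := ih₁ h (1 :: π) (1 :: ϖ)
    have h₂ := ih₂ h (2 :: π) (2 :: ϖ)
    simp only [AExpr.val]
    rcases e₁ : a₁.val σ (1 :: π) with c | ⟨v, w⟩ | ⟨b, ρ⟩ <;>
    rcases e₂ : a₁.val τ (1 :: ϖ) with c' | ⟨v', w'⟩ | ⟨b', ρ'⟩ <;>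
    rw [e₁, e₂] at h₁ <;> simp only [Val.bare, reduceCtorEq] at h₁ ⊢ <;> try exact h₁
    refine ih₃ (VEnv.toEnv_bares ?_) _ _
    simp_all [VEnv.bare]
  | dist k xs a a' ih ih' => exact ih' (VEnv.toEnv_bares (Env.capture_bare h xs)) _ _

/-- The augmented expression is one that the execution of `a.expr` can produce. -/
def AExpr.Ok (F : DistFamily C D) : AExpr C D → Env C D → Addr → Prop
  | .sym _, _, _ => True
  | .var x, σ, _ => (σ x).isSome
  | .lam b, σ, _ => ∀ x ∈ (Expr.lam b).free, (σ x).isSome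
  | .neut a₁ a₂, σ, π => a₁.Ok F σ (1 :: π) ∧ a₂.Ok F σ (2 :: π) ∧
      ∀ b ρ, a₁.val σ (1 :: π) ≠ .clo b ρ
  | .beta a₁ a₂ a₃, σ, π => a₁.Ok F σ (1 :: π) ∧ a₂.Ok F σ (2 :: π) ∧
      ∃ ρ, a₁.val σ (1 :: π) = .clo a₃.expr ρ ∧
        a₃.Ok F (VEnv.cons (2 :: π) (a₂.val σ (2 :: π)) ρ).toEnv (3 :: π)
  | .dist k xs a a', σ, π => a.Ok F σ (1 :: π) ∧ xs.Nodup ∧ (∀ x ∈ xs, (σ x).isSome) ∧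
      a'.expr ∈ (F.pmf k (a.val σ (1 :: π)).bare).support ∧
      a'.Ok F (σ.capture xs).toEnv (2 :: π)

variable {F : DistFamily C D}

/-- An augmented expression determines the expression it executes, so `Exec` can be traded for a
predicate that recurses on the augmented expression alone; `AExpr.Ok.exec` is the converse. -/
theorem Exec.expr_eq_and_ok {σ : Env C D} {π : Addr} {e : Expr C D} {a : AExpr C D}
    (h : Exec F σ π e a) : a.expr = e ∧ a.Ok F σ π := by
  induction h with
  | sym c => exact ⟨rfl, trivial⟩
  | var x h => exact ⟨rfl, h⟩
  | lam b h => exact ⟨rfl, h⟩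
  | neut _ _ h ih₁ ih₂ =>
    exact ⟨by simp [AExpr.expr, ih₁.1, ih₂.1], ih₁.2, ih₂.2, h⟩
  | beta _ _ h _ ih₁ ih₂ ih₃ =>
    exact ⟨by simp [AExpr.expr, ih₁.1, ih₂.1], ih₁.2, ih₂.2, _, by rw [h, ih₃.1], ih₃.2⟩
  | dist _ hn hs hd _ ih ih' =>
    exact ⟨by simp [AExpr.expr, ih.1], ih.2, hn, hs, by rwa [ih'.1], ih'.2⟩

theorem AExpr.Ok.exec {a : AExpr C D} {σ : Env C D} {π : Addr} (h : a.Ok F σ π) :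
    Exec F σ π a.expr a := by
  induction a generalizing σ π with
  | sym c => exact .sym c
  | var x => exact .var x h
  | lam b => exact .lam b h
  | neut a₁ a₂ ih₁ ih₂ => exact .neut (ih₁ h.1) (ih₂ h.2.1) h.2.2
  | beta a₁ a₂ a₃ ih₁ ih₂ ih₃ =>
    obtain ⟨h₁, h₂, ρ, hρ, h₃⟩ := h
    exact .beta (ih₁ h₁) (ih₂ h₂) hρ (ih₃ h₃)
  | dist k xs a a' ih ih' =>
    obtain ⟨h₁, hn, hs, hd, h₂⟩ := h
    exact .dist (ih h₁) hn hs hd (ih' h₂)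

/-- Whether an application reduces, and with which body, can be read off the bare operator value,
and distributions take bare parameters. Bodies and sampled expressions that stay unchanged under
extraction therefore remain valid at their new position. -/
theorem AExpr.Ok.congr {a : AExpr C D} {σ τ : Env C D} {π : Addr} (ha : a.Ok F σ π)
    (h : σ.bares = τ.bares) (ϖ : Addr) : a.Ok F τ ϖ := by
  induction a generalizing σ τ π ϖ with
  | sym c => trivial
  | var x => exact Env.isSome_of_bares (congrFun h x) ha
  | lam b => exact fun x hx => Env.isSome_of_bares (congrFun h x) (ha x hx)
  | neut a₁ a₂ ih₁ ih₂ =>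
    refine ⟨ih₁ ha.1 h _, ih₂ ha.2.1 h _, fun b ρ hb => ?_⟩
    have := a₁.val_bare h (1 :: π) (1 :: ϖ)
    rw [hb] at this
    obtain ⟨ρ', h', _⟩ := Val.clo_of_bare this
    exact ha.2.2 _ _ h'
  | beta a₁ a₂ a₃ ih₁ ih₂ ih₃ =>
    obtain ⟨h₁, h₂, ρ, hρ, h₃⟩ := ha
    have hb := a₁.val_bare h (1 :: π) (1 :: ϖ)
    rw [hρ] at hb
    obtain ⟨ρ', h', hρ'⟩ := Val.clo_of_bare hb.symm
    refine ⟨ih₁ h₁ h _, ih₂ h₂ h _, ρ', h', ih₃ h₃ (VEnv.toEnv_bares ?_) _⟩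
    simp [VEnv.bare, hρ', a₂.val_bare h (2 :: π) (2 :: ϖ)]
  | dist k xs a a' ih ih' =>
    obtain ⟨h₁, hn, hs, hd, h₂⟩ := ha
    refine ⟨ih h₁ h _, hn, fun x hx => Env.isSome_of_bares (congrFun h x) (hs x hx), ?_,
      ih' h₂ (VEnv.toEnv_bares (Env.capture_bare h xs)) _⟩
    rwa [← a.val_bare h (1 :: π) (1 :: ϖ)]

theorem AExpr.density_beta {a₁ a₂ a₃ : AExpr C D} {σ : Env C D} {π : Addr} {b : Expr C D}
    {ρ : VEnv C D Addr} (h : a₁.val σ (1 :: π) = .clo b ρ) :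
    (AExpr.beta a₁ a₂ a₃).density F σ π = a₁.density F σ (1 :: π) * a₂.density F σ (2 :: π) *
      a₃.density F (VEnv.cons (2 :: π) (a₂.val σ (2 :: π)) ρ).toEnv (3 :: π) := by
  simp only [AExpr.density, h]

theorem AExpr.Ok.density_congr {a : AExpr C D} {σ τ : Env C D} {π : Addr} (ha : a.Ok F σ π)
    (h : σ.bares = τ.bares) (ϖ : Addr) : a.density F σ π = a.density F τ ϖ := by
  induction a generalizing σ τ π ϖ with
  | sym c => rfl
  | var x => rfl
  | lam b => rfl
  | neut a₁ a₂ ih₁ ih₂ =>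
    simp only [AExpr.density, ih₁ ha.1 h (1 :: ϖ), ih₂ ha.2.1 h (2 :: ϖ)]
  | beta a₁ a₂ a₃ ih₁ ih₂ ih₃ =>
    obtain ⟨h₁, h₂, ρ, hρ, h₃⟩ := ha
    have hb := a₁.val_bare h (1 :: π) (1 :: ϖ)
    rw [hρ] at hb
    obtain ⟨ρ', h', hρ'⟩ := Val.clo_of_bare hb.symm
    rw [AExpr.density_beta hρ, AExpr.density_beta h', ih₁ h₁ h (1 :: ϖ), ih₂ h₂ h (2 :: ϖ),
      ih₃ h₃ (VEnv.toEnv_bares _) (3 :: ϖ)]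
    simp [VEnv.bare, hρ', a₂.val_bare h (2 :: π) (2 :: ϖ)]
  | dist k xs a a' ih ih' =>
    obtain ⟨h₁, hn, hs, hd, h₂⟩ := ha
    simp only [AExpr.density, ih h₁ h (1 :: ϖ), a.val_bare h (1 :: π) (1 :: ϖ),
      ih' h₂ (VEnv.toEnv_bares (Env.capture_bare h xs)) (2 :: ϖ)]

theorem AExpr.Ok.density_ne_zero {a : AExpr C D} {σ : Env C D} {π : Addr} (ha : a.Ok F σ π) :
    a.density F σ π ≠ 0 := by
  induction a generalizing σ π with
  | sym c => exact one_ne_zero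
  | var x => exact one_ne_zero
  | lam b => exact one_ne_zero
  | neut a₁ a₂ ih₁ ih₂ => exact mul_ne_zero (ih₁ ha.1) (ih₂ ha.2.1)
  | beta a₁ a₂ a₃ ih₁ ih₂ ih₃ =>
    obtain ⟨h₁, h₂, ρ, hρ, h₃⟩ := ha
    rw [AExpr.density_beta hρ]
    exact mul_ne_zero (mul_ne_zero (ih₁ h₁) (ih₂ h₂)) (ih₃ h₃)
  | dist k xs a a' ih ih' =>
    obtain ⟨h₁, hn, hs, hd, h₂⟩ := ha
    exact mul_ne_zero (mul_ne_zero (ih h₁) (ih' h₂)) ((PMF.mem_support_iff _ _).1 hd)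

end Bare

-- The tree of positions

section Positions

/-- `q` is a position strictly below `π`. -/
def Under (π q : Addr) : Prop := π <:+ q ∧ q ≠ π

theorem under_of_cons_suffix {i : ℕ} {π q : Addr} (h : i :: π <:+ q) : Under π q := by
  refine ⟨(List.suffix_cons i π).trans h, ?_⟩
  rintro rfl
  have := h.length_le
  simp at this

theorem under_cons (i : ℕ) (π : Addr) : Under π (i :: π) :=
  under_of_cons_suffix (List.suffix_refl _)

theorem Under.of_cons {i : ℕ} {π q : Addr} (h : Under (i :: π) q) : Under π q :=
  under_of_cons_suffix h.1

/-- Addresses grow at the head, so ancestors are suffixes, and two suffixes of `q` of equal length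
coincide. Disjointness of the subtrees of siblings is the source of all freshness arguments below.
-/
theorem not_suffix_of_ne {i j : ℕ} (hij : i ≠ j) {π q : Addr} (h : i :: π <:+ q) :
    ¬ j :: π <:+ q := by
  intro h'
  have h₂ := (List.suffix_of_suffix_length_le h h' (by simp)).eq_of_length (by simp)
  simp only [List.cons.injEq] at h₂
  exact hij h₂.1

end Positions

-- Scoping of the identifiers captured in values

section Wellformed

variable {C D : Type}

def VEnv.addrs : VEnv C D Addr → List Addr
  | .nil => []
  | .cons a _ ρ => a :: ρ.addrs

mutual

/-- All identifiers captured in a value satisfy `P`, and those of each captured environment are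
distinct. -/
def Val.Wf (P : Addr → Prop) : Val C D Addr → Prop
  | .sym _ => True
  | .app v w => v.Wf P ∧ w.Wf P
  | .clo _ ρ => ρ.Wf P

def VEnv.Wf (P : Addr → Prop) : VEnv C D Addr → Prop
  | .nil => True
  | .cons a v ρ => P a ∧ a ∉ ρ.addrs ∧ v.Wf P ∧ ρ.Wf P

end

mutual

theorem Val.Wf.mono {P Q : Addr → Prop} (h : ∀ q, P q → Q q) :
    ∀ {v : Val C D Addr}, v.Wf P → v.Wf Q
  | .sym _, _ => trivial
  | .app _ _, hv => ⟨Val.Wf.mono h hv.1, Val.Wf.mono h hv.2⟩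
  | .clo _ _, hv => VEnv.Wf.mono h hv

theorem VEnv.Wf.mono {P Q : Addr → Prop} (h : ∀ q, P q → Q q) :
    ∀ {ρ : VEnv C D Addr}, ρ.Wf P → ρ.Wf Q
  | .nil, _ => trivial
  | .cons _ _ _, hρ => ⟨h _ hρ.1, hρ.2.1, Val.Wf.mono h hρ.2.2.1, VEnv.Wf.mono h hρ.2.2.2⟩

end

/-- The field `inj` makes the renaming `Env.toName` injective on bound variables, as
`Env.closure_rename_bare` needs; the field `wf` confines identifiers to a scope `P` from which new
names can be kept apart. -/
structure EnvWf (P : Addr → Prop) (σ : Env C D) : Prop where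
  inj : ∀ {x y a v w}, σ x = some (a, v) → σ y = some (a, w) → x = y
  wf : ∀ {x a v}, σ x = some (a, v) → P a ∧ v.Wf P

theorem EnvWf.mono {P Q : Addr → Prop} {σ : Env C D} (hσ : EnvWf P σ) (h : ∀ q, P q → Q q) :
    EnvWf Q σ :=
  ⟨hσ.inj, fun hx => ⟨h _ (hσ.wf hx).1, (hσ.wf hx).2.mono h⟩⟩

theorem VEnv.mem_addrs_of_get : ∀ {ρ : VEnv C D Addr} {i a v}, ρ.get i = some (a, v) → a ∈ ρ.addrs
  | .nil, _, _, _, h => by simp [VEnv.get] at h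
  | .cons a v ρ, 0, _, _, h => by
    simp only [VEnv.get, Option.some.injEq, Prod.mk.injEq] at h
    simp [VEnv.addrs, h.1]
  | .cons a v ρ, i + 1, _, _, h => List.mem_cons_of_mem _ (VEnv.mem_addrs_of_get (ρ := ρ) h)

theorem VEnv.Wf.get_wf {P : Addr → Prop} : ∀ {ρ : VEnv C D Addr}, ρ.Wf P → ∀ {i a v},
    ρ.get i = some (a, v) → P a ∧ v.Wf P
  | .nil, _, _, _, _, h => by simp [VEnv.get] at h
  | .cons a v ρ, hρ, 0, _, _, h => by
    simp only [VEnv.get, Option.some.injEq, Prod.mk.injEq] at h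
    obtain ⟨rfl, rfl⟩ := h
    exact ⟨hρ.1, hρ.2.2.1⟩
  | .cons a v ρ, hρ, i + 1, _, _, h => hρ.2.2.2.get_wf (ρ := ρ) h

theorem VEnv.Wf.get_inj {P : Addr → Prop} : ∀ {ρ : VEnv C D Addr}, ρ.Wf P → ∀ {i j a v w},
    ρ.get i = some (a, v) → ρ.get j = some (a, w) → i = j
  | .nil, _, _, _, _, _, _, h, _ => by simp [VEnv.get] at h
  | .cons a v ρ, _, 0, 0, _, _, _, _, _ => rfl
  | .cons a v ρ, hρ, 0, j + 1, _, _, _, h, h' => by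
    simp only [VEnv.get, Option.some.injEq, Prod.mk.injEq] at h
    obtain ⟨rfl, rfl⟩ := h
    exact absurd (VEnv.mem_addrs_of_get (ρ := ρ) h') hρ.2.1
  | .cons a v ρ, hρ, i + 1, 0, _, _, _, h, h' => by
    simp only [VEnv.get, Option.some.injEq, Prod.mk.injEq] at h'
    obtain ⟨rfl, rfl⟩ := h'
    exact absurd (VEnv.mem_addrs_of_get (ρ := ρ) h) hρ.2.1
  | .cons a v ρ, hρ, i + 1, j + 1, _, _, _, h, h' => by
    rw [hρ.2.2.2.get_inj (ρ := ρ) h h']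

theorem VEnv.Wf.toEnv {P : Addr → Prop} {ρ : VEnv C D Addr} (hρ : ρ.Wf P) :
    EnvWf P ρ.toEnv where
  inj {x y a v w} h h' := by
    cases x with
    | glob x => simp [VEnv.toEnv] at h
    | loc i =>
      cases y with
      | glob y => simp [VEnv.toEnv] at h'
      | loc j => rw [hρ.get_inj h h']
  wf {x a v} h := by
    cases x with
    | glob x => simp [VEnv.toEnv] at h
    | loc i => exact hρ.get_wf h

theorem VEnv.Wf.of_mem_addrs {P : Addr → Prop} : ∀ {ρ : VEnv C D Addr}, ρ.Wf P → ∀ {a},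
    a ∈ ρ.addrs → P a
  | .nil, _, _, h => by simp [VEnv.addrs] at h
  | .cons a v ρ, hρ, b, h => by
    rcases List.mem_cons.1 h with rfl | h
    · exact hρ.1
    · exact hρ.2.2.2.of_mem_addrs (ρ := ρ) h

theorem Env.mem_addrs_capture {σ : Env C D} {xs : List Var} {a : Addr}
    (h : a ∈ (σ.capture xs).addrs) : ∃ x ∈ xs, ∃ v, σ x = some (a, v) := by
  induction xs with
  | nil => simp [Env.capture, VEnv.addrs] at h
  | cons x xs ih =>
    simp only [Env.capture] at h
    rcases hx : σ x with _ | ⟨b, v⟩ <;> rw [hx] at h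
    · obtain ⟨y, hy, h⟩ := ih h
      exact ⟨y, by simp [hy], h⟩
    · rcases List.mem_cons.1 h with rfl | h
      · exact ⟨x, by simp, v, hx⟩
      · obtain ⟨y, hy, h⟩ := ih h
        exact ⟨y, by simp [hy], h⟩

theorem EnvWf.capture {P : Addr → Prop} {σ : Env C D} (hσ : EnvWf P σ) {xs : List Var}
    (hx : xs.Nodup) : (σ.capture xs).Wf P := by
  induction xs with
  | nil => trivial
  | cons x xs ih =>
    rw [List.nodup_cons] at hx
    simp only [Env.capture]
    rcases h : σ x with _ | ⟨a, v⟩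
    · exact ih hx.2
    · refine ⟨(hσ.wf h).1, fun ha => ?_, (hσ.wf h).2, ih hx.2⟩
      obtain ⟨y, hy, w, hw⟩ := Env.mem_addrs_capture ha
      exact hx.1 (hσ.inj h hw ▸ hy)

/-- Extraction at `π` introduces names below `π` only, so under this condition it cannot overwrite a
name in scope. -/
def Fresh (P : Addr → Prop) (π : Addr) : Prop := ∀ q, P q → ¬ π <:+ q

theorem Fresh.cons {P : Addr → Prop} {π : Addr} (h : Fresh P π) (i : ℕ) : Fresh P (i :: π) :=
  fun q hq hs => h q hq ((List.suffix_cons i π).trans hs)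

/-- The identifiers in scope in the body of an application at `π`. -/
def BodyScope (P : Addr → Prop) (π q : Addr) : Prop :=
  P q ∨ Under (1 :: π) q ∨ 2 :: π <:+ q

theorem Fresh.body {P : Addr → Prop} {π : Addr} (h : Fresh P π) :
    Fresh (BodyScope P π) (3 :: π) := by
  rintro q (hq | hq | hq) hs
  · exact h.cons 3 q hq hs
  · exact not_suffix_of_ne (by decide) hq.1 hs
  · exact not_suffix_of_ne (by decide) hq hs

theorem BodyScope.of_left {P : Addr → Prop} {π q : Addr} (h : P q ∨ Under (1 :: π) q) :
    BodyScope P π q := h.imp_right .inl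

theorem BodyScope.of_right {P : Addr → Prop} {π q : Addr} (h : P q ∨ Under (2 :: π) q) :
    BodyScope P π q := h.imp_right fun h => .inr h.1

theorem BodyScope.scope {P : Addr → Prop} {π q : Addr} (h : BodyScope P π q) :
    P q ∨ Under π q :=
  h.imp_right fun h => h.elim Under.of_cons under_of_cons_suffix

theorem VEnv.Wf.body {P : Addr → Prop} {π : Addr} {ρ : VEnv C D Addr} {v : Val C D Addr}
    (hP : Fresh P π) (hρ : ρ.Wf fun q => P q ∨ Under (1 :: π) q)
    (hv : v.Wf fun q => P q ∨ Under (2 :: π) q) :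
    (VEnv.cons (2 :: π) v ρ).Wf (BodyScope P π) := by
  refine ⟨.inr (.inr (List.suffix_refl _)), fun hm => ?_, hv.mono fun _ => .of_right,
    hρ.mono fun _ => .of_left⟩
  rcases hρ.of_mem_addrs hm with h | h
  · exact hP.cons 2 _ h (List.suffix_refl _)
  · exact not_suffix_of_ne (by decide) h.1 (List.suffix_refl _)

variable {F : DistFamily C D}

/-- New bindings arise only from operands of applications, and the operand at `2 :: π` lies strictly
below the application at `π`. In the body the scope grows to `BodyScope`, which is still disjoint
from the subtree of `3 :: π`. -/
theorem AExpr.Ok.val_wf {a : AExpr C D} {σ : Env C D} {π : Addr} {P : Addr → Prop}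
    (ha : a.Ok F σ π) (hσ : EnvWf P σ) (hP : Fresh P π) :
    (a.val σ π).Wf fun q => P q ∨ Under π q := by
  induction a generalizing σ π P with
  | sym c => trivial
  | var x =>
    simp only [AExpr.val]
    rcases h : σ x with _ | ⟨a, v⟩
    · trivial
    · exact (hσ.wf h).2.mono fun _ => .inl
  | lam b => exact (hσ.capture (List.nodup_dedup _)).mono fun _ => .inl
  | neut a₁ a₂ ih₁ ih₂ =>
    exact ⟨(ih₁ ha.1 hσ (hP.cons 1)).mono fun _ => Or.imp_right Under.of_cons,
      (ih₂ ha.2.1 hσ (hP.cons 2)).mono fun _ => Or.imp_right Under.of_cons⟩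
  | beta a₁ a₂ a₃ ih₁ ih₂ ih₃ =>
    obtain ⟨h₁, h₂, ρ, hρ, h₃⟩ := ha
    have w₁ := ih₁ h₁ hσ (hP.cons 1)
    simp only [AExpr.val, hρ] at w₁ ⊢
    exact (ih₃ h₃ (VEnv.Wf.body hP w₁ (ih₂ h₂ hσ (hP.cons 2))).toEnv hP.body).mono fun q hq =>
      hq.elim BodyScope.scope fun h => .inr h.of_cons
  | dist k xs a a' ih ih' =>
    obtain ⟨h₁, hn, hs, hd, h₂⟩ := ha
    exact (ih' h₂ (hσ.capture hn).toEnv (hP.cons 2)).mono fun _ => Or.imp_right Under.of_cons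

theorem EnvWf.assign {P : Addr → Prop} {σ : Env C D} (hσ : EnvWf P σ) {x a : Addr}
    {v : Val C D Addr} (ha : ¬ P a) (hv : v.Wf fun q => P q ∨ Under a q) :
    EnvWf (fun q => P q ∨ a <:+ q) (σ.assign x a v) where
  inj {y z b w w'} h h' := by
    simp only [Env.assign, Function.update_apply] at h h'
    split_ifs at h h' with h₁ h₂ h₂
    · rw [h₁, h₂]
    · simp only [Option.some.injEq, Prod.mk.injEq] at h
      obtain ⟨rfl, rfl⟩ := h
      exact absurd (hσ.wf h').1 ha
    · simp only [Option.some.injEq, Prod.mk.injEq] at h'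
      obtain ⟨rfl, rfl⟩ := h'
      exact absurd (hσ.wf h).1 ha
    · exact hσ.inj h h'
  wf {y b w} h := by
    simp only [Env.assign, Function.update_apply] at h
    split_ifs at h with h₁
    · simp only [Option.some.injEq, Prod.mk.injEq] at h
      obtain ⟨rfl, rfl⟩ := h
      exact ⟨.inr (List.suffix_refl _), hv.mono fun q => Or.imp_right fun h => h.1⟩
    · exact ⟨.inl (hσ.wf h).1, (hσ.wf h).2.mono fun _ => .inl⟩

end Wellformed

-- Original environments inside extracted ones

section Known

variable {C D : Type} {S : Finset Addr}

mutual

/-- The variables captured in a value are, outside the subproblem `S`, bound in `τ` under the name of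
their identifier. -/
def Val.Known (S : Finset Addr) (τ : Env C D) : Val C D Addr → Prop
  | .sym _ => True
  | .app v w => v.Known S τ ∧ w.Known S τ
  | .clo _ ρ => ρ.Known S τ

def VEnv.Known (S : Finset Addr) (τ : Env C D) : VEnv C D Addr → Prop
  | .nil => True
  | .cons a v ρ => τ.bares (.glob a) = some v.bare ∧ (a ∉ S → v.Known S τ) ∧ ρ.Known S τ

end

/-- `τ` and `τ'` give the same values to the global variables with names in `P`. -/
def Env.Agree (P : Addr → Prop) (τ τ' : Env C D) : Prop :=
  ∀ q, P q → τ'.bares (.glob q) = τ.bares (.glob q)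

theorem Env.Agree.refl (P : Addr → Prop) (τ : Env C D) : τ.Agree P τ := fun _ _ => rfl

theorem Env.Agree.mono {P Q : Addr → Prop} {τ τ' : Env C D} (h : τ.Agree Q τ')
    (hPQ : ∀ q, P q → Q q) : τ.Agree P τ' := fun q hq => h q (hPQ q hq)

theorem Env.Agree.trans {P : Addr → Prop} {τ₁ τ₂ τ₃ : Env C D} (h : τ₁.Agree P τ₂)
    (h' : τ₂.Agree P τ₃) : τ₁.Agree P τ₃ := fun q hq => (h' q hq).trans (h q hq)

theorem Env.bares_assign (τ : Env C D) (x a : Addr) (v : Val C D Addr) :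
    (τ.assign x a v).bares (.glob x) = some v.bare := by
  simp [Env.bares, Env.assign]

theorem Env.agree_assign (τ : Env C D) (x a : Addr) (v : Val C D Addr) :
    τ.Agree (· ≠ x) (τ.assign x a v) := fun q hq => by
  simp [Env.bares, Env.assign, Function.update_of_ne, hq]

mutual

theorem Val.Known.congr {P : Addr → Prop} {τ τ' : Env C D} (h : τ.Agree P τ') :
    ∀ {v : Val C D Addr}, v.Wf P → v.Known S τ → v.Known S τ'
  | .sym _, _, _ => trivial
  | .app _ _, hw, hv => ⟨Val.Known.congr h hw.1 hv.1, Val.Known.congr h hw.2 hv.2⟩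
  | .clo _ _, hw, hv => VEnv.Known.congr h hw hv

theorem VEnv.Known.congr {P : Addr → Prop} {τ τ' : Env C D} (h : τ.Agree P τ') :
    ∀ {ρ : VEnv C D Addr}, ρ.Wf P → ρ.Known S τ → ρ.Known S τ'
  | .nil, _, _ => trivial
  | .cons _ _ _, hw, hρ => ⟨(h _ hw.1).trans hρ.1,
      fun ha => Val.Known.congr h hw.2.2.1 (hρ.2.1 ha), VEnv.Known.congr h hw.2.2.2 hρ.2.2⟩

end

/-- The invariant between an environment `σ` of the original trace and the environment `τ` of the
extracted one. The recursion into captured values stops at identifiers in `S`: a value computed in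
`S` may capture variables of a body that stays inside `S`, and these have no name in `τ`. -/
def EnvKnown (S : Finset Addr) (τ σ : Env C D) : Prop :=
  ∀ ⦃x a v⦄, σ x = some (a, v) → τ.bares (.glob a) = some v.bare ∧ (a ∉ S → v.Known S τ)

theorem EnvKnown.congr {P : Addr → Prop} {τ τ' σ : Env C D} (hK : EnvKnown S τ σ)
    (hσ : EnvWf P σ) (h : τ.Agree P τ') : EnvKnown S τ' σ := fun _ _ _ hx =>
  ⟨(h _ (hσ.wf hx).1).trans (hK hx).1, fun ha => ((hK hx).2 ha).congr h (hσ.wf hx).2⟩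

theorem VEnv.Known.get {τ : Env C D} : ∀ {ρ : VEnv C D Addr}, ρ.Known S τ → ∀ {i a v},
    ρ.get i = some (a, v) → τ.bares (.glob a) = some v.bare ∧ (a ∉ S → v.Known S τ)
  | .nil, _, _, _, _, h => by simp [VEnv.get] at h
  | .cons a v ρ, hρ, 0, _, _, h => by
    simp only [VEnv.get, Option.some.injEq, Prod.mk.injEq] at h
    obtain ⟨rfl, rfl⟩ := h
    exact ⟨hρ.1, hρ.2.1⟩
  | .cons a v ρ, hρ, i + 1, _, _, h => VEnv.Known.get (ρ := ρ) hρ.2.2 h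

theorem VEnv.Known.toEnv {τ : Env C D} {ρ : VEnv C D Addr} (h : ρ.Known S τ) :
    EnvKnown S τ ρ.toEnv := by
  intro x a v hx
  cases x with
  | glob x => simp [VEnv.toEnv] at hx
  | loc i => exact h.get hx

theorem EnvKnown.capture {τ σ : Env C D} (h : EnvKnown S τ σ) (xs : List Var) :
    (σ.capture xs).Known S τ := by
  induction xs with
  | nil => trivial
  | cons x xs ih =>
    simp only [Env.capture]
    rcases hx : σ x with _ | ⟨a, v⟩
    · exact ih
    · exact ⟨(h hx).1, (h hx).2, ih⟩

theorem EnvKnown.bares_toName {τ σ : Env C D} (h : EnvKnown S τ σ) {x : Var}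
    (hx : (σ x).isSome) : τ.bares (σ.toName x) = σ.bares x := by
  obtain ⟨⟨a, v⟩, hx⟩ := Option.isSome_iff_exists.1 hx
  rw [show σ.toName x = .glob a by simp [Env.toName, hx], (h hx).1]
  simp [Env.bares, hx]

theorem EnvWf.toName_inj {P : Addr → Prop} {σ : Env C D} (hσ : EnvWf P σ) {x y : Var}
    (hx : (σ x).isSome) (hy : (σ y).isSome) (h : σ.toName x = σ.toName y) : x = y := by
  obtain ⟨⟨a, v⟩, hx⟩ := Option.isSome_iff_exists.1 hx
  obtain ⟨⟨b, w⟩, hy⟩ := Option.isSome_iff_exists.1 hy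
  simp only [Env.toName, hx, hy, Var.glob.injEq] at h
  subst h
  exact hσ.inj hx hy

theorem EnvKnown.assign {τ σ : Env C D} {P : Addr → Prop} (hK : EnvKnown S τ σ) (hσ : EnvWf P σ)
    {x a b : Addr} {v w : Val C D Addr} (ha : ¬ P a) (hw : w.bare = v.bare)
    (hv : v.Wf fun q => P q ∨ Under a q) (hk : a ∉ S → v.Known S τ) :
    EnvKnown S (τ.assign (a) b w) (σ.assign x a v) := by
  intro y c u hy
  simp only [Env.assign, Function.update_apply] at hy
  split_ifs at hy with h
  · simp only [Option.some.injEq, Prod.mk.injEq] at hy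
    obtain ⟨rfl, rfl⟩ := hy
    refine ⟨by rw [Env.bares_assign, hw], fun h => (hk h).congr ((τ.agree_assign a b w).mono ?_) hv⟩
    rintro q (hq | hq) rfl
    · exact ha hq
    · exact hq.2 rfl
  · exact hK.congr hσ ((τ.agree_assign a b w).mono fun q hq e => ha (e ▸ hq)) hy

end Known

-- Positive-density traces without reference to a program

section Runs

variable {C D : Type}

/-- The environment after the execution of the statements of a trace. -/
def envAfter : Env C D → ℕ → Trace C D → Env C D
  | τ, _, [] => τ
  | τ, j, .assume x a :: t => envAfter (τ.assign x [j] (a.val τ [j])) (j + 1) t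
  | τ, j, .observe _ _ _ _ :: t => envAfter τ (j + 1) t

/-- The trace is one of its own program, and its observations have positive density. -/
def Runs (F : DistFamily C D) : Env C D → ℕ → Trace C D → Prop
  | _, _, [] => True
  | τ, j, .assume x a :: t =>
    a.Ok F τ [j] ∧ Runs F (τ.assign x [j] (a.val τ [j])) (j + 1) t
  | τ, j, .observe k _ a d :: t =>
    a.Ok F τ [1, j] ∧ d ∈ (F.pmf k (a.val τ [1, j]).bare).support ∧ Runs F τ (j + 1) t

def stmtNames {ε : Type} : List (Stmt C D ε) → List Addr
  | [] => []
  | .assume x _ :: t => x :: stmtNames t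
  | .observe _ _ _ _ :: t => stmtNames t

theorem stmtNames_append {ε : Type} (s t : List (Stmt C D ε)) :
    stmtNames (s ++ t) = stmtNames s ++ stmtNames t := by
  induction s with
  | nil => rfl
  | cons a s ih => cases a <;> simp [stmtNames, ih]

theorem stmtNames_program (t : Trace C D) : stmtNames t.program = stmtNames t := by
  induction t with
  | nil => rfl
  | cons a t ih =>
    cases a <;> simp only [Trace.program, List.map_cons, Stmt.roll, stmtNames] at ih ⊢ <;>
      simp [ih]

theorem agree_envAfter (τ : Env C D) (j : ℕ) (t : Trace C D) :
    τ.Agree (· ∉ stmtNames t) (envAfter τ j t) := by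
  induction t generalizing τ j with
  | nil => exact .refl _ _
  | cons a t ih =>
    cases a with
    | assume x a =>
      intro q hq
      simp only [stmtNames, List.mem_cons, not_or] at hq
      exact (ih _ _ q hq.2).trans (Env.agree_assign _ _ _ _ q hq.1)
    | observe k xs a d => exact ih _ _

theorem envAfter_append (τ : Env C D) (j : ℕ) (s t : Trace C D) :
    envAfter τ j (s ++ t) = envAfter (envAfter τ j s) (j + s.length) t := by
  induction s generalizing τ j with
  | nil => rfl
  | cons a s ih =>
    cases a <;> simp only [List.cons_append, envAfter, ih, List.length_cons] <;>
      rw [add_right_comm, add_assoc]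

variable {F : DistFamily C D}

theorem runs_append {τ : Env C D} {j : ℕ} {s t : Trace C D} :
    Runs F τ j (s ++ t) ↔ Runs F τ j s ∧ Runs F (envAfter τ j s) (j + s.length) t := by
  induction s generalizing τ j with
  | nil => simp [Runs, envAfter]
  | cons a s ih =>
    have e : j + 1 + s.length = j + (s.length + 1) := by omega
    cases a <;> simp only [List.cons_append, Runs, envAfter, ih, List.length_cons, e, and_assoc]

theorem densityFrom_append (τ : Env C D) (j : ℕ) (s t : Trace C D) :
    densityFrom F τ j (s ++ t) =
      densityFrom F τ j s * densityFrom F (envAfter τ j s) (j + s.length) t := by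
  induction s generalizing τ j with
  | nil => simp [densityFrom, envAfter]
  | cons a s ih =>
    have e : j + 1 + s.length = j + (s.length + 1) := by omega
    cases a <;>
      simp only [List.cons_append, densityFrom, envAfter, ih, List.length_cons, e, mul_assoc]

/-- Execution already forces sampled expressions into the support, so positive density is a
condition on the observations only. Membership in a trace space thereby splits into an equation for
the program and a predicate on the trace. -/
theorem execProg_and_density_iff {τ : Env C D} {j : ℕ} {p : Program C D} {t : Trace C D} :
    ExecProg F τ j p t ∧ densityFrom F τ j t ≠ 0 ↔ t.program = p ∧ Runs F τ j t := by
  constructor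
  · rintro ⟨h, hd⟩
    induction h with
    | nil => exact ⟨rfl, trivial⟩
    | assume h _ ih =>
      have ih := ih (right_ne_zero_of_mul hd)
      exact ⟨by rw [← ih.1, ← h.expr_eq_and_ok.1]; rfl, h.expr_eq_and_ok.2, ih.2⟩
    | observe h _ ih =>
      have ih := ih (right_ne_zero_of_mul hd)
      exact ⟨by rw [← ih.1, ← h.expr_eq_and_ok.1]; rfl, h.expr_eq_and_ok.2,
        (PMF.mem_support_iff _ _).2 (left_ne_zero_of_mul (left_ne_zero_of_mul hd)), ih.2⟩
  · rintro ⟨rfl, h⟩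
    induction t generalizing τ j with
    | nil => exact ⟨.nil, one_ne_zero⟩
    | cons a t ih =>
      cases a with
      | assume x a =>
        have ih := ih h.2
        exact ⟨.assume h.1.exec ih.1, mul_ne_zero h.1.density_ne_zero ih.2⟩
      | observe k xs a d =>
        have ih := ih h.2.2
        exact ⟨.observe h.1.exec ih.1,
          mul_ne_zero (mul_ne_zero ((PMF.mem_support_iff _ _).1 h.2.1) h.1.density_ne_zero) ih.2⟩

end Runs

-- Extraction preserves validity, values and density

section Extraction

variable {C D : Type}

/-- Each emitted `assume` is named by the position of an operator or operand, which is a proper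
descendant of `π`. -/
theorem AExpr.names_extract {S : Finset Addr} (a : AExpr C D) (σ : Env C D) (π : Addr) :
    ∀ q ∈ stmtNames (a.extract S σ π).1, Under π q := by
  induction a generalizing σ π with
  | sym c => simp [AExpr.extract, stmtNames]
  | var x => simp [AExpr.extract, stmtNames]
  | lam b => simp [AExpr.extract, stmtNames]
  | neut a₁ a₂ ih₁ ih₂ =>
    intro q hq
    simp only [AExpr.extract, stmtNames_append, List.mem_append] at hq
    exact hq.elim (fun h => (ih₁ _ _ q h).of_cons) fun h => (ih₂ _ _ q h).of_cons
  | beta a₁ a₂ a₃ ih₁ ih₂ ih₃ =>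
    intro q hq
    simp only [AExpr.extract] at hq
    split_ifs at hq
    · simp only [stmtNames_append, List.mem_append] at hq
      exact hq.elim (fun h => (ih₁ _ _ q h).of_cons) fun h => (ih₂ _ _ q h).of_cons
    · simp only [stmtNames_append, List.mem_append, stmtNames, List.mem_cons] at hq
      rcases hq with h | rfl | h | rfl | h
      · exact (ih₁ _ _ q h).of_cons
      · exact under_cons _ _
      · exact (ih₂ _ _ q h).of_cons
      · exact under_cons _ _
      · exact (ih₃ _ _ q h).of_cons
  | dist k xs a a' ih ih' =>
    intro q hq
    simp only [AExpr.extract] at hq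
    split_ifs at hq
    · exact (ih _ _ q hq).of_cons
    · simp only [stmtNames_append, List.mem_append, stmtNames] at hq
      exact hq.elim (fun h => (ih _ _ q h).of_cons) fun h => (ih' _ _ q h).of_cons

/-- The part of validity of the subproblem `S` that concerns an augmented expression, outside the
bodies of applications and the sampled expressions that belong to `S`. -/
def AExpr.Loc (S : Finset Addr) : AExpr C D → Env C D → Addr → Prop
  | .sym _, _, _ => True
  | .var x, σ, π => ∀ a v, σ x = some (a, v) → a ∈ S → π ∈ S
  | .lam _, _, _ => True
  | .neut a₁ a₂, σ, π => a₁.Loc S σ (1 :: π) ∧ a₂.Loc S σ (2 :: π) ∧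
      (1 :: π ∈ S → π ∈ S) ∧ (2 :: π ∈ S → π ∈ S)
  | .beta a₁ a₂ a₃, σ, π => a₁.Loc S σ (1 :: π) ∧ a₂.Loc S σ (2 :: π) ∧
      (1 :: π ∈ S → π ∈ S) ∧ (1 :: π ∉ S → (3 :: π ∈ S → π ∈ S) ∧
        ∀ b ρ, a₁.val σ (1 :: π) = .clo b ρ →
          a₃.Loc S (VEnv.cons (2 :: π) (a₂.val σ (2 :: π)) ρ).toEnv (3 :: π))
  | .dist _ xs a a', σ, π => a.Loc S σ (1 :: π) ∧ (0 :: π ∈ S → π ∈ S) ∧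
      (0 :: π ∉ S → (2 :: π ∈ S → π ∈ S) ∧ a'.Loc S (σ.capture xs).toEnv (2 :: π))

theorem AExpr.val_beta {a₁ a₂ a₃ : AExpr C D} {σ : Env C D} {π : Addr} {b : Expr C D}
    {ρ : VEnv C D Addr} (h : a₁.val σ (1 :: π) = .clo b ρ) :
    (AExpr.beta a₁ a₂ a₃).val σ π =
      a₃.val (VEnv.cons (2 :: π) (a₂.val σ (2 :: π)) ρ).toEnv (3 :: π) := by
  simp only [AExpr.val, h]

theorem AExpr.extract_beta_of_mem {S : Finset Addr} {a₁ a₂ a₃ : AExpr C D} {σ : Env C D} {π : Addr}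
    (h : 1 :: π ∈ S) : (AExpr.beta a₁ a₂ a₃).extract S σ π =
      ((a₁.extract S σ (1 :: π)).1 ++ (a₂.extract S σ (2 :: π)).1,
        .beta (a₁.extract S σ (1 :: π)).2 (a₂.extract S σ (2 :: π)).2 a₃) := by
  simp only [AExpr.extract, h, if_true]

theorem AExpr.extract_beta_of_notMem {S : Finset Addr} {a₁ a₂ a₃ : AExpr C D} {σ : Env C D}
    {π : Addr} {b : Expr C D} {ρ : VEnv C D Addr} (h : 1 :: π ∉ S)
    (hv : a₁.val σ (1 :: π) = .clo b ρ) : (AExpr.beta a₁ a₂ a₃).extract S σ π =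
      ((a₁.extract S σ (1 :: π)).1 ++ .assume (1 :: π) (a₁.extract S σ (1 :: π)).2 ::
        ((a₂.extract S σ (2 :: π)).1 ++ .assume (2 :: π) (a₂.extract S σ (2 :: π)).2 ::
          (a₃.extract S (VEnv.cons (2 :: π) (a₂.val σ (2 :: π)) ρ).toEnv (3 :: π)).1),
        (a₃.extract S (VEnv.cons (2 :: π) (a₂.val σ (2 :: π)) ρ).toEnv (3 :: π)).2) := by
  simp only [AExpr.extract, h, if_false, hv]

theorem AExpr.extract_dist_of_mem {S : Finset Addr} {k : D} {xs : List Var} {a a' : AExpr C D}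
    {σ : Env C D} {π : Addr} (h : 0 :: π ∈ S) : (AExpr.dist k xs a a').extract S σ π =
      ((a.extract S σ (1 :: π)).1, .dist k (xs.map σ.toName) (a.extract S σ (1 :: π)).2 a') := by
  simp only [AExpr.extract, h, if_true]

theorem AExpr.extract_dist_of_notMem {S : Finset Addr} {k : D} {xs : List Var} {a a' : AExpr C D}
    {σ : Env C D} {π : Addr} (h : 0 :: π ∉ S) : (AExpr.dist k xs a a').extract S σ π =
      ((a.extract S σ (1 :: π)).1 ++
        .observe k (xs.map σ.toName) (a.extract S σ (1 :: π)).2 a'.expr ::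
          (a'.extract S (σ.capture xs).toEnv (2 :: π)).1,
        (a'.extract S (σ.capture xs).toEnv (2 :: π)).2) := by
  simp only [AExpr.extract, h, if_false]

variable {F : DistFamily C D} {S : Finset Addr}

theorem agree_of_under {τ : Env C D} {j : ℕ} {s : Trace C D} {π : Addr} {P : Addr → Prop}
    (hs : ∀ q ∈ stmtNames s, Under π q) (hP : ∀ q, P q → ¬ π <:+ q) :
    τ.Agree P (envAfter τ j s) :=
  (agree_envAfter τ j s).mono fun q hq hm => hP q hq (hs q hm).1

/-- The extracted augmented expression `b`, with emitted statements `s`, runs in `τ` and gives the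
same value and density as `a`. -/
structure ExtractsTo (F : DistFamily C D) (S : Finset Addr) (P : Addr → Prop) (a : AExpr C D)
    (σ : Env C D) (π : Addr) (τ : Env C D) (j : ℕ) (r : Trace C D × AExpr C D) : Prop where
  runs : Runs F τ j r.1
  ok : ∀ {τ'}, (envAfter τ j r.1).Agree (fun q => P q ∨ Under π q) τ' → ∀ ϖ, r.2.Ok F τ' ϖ
  bare : ∀ {τ'}, (envAfter τ j r.1).Agree (fun q => P q ∨ Under π q) τ' → ∀ ϖ,
    (r.2.val τ' ϖ).bare = (a.val σ π).bare
  density : ∀ {τ'}, (envAfter τ j r.1).Agree (fun q => P q ∨ Under π q) τ' → ∀ ϖ,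
    densityFrom F τ j r.1 * r.2.density F τ' ϖ = a.density F σ π
  known : ∀ {τ'}, (envAfter τ j r.1).Agree (fun q => P q ∨ Under π q) τ' → π ∉ S →
    (a.val σ π).Known S τ'

/-- An extracted operator is evaluated only after the statements emitted for the operand have run.
Those assign names below `2 :: π`, hence none that the operator depends on. -/
theorem agree_second {τ τ' : Env C D} {j : ℕ} {s : Trace C D} {π : Addr} {P : Addr → Prop}
    (hP : Fresh P π) (hs : ∀ q ∈ stmtNames s, Under (2 :: π) q)
    (hA : (envAfter τ j s).Agree (fun q => P q ∨ Under π q) τ') :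
    τ.Agree (fun q => P q ∨ Under (1 :: π) q) τ' := by
  refine .trans (agree_of_under hs ?_) (hA.mono fun _ => Or.imp_right Under.of_cons)
  rintro q (hq | hq)
  · exact hP.cons 2 q hq
  · exact not_suffix_of_ne (by decide) hq.1

/-- The state in which the inlined body of an application at `π` is run. -/
theorem agree_body {τ : Env C D} {j : ℕ} {v₁ v₂ : Val C D Addr} {a₁ a₂ : Addr}
    {s₂ : Trace C D} {π : Addr} {P : Addr → Prop} (hP : Fresh P π)
    (hs : ∀ q ∈ stmtNames s₂, Under (2 :: π) q) :
    τ.Agree (fun q => P q ∨ Under (1 :: π) q)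
      ((envAfter (τ.assign (1 :: π) a₁ v₁) j s₂).assign (2 :: π) a₂ v₂) := by
  refine .trans ((τ.agree_assign _ _ _).mono ?_) (.trans (agree_of_under hs ?_)
    ((Env.agree_assign _ _ _ _).mono ?_))
  · rintro q (hq | hq) rfl
    · exact hP.cons 1 _ hq (List.suffix_refl _)
    · exact hq.2 rfl
  · rintro q (hq | hq)
    · exact hP.cons 2 q hq
    · exact not_suffix_of_ne (by decide) hq.1
  · rintro q (hq | hq) rfl
    · exact hP.cons 2 _ hq (List.suffix_refl _)
    · exact not_suffix_of_ne (by decide) hq.1 (List.suffix_refl _)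

theorem agree_first {τ : Env C D} {j : ℕ} {s : Trace C D} {π : Addr} {P : Addr → Prop}
    (hP : Fresh P π) (hs : ∀ q ∈ stmtNames s, Under (1 :: π) q) :
    τ.Agree P (envAfter τ j s) :=
  agree_of_under hs fun q hq => hP.cons 1 q hq

theorem agree_first_assign {τ : Env C D} {j : ℕ} {s : Trace C D} {π a : Addr} {v : Val C D Addr}
    {P : Addr → Prop} (hP : Fresh P π) (hs : ∀ q ∈ stmtNames s, Under (1 :: π) q) :
    τ.Agree P ((envAfter τ j s).assign (1 :: π) a v) :=
  (agree_first hP hs).trans ((Env.agree_assign _ _ _ _).mono fun q hq e =>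
    hP.cons 1 q hq (e ▸ List.suffix_refl _))

/-- The invariant for an inlined body. The argument has just been assigned under its own identifier
`2 :: π`; the captured variables are known because the closure value is, and the later assignments
do not touch their names. -/
theorem ExtractsTo.known_body {a₂ : AExpr C D} {σ τ : Env C D} {π : Addr}
    {P : Addr → Prop} {j j' : ℕ} {r₂ : Trace C D × AExpr C D} {ρ : VEnv C D Addr}
    {v₁ : Val C D Addr} {b₁ b₂ : Addr} (hP : Fresh P π)
    (hn : ∀ q ∈ stmtNames r₂.1, Under (2 :: π) q)
    (hw : ρ.Wf fun q => P q ∨ Under (1 :: π) q)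
    (hw₂ : (a₂.val σ (2 :: π)).Wf fun q => P q ∨ Under (2 :: π) q)
    (h₁ : ρ.Known S τ) (h₂ : ExtractsTo F S P a₂ σ (2 :: π) (τ.assign (1 :: π) b₁ v₁) j r₂) :
    EnvKnown S ((envAfter (τ.assign (1 :: π) b₁ v₁) j r₂.1).assign (2 :: π) b₂
        (r₂.2.val (envAfter (τ.assign (1 :: π) b₁ v₁) j r₂.1) [j']))
      (VEnv.cons (2 :: π) (a₂.val σ (2 :: π)) ρ).toEnv := by
  refine VEnv.Known.toEnv (ρ := .cons _ _ _)
    ⟨?_, fun h => ?_, h₁.congr (agree_body hP hn) hw⟩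
  · rw [Env.bares_assign, h₂.bare (.refl _ _)]
  · refine (h₂.known (.refl _ _) h).congr ((Env.agree_assign _ _ _ _).mono ?_) hw₂
    rintro q (hq | hq) rfl
    · exact hP.cons 2 _ hq (List.suffix_refl _)
    · exact hq.2 rfl

/-- An extracted expression is evaluated later than the statements it emits, at another position.
`ExtractsTo` therefore speaks of every state that agrees with the emitted state on the relevant
names, and of every position `ϖ`. The clause `known`, restricted to `π ∉ S`, is what carries the
induction through inlined bodies. -/
theorem AExpr.extract_spec {a : AExpr C D} {σ τ : Env C D} {π : Addr} {P : Addr → Prop}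
    (ha : a.Ok F σ π) (hσ : EnvWf P σ) (hP : Fresh P π) (hL : a.Loc S σ π)
    (hK : EnvKnown S τ σ) (j : ℕ) : ExtractsTo F S P a σ π τ j (a.extract S σ π) := by
  induction a generalizing σ τ π P j with
  | sym c =>
    exact ⟨trivial, fun _ _ => trivial, fun _ _ => rfl, fun _ _ => one_mul _, fun _ _ => trivial⟩
  | var x =>
    have key : ∀ {τ'}, τ.Agree (fun q => P q ∨ Under π q) τ' →
        τ'.bares (σ.toName x) = σ.bares x := fun h =>
      EnvKnown.bares_toName (hK.congr hσ (h.mono fun _ => .inl)) ha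
    refine ⟨trivial, fun h _ => Env.isSome_of_bares (key h).symm ha, fun {τ'} h ϖ => ?_,
      fun _ _ => one_mul _, fun h hπ => ?_⟩
    · have e := key h
      simp only [Env.bares] at e
      obtain ⟨⟨b, v⟩, hx⟩ := Option.isSome_iff_exists.1 ha
      rcases hy : τ' (σ.toName x) with _ | ⟨c, w⟩
      · simp [hx, hy] at e
      · simp only [AExpr.extract, AExpr.val, hx, hy]
        simpa [hx, hy] using e
    · obtain ⟨⟨b, v⟩, hx⟩ := Option.isSome_iff_exists.1 ha
      simp only [AExpr.val, hx]
      -- The data edge from the binding node to this occurrence: were the binding in `S`, the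
      -- occurrence would be too.
      exact ((hK.congr hσ (h.mono fun _ => .inl)) hx).2 fun hb => hπ (hL _ _ hx hb)
  | lam b =>
    have key : ∀ {τ'}, τ.Agree (fun q => P q ∨ Under π q) τ' → ∀ x ∈ (Expr.lam b).free,
        τ'.bares (σ.toName x) = σ.bares x := fun h x hx =>
      EnvKnown.bares_toName (hK.congr hσ (h.mono fun _ => .inl)) (ha x hx)
    refine ⟨trivial, fun {τ'} h _ x hx => ?_, fun h _ => ?_, fun _ _ => one_mul _, fun h hπ => ?_⟩
    · change x ∈ ((Expr.lam b).rename σ.toName).free at hx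
      rw [Expr.free_rename, List.mem_map] at hx
      obtain ⟨y, hy, rfl⟩ := hx
      exact Env.isSome_of_bares (key h y hy).symm (ha y hy)
    · exact Env.closure_rename_bare (key h) fun x hx y hy => hσ.toName_inj (ha x hx) (ha y hy)
    · exact EnvKnown.capture (hK.congr hσ (h.mono fun _ => .inl)) _
  | neut a₁ a₂ ih₁ ih₂ =>
    obtain ⟨ok₁, ok₂, hn⟩ := ha
    obtain ⟨L₁, L₂, l₁, l₂⟩ := hL
    have n₁ := a₁.names_extract (S := S) σ (1 :: π)
    have n₂ := a₂.names_extract (S := S) σ (2 :: π)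
    have s₁ := ih₁ ok₁ hσ (hP.cons 1) L₁ hK j
    have s₂ := ih₂ ok₂ hσ (hP.cons 2) L₂ (hK.congr hσ (agree_first (j := j) hP n₁))
      (j + (a₁.extract S σ (1 :: π)).1.length)
    simp only [AExpr.extract]
    have A₁ : ∀ {τ'}, (envAfter τ j ((a₁.extract S σ (1 :: π)).1 ++
        (a₂.extract S σ (2 :: π)).1)).Agree (fun q => P q ∨ Under π q) τ' →
        (envAfter τ j (a₁.extract S σ (1 :: π)).1).Agree (fun q => P q ∨ Under (1 :: π) q) τ' := by
      intro τ' h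
      rw [envAfter_append] at h
      exact agree_second hP n₂ h
    have A₂ : ∀ {τ'}, (envAfter τ j ((a₁.extract S σ (1 :: π)).1 ++
        (a₂.extract S σ (2 :: π)).1)).Agree (fun q => P q ∨ Under π q) τ' →
        (envAfter (envAfter τ j (a₁.extract S σ (1 :: π)).1)
          (j + (a₁.extract S σ (1 :: π)).1.length) (a₂.extract S σ (2 :: π)).1).Agree
          (fun q => P q ∨ Under (2 :: π) q) τ' := by
      intro τ' h
      rw [envAfter_append] at h
      exact h.mono fun _ => Or.imp_right Under.of_cons
    refine ⟨runs_append.2 ⟨s₁.runs, s₂.runs⟩, fun h ϖ => ⟨s₁.ok (A₁ h) _, s₂.ok (A₂ h) _, ?_⟩,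
      fun h ϖ => ?_, fun h ϖ => ?_, fun h hπ => ⟨s₁.known (A₁ h) fun h => hπ (l₁ h),
        s₂.known (A₂ h) fun h => hπ (l₂ h)⟩⟩
    · intro b ρ hb
      have := s₁.bare (A₁ h) (1 :: ϖ)
      rw [hb] at this
      obtain ⟨ρ', h', -⟩ := Val.clo_of_bare this.symm
      exact hn _ _ h'
    · simp only [AExpr.val, Val.bare, s₁.bare (A₁ h), s₂.bare (A₂ h)]
    · simp only [AExpr.density, densityFrom_append]
      rw [mul_mul_mul_comm, s₁.density (A₁ h), s₂.density (A₂ h)]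
  | beta a₁ a₂ a₃ ih₁ ih₂ ih₃ =>
    obtain ⟨ok₁, ok₂, ρ, hρ, ok₃⟩ := ha
    obtain ⟨L₁, L₂, l₁, L₃⟩ := hL
    have n₁ := a₁.names_extract (S := S) σ (1 :: π)
    have n₂ := a₂.names_extract (S := S) σ (2 :: π)
    have s₁ := ih₁ ok₁ hσ (hP.cons 1) L₁ hK j
    by_cases hS : 1 :: π ∈ S
    · have s₂ := ih₂ ok₂ hσ (hP.cons 2) L₂ (hK.congr hσ (agree_first (j := j) hP n₁))
        (j + (a₁.extract S σ (1 :: π)).1.length)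
      rw [AExpr.extract_beta_of_mem hS]
      have A₁ : ∀ {τ'}, (envAfter τ j ((a₁.extract S σ (1 :: π)).1 ++
          (a₂.extract S σ (2 :: π)).1)).Agree (fun q => P q ∨ Under π q) τ' →
          (envAfter τ j (a₁.extract S σ (1 :: π)).1).Agree
            (fun q => P q ∨ Under (1 :: π) q) τ' := by
        intro τ' h
        rw [envAfter_append] at h
        exact agree_second hP n₂ h
      have A₂ : ∀ {τ'}, (envAfter τ j ((a₁.extract S σ (1 :: π)).1 ++
          (a₂.extract S σ (2 :: π)).1)).Agree (fun q => P q ∨ Under π q) τ' →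
          (envAfter (envAfter τ j (a₁.extract S σ (1 :: π)).1)
            (j + (a₁.extract S σ (1 :: π)).1.length) (a₂.extract S σ (2 :: π)).1).Agree
            (fun q => P q ∨ Under (2 :: π) q) τ' := by
        intro τ' h
        rw [envAfter_append] at h
        exact h.mono fun _ => Or.imp_right Under.of_cons
      -- The operator is in `S`, so the application is kept. Its body `a₃` is copied verbatim and
      -- runs in an environment that is the old one up to identifiers.
      have B : ∀ {τ'}, (envAfter τ j ((a₁.extract S σ (1 :: π)).1 ++
          (a₂.extract S σ (2 :: π)).1)).Agree (fun q => P q ∨ Under π q) τ' → ∀ ϖ, ∃ ρ',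
          (a₁.extract S σ (1 :: π)).2.val τ' (1 :: ϖ) = .clo a₃.expr ρ' ∧
          (VEnv.cons (2 :: π) (a₂.val σ (2 :: π)) ρ).toEnv.bares = (VEnv.cons (2 :: ϖ)
            ((a₂.extract S σ (2 :: π)).2.val τ' (2 :: ϖ)) ρ').toEnv.bares := by
        intro τ' h ϖ
        have := s₁.bare (A₁ h) (1 :: ϖ)
        rw [hρ] at this
        obtain ⟨ρ', h', e⟩ := Val.clo_of_bare this
        refine ⟨ρ', h', VEnv.toEnv_bares ?_⟩
        simp only [VEnv.bare, s₂.bare (A₂ h), e]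
      refine ⟨runs_append.2 ⟨s₁.runs, s₂.runs⟩, fun h ϖ => ?_, fun h ϖ => ?_, fun h ϖ => ?_,
        fun h hπ => absurd (l₁ hS) hπ⟩
      · obtain ⟨ρ', h', e⟩ := B h ϖ
        exact ⟨s₁.ok (A₁ h) _, s₂.ok (A₂ h) _, ρ', h', ok₃.congr e _⟩
      · obtain ⟨ρ', h', e⟩ := B h ϖ
        rw [AExpr.val_beta h', AExpr.val_beta hρ]
        exact a₃.val_bare e.symm _ _
      · obtain ⟨ρ', h', e⟩ := B h ϖ
        rw [AExpr.density_beta h', AExpr.density_beta hρ, densityFrom_append, ← mul_assoc,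
          mul_mul_mul_comm, s₁.density (A₁ h), s₂.density (A₂ h), ok₃.density_congr e (3 :: ϖ)]
    · obtain ⟨l₃, L₃⟩ := L₃ hS
      rw [AExpr.extract_beta_of_notMem hS hρ]
      set r₁ := a₁.extract S σ (1 :: π) with hr₁
      set r₂ := a₂.extract S σ (2 :: π) with hr₂
      set τ₁ := envAfter τ j r₁.1 with hτ₁
      set j₁ := j + r₁.1.length with hj₁
      set v₁ := r₁.2.val τ₁ [j₁] with hv₁
      have w₁ := ok₁.val_wf hσ (hP.cons 1)
      have w₂ := ok₂.val_wf hσ (hP.cons 2)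
      -- Here `1 :: π ∉ S` is essential: the variables captured by the operator have names in the
      -- extracted state, so the inlined body can refer to them.
      have k₁ := s₁.known (.refl _ _) hS
      rw [hρ] at w₁ k₁
      have s₂ := ih₂ (τ := τ₁.assign (1 :: π) [j₁] v₁) ok₂ hσ (hP.cons 2) L₂
        (hK.congr hσ (agree_first_assign hP n₁)) (j₁ + 1)
      set τ₂ := envAfter (τ₁.assign (1 :: π) [j₁] v₁) (j₁ + 1) r₂.1 with hτ₂
      set j₂ := j₁ + 1 + r₂.1.length with hj₂
      have s₃ := ih₃ ok₃ (VEnv.Wf.body hP w₁ w₂).toEnv hP.body (L₃ _ _ hρ)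
        (ExtractsTo.known_body (b₂ := [j₂]) (j' := j₂) hP n₂ w₁ w₂ k₁ s₂) (j₂ + 1)
      set r₃ := a₃.extract S (VEnv.cons (2 :: π) (a₂.val σ (2 :: π)) ρ).toEnv (3 :: π) with hr₃
      have eA : envAfter τ j (r₁.1 ++ .assume (1 :: π) r₁.2 ::
          (r₂.1 ++ .assume (2 :: π) r₂.2 :: r₃.1)) =
          envAfter (τ₂.assign (2 :: π) [j₂] (r₂.2.val τ₂ [j₂])) (j₂ + 1) r₃.1 := by
        simp only [envAfter_append, envAfter, ← hj₁, ← hτ₁, ← hv₁, ← hj₂, ← hτ₂]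
      have A₃ : ∀ {τ'}, (envAfter τ j (r₁.1 ++ .assume (1 :: π) r₁.2 ::
          (r₂.1 ++ .assume (2 :: π) r₂.2 :: r₃.1))).Agree (fun q => P q ∨ Under π q) τ' →
          (envAfter (τ₂.assign (2 :: π) [j₂] (r₂.2.val τ₂ [j₂])) (j₂ + 1) r₃.1).Agree
            (fun q => BodyScope P π q ∨ Under (3 :: π) q) τ' := by
        intro τ' h
        rw [eA] at h
        exact h.mono fun q hq => hq.elim BodyScope.scope fun h => .inr h.of_cons
      refine ⟨?_, fun h ϖ => s₃.ok (A₃ h) ϖ, fun h ϖ => ?_, fun h ϖ => ?_, fun h hπ => ?_⟩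
      · simp only [runs_append, Runs, ← hj₁, ← hτ₁, ← hv₁, ← hj₂, ← hτ₂]
        exact ⟨s₁.runs, s₁.ok (.refl _ _) _, s₂.runs, s₂.ok (.refl _ _) _, s₃.runs⟩
      · rw [AExpr.val_beta hρ]
        exact s₃.bare (A₃ h) ϖ
      · rw [AExpr.density_beta hρ, ← s₃.density (A₃ h) ϖ, ← s₁.density (.refl _ _) [j₁],
          ← s₂.density (.refl _ _) [j₂]]
        simp only [densityFrom_append, densityFrom, ← hj₁, ← hτ₁, ← hv₁, ← hj₂, ← hτ₂, mul_assoc]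
        rfl
      · rw [AExpr.val_beta hρ]
        exact s₃.known (A₃ h) fun h => hπ (l₃ h)
  | dist k xs a a' ih ih' =>
    obtain ⟨ok₁, hnd, hb, hd, ok₂⟩ := ha
    obtain ⟨L₁, l₁, L₂⟩ := hL
    have n₁ := a.names_extract (S := S) σ (1 :: π)
    have s₁ := ih ok₁ hσ (hP.cons 1) L₁ hK j
    by_cases hS : 0 :: π ∈ S
    · rw [AExpr.extract_dist_of_mem hS]
      have A₁ : ∀ {τ'}, (envAfter τ j (a.extract S σ (1 :: π)).1).Agree
          (fun q => P q ∨ Under π q) τ' → (envAfter τ j (a.extract S σ (1 :: π)).1).Agree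
          (fun q => P q ∨ Under (1 :: π) q) τ' := fun h =>
        h.mono fun _ => Or.imp_right Under.of_cons
      have K : ∀ {τ'}, (envAfter τ j (a.extract S σ (1 :: π)).1).Agree
          (fun q => P q ∨ Under π q) τ' → ∀ x ∈ xs, τ'.bares (σ.toName x) = σ.bares x :=
        fun h x hx => EnvKnown.bares_toName (hK.congr hσ ((agree_first hP n₁).trans
          (h.mono fun _ => .inl))) (hb x hx)
      have E : ∀ {τ'}, (envAfter τ j (a.extract S σ (1 :: π)).1).Agree
          (fun q => P q ∨ Under π q) τ' → (σ.capture xs).toEnv.bares =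
          (τ'.capture (xs.map σ.toName)).toEnv.bares := fun h =>
        (VEnv.toEnv_bares (Env.capture_map_bare (K h))).symm
      refine ⟨s₁.runs, fun {τ'} h ϖ => ⟨s₁.ok (A₁ h) _, ?_, ?_, ?_, ok₂.congr (E h) _⟩,
        fun h ϖ => a'.val_bare (E h).symm _ _, fun h ϖ => ?_, fun h hπ => absurd (l₁ hS) hπ⟩
      · exact hnd.map_on fun x hx y hy => hσ.toName_inj (hb x hx) (hb y hy)
      · intro x hx
        obtain ⟨y, hy, rfl⟩ := List.mem_map.1 hx
        exact Env.isSome_of_bares (K h y hy).symm (hb y hy)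
      · rwa [s₁.bare (A₁ h)]
      · simp only [AExpr.density]
        rw [s₁.bare (A₁ h), ← ok₂.density_congr (E h) (2 :: ϖ), ← mul_assoc, ← mul_assoc,
          s₁.density (A₁ h)]
    · obtain ⟨l₂, L₂⟩ := L₂ hS
      rw [AExpr.extract_dist_of_notMem hS]
      set r₁ := a.extract S σ (1 :: π) with hr₁
      set τ₁ := envAfter τ j r₁.1 with hτ₁
      set j₁ := j + r₁.1.length with hj₁
      have s₂ := ih' (τ := τ₁) ok₂ (hσ.capture hnd).toEnv (hP.cons 2) L₂
        (EnvKnown.capture (hK.congr hσ (agree_first hP n₁)) xs).toEnv (j₁ + 1)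
      set r₂ := a'.extract S (σ.capture xs).toEnv (2 :: π) with hr₂
      have eA : envAfter τ j (r₁.1 ++ .observe k (xs.map σ.toName) r₁.2 a'.expr :: r₂.1) =
          envAfter τ₁ (j₁ + 1) r₂.1 := by
        simp only [envAfter_append, envAfter, ← hj₁, ← hτ₁]
      have A₂ : ∀ {τ'}, (envAfter τ j (r₁.1 ++ .observe k (xs.map σ.toName) r₁.2 a'.expr ::
          r₂.1)).Agree (fun q => P q ∨ Under π q) τ' →
          (envAfter τ₁ (j₁ + 1) r₂.1).Agree (fun q => P q ∨ Under (2 :: π) q) τ' := by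
        intro τ' h
        rw [eA] at h
        exact h.mono fun _ => Or.imp_right Under.of_cons
      refine ⟨?_, fun h ϖ => s₂.ok (A₂ h) ϖ, fun h ϖ => s₂.bare (A₂ h) ϖ, fun h ϖ => ?_,
        fun h hπ => s₂.known (A₂ h) fun h => hπ (l₂ h)⟩
      · simp only [runs_append, Runs, ← hj₁, ← hτ₁]
        refine ⟨s₁.runs, s₁.ok (.refl _ _) _, ?_, s₂.runs⟩
        rwa [s₁.bare (.refl _ _)]
      -- The factor of the stochastic choice reappears as the factor of the emitted observation,
      -- since the parameter has the same bare value.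
      · simp only [AExpr.density, densityFrom_append, densityFrom, ← hj₁, ← hτ₁]
        rw [← s₂.density (A₂ h) ϖ, ← s₁.density (.refl _ _) [1, j₁], s₁.bare (.refl _ _)]
        ring

end Extraction

-- Traces that differ only inside a subproblem

section Similarity

variable {C D : Type}

mutual

/-- Two values differ only in variables that are assigned in the subproblem `S`. -/
inductive VRel (S : Finset Addr) : Val C D Addr → Val C D Addr → Prop where
  | sym (c) : VRel S (.sym c) (.sym c)
  | app {v w v' w'} : VRel S v v' → VRel S w w' → VRel S (.app v w) (.app v' w')
  | clo {b ρ ρ'} : VEnvRel S ρ ρ' → VRel S (.clo b ρ) (.clo b ρ')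

inductive VEnvRel (S : Finset Addr) : VEnv C D Addr → VEnv C D Addr → Prop where
  | nil : VEnvRel S .nil .nil
  | cons {a v v' ρ ρ'} : (a ∉ S → VRel S v v') → VEnvRel S ρ ρ' →
      VEnvRel S (.cons a v ρ) (.cons a v' ρ')

end

/-- Identifiers have to coincide exactly, not just bare values, so that `Env.toName` is the same on
both sides and the extracted programs are literally equal. -/
def EnvRel (S : Finset Addr) (σ σ' : Env C D) : Prop :=
  ∀ x, Option.Rel (fun p q => p.1 = q.1 ∧ (p.1 ∉ S → VRel S p.2 q.2)) (σ x) (σ' x)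

variable {S : Finset Addr} {σ σ' : Env C D}

theorem VRel.exists_clo {b : Expr C D} {ρ : VEnv C D Addr} {v : Val C D Addr}
    (h : VRel S (.clo b ρ) v) : ∃ ρ', v = .clo b ρ' ∧ VEnvRel S ρ ρ' := by
  cases h with
  | clo h => exact ⟨_, rfl, h⟩

theorem VRel.exists_clo_left {b : Expr C D} {ρ : VEnv C D Addr} {v : Val C D Addr}
    (h : VRel S v (.clo b ρ)) : ∃ ρ', v = .clo b ρ' := by
  cases h with
  | clo h => exact ⟨_, rfl⟩

theorem VEnvRel.get : ∀ {ρ ρ' : VEnv C D Addr}, VEnvRel S ρ ρ' → ∀ i,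
    Option.Rel (fun p q => p.1 = q.1 ∧ (p.1 ∉ S → VRel S p.2 q.2)) (ρ.get i) (ρ'.get i)
  | .nil, _, h, i => by cases h; exact .none
  | .cons a v ρ, _, h, i => by
    cases h with
    | cons hv hρ =>
      cases i with
      | zero => exact .some ⟨rfl, hv⟩
      | succ i => exact VEnvRel.get hρ i

theorem VEnvRel.toEnv {ρ ρ' : VEnv C D Addr} (h : VEnvRel S ρ ρ') : EnvRel S ρ.toEnv ρ'.toEnv := by
  intro x
  cases x with
  | glob x => exact .none
  | loc i => exact h.get i

theorem EnvRel.cases (h : EnvRel S σ σ') (x : Var) : (σ x = none ∧ σ' x = none) ∨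
    ∃ a v v', σ x = some (a, v) ∧ σ' x = some (a, v') ∧ (a ∉ S → VRel S v v') := by
  have h := h x
  rcases hx : σ x with _ | ⟨a, v⟩ <;> rcases hy : σ' x with _ | ⟨b, w⟩ <;> rw [hx, hy] at h
  · exact .inl ⟨rfl, rfl⟩
  · cases h
  · cases h
  · cases h with
    | some h => obtain ⟨rfl, h⟩ := h; exact .inr ⟨_, _, _, rfl, rfl, h⟩

theorem EnvRel.capture (h : EnvRel S σ σ') (xs : List Var) :
    VEnvRel S (σ.capture xs) (σ'.capture xs) := by
  induction xs with
  | nil => exact .nil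
  | cons x xs ih =>
    simp only [Env.capture]
    rcases h.cases x with ⟨hx, hy⟩ | ⟨a, v, v', hx, hy, hv⟩ <;> rw [hx, hy]
    · exact ih
    · exact .cons hv ih

theorem EnvRel.toName_eq (h : EnvRel S σ σ') : σ'.toName = σ.toName := by
  funext x
  rcases h.cases x with ⟨hx, hy⟩ | ⟨a, v, v', hx, hy, -⟩ <;> simp [Env.toName, hx, hy]

theorem EnvRel.isSome (h : EnvRel S σ σ') {x : Var} (hx : (σ x).isSome) : (σ' x).isSome := by
  rcases h.cases x with ⟨hx', hy⟩ | ⟨a, v, v', hx, hy, -⟩ <;> simp_all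

theorem EnvRel.assign (h : EnvRel S σ σ') {v v' : Val C D Addr} {x a : Addr}
    (hv : a ∉ S → VRel S v v') : EnvRel S (σ.assign x a v) (σ'.assign x a v') := by
  intro y
  simp only [Env.assign, Function.update_apply]
  split_ifs
  · exact .some ⟨rfl, hv⟩
  · exact h y

theorem Sim.expr_eq {π : Addr} {a b : AExpr C D} (h : Sim S π a b) : b.expr = a.expr := by
  induction h <;> simp_all [AExpr.expr]

variable {F : DistFamily C D}

/-- The two claims need each other. Related operator values outside `S` are closures with the same
code and the same captured identifiers, which makes the environments of the bodies related; local
validity is what guarantees that a value outside `S` is not passed on from a node in `S`. -/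
theorem Sim.transfer {π : Addr} {a b : AExpr C D} (h : Sim S π a b)
    (ha : a.Ok F σ π) (hb : b.Ok F σ' π) (hL : a.Loc S σ π) (hE : EnvRel S σ σ') :
    b.Loc S σ' π ∧ (π ∉ S → VRel S (a.val σ π) (b.val σ' π)) := by
  induction h generalizing σ σ' with
  | sym c => exact ⟨trivial, fun _ => .sym c⟩
  | @var π x =>
    obtain ⟨⟨a, v⟩, hx⟩ := Option.isSome_iff_exists.1 ha
    rcases hE.cases x with ⟨hx', -⟩ | ⟨a, v, v', hx, hy, hv⟩
    · simp [hx] at hx'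
    · refine ⟨fun c w hc => ?_, fun hπ => ?_⟩
      · rw [hy] at hc
        simp only [Option.some.injEq, Prod.mk.injEq] at hc
        exact hc.1 ▸ hL a v hx
      · simp only [AExpr.val, hx, hy]
        exact hv fun h => hπ (hL a v hx h)
  | lam b => exact ⟨trivial, fun _ => .clo (hE.capture _)⟩
  | neut _ _ _ ih₁ ih₂ =>
    have i₁ := ih₁ ha.1 hb.1 hL.1 hE
    have i₂ := ih₂ ha.2.1 hb.2.1 hL.2.1 hE
    exact ⟨⟨i₁.1, i₂.1, hL.2.2⟩, fun hπ => .app (i₁.2 fun h => hπ (hL.2.2.1 h))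
      (i₂.2 fun h => hπ (hL.2.2.2 h))⟩
  | beta hS _ _ _ ih₁ ih₂ ih₃ =>
    obtain ⟨ok₁, ok₂, ρ, hρ, ok₃⟩ := ha
    obtain ⟨ok₁', ok₂', ρ', hρ', ok₃'⟩ := hb
    have i₁ := ih₁ ok₁ ok₁' hL.1 hE
    have i₂ := ih₂ ok₂ ok₂' hL.2.1 hE
    have hR := i₁.2 hS
    rw [hρ, hρ'] at hR
    obtain ⟨ρ'', e, hR⟩ := hR.exists_clo
    simp only [Val.clo.injEq] at e
    obtain ⟨-, rfl⟩ := e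
    have i₃ := ih₃ ok₃ ok₃' ((hL.2.2.2 hS).2 _ _ hρ) (VEnvRel.cons i₂.2 hR).toEnv
    refine ⟨⟨i₁.1, i₂.1, hL.2.2.1, fun _ => ⟨(hL.2.2.2 hS).1, fun b ρ h => ?_⟩⟩, fun hπ => ?_⟩
    · rw [hρ'] at h
      simp only [Val.clo.injEq] at h
      obtain ⟨-, rfl⟩ := h
      exact i₃.1
    · rw [AExpr.val_beta hρ, AExpr.val_beta hρ']
      exact i₃.2 fun h => hπ ((hL.2.2.2 hS).1 h)
  | neut_neut hS _ _ ih₁ ih₂ =>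
    exact ⟨⟨(ih₁ ha.1 hb.1 hL.1 hE).1, (ih₂ ha.2.1 hb.2.1 hL.2.1 hE).1, hL.2.2⟩,
      fun hπ => absurd (hL.2.2.1 hS) hπ⟩
  | neut_beta hS _ _ ih₁ ih₂ =>
    exact ⟨⟨(ih₁ ha.1 hb.1 hL.1 hE).1, (ih₂ ha.2.1 hb.2.1 hL.2.1 hE).1, hL.2.2.1,
      fun h => absurd hS h⟩, fun hπ => absurd (hL.2.2.1 hS) hπ⟩
  | beta_neut hS _ _ ih₁ ih₂ =>
    exact ⟨⟨(ih₁ ha.1 hb.1 hL.1 hE).1, (ih₂ ha.2.1 hb.2.1 hL.2.1 hE).1, hL.2.2.1,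
      fun _ => hL.2.2.1 hS⟩, fun hπ => absurd (hL.2.2.1 hS) hπ⟩
  | beta_beta hS _ _ ih₁ ih₂ =>
    exact ⟨⟨(ih₁ ha.1 hb.1 hL.1 hE).1, (ih₂ ha.2.1 hb.2.1 hL.2.1 hE).1, hL.2.2.1,
      fun h => absurd hS h⟩, fun hπ => absurd (hL.2.2.1 hS) hπ⟩
  | dist_out hS _ _ ih ih' =>
    obtain ⟨ok₁, -, -, -, ok₂⟩ := ha
    obtain ⟨ok₁', -, -, -, ok₂'⟩ := hb
    have i₂ := ih' ok₂ ok₂' (hL.2.2 hS).2 (hE.capture _).toEnv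
    exact ⟨⟨(ih ok₁ ok₁' hL.1 hE).1, hL.2.1, fun _ => ⟨(hL.2.2 hS).1, i₂.1⟩⟩,
      fun hπ => i₂.2 fun h => hπ ((hL.2.2 hS).1 h)⟩
  | dist_in hS _ ih =>
    exact ⟨⟨(ih ha.1 hb.1 hL.1 hE).1, hL.2.1, fun h => absurd hS h⟩,
      fun hπ => absurd (hL.2.1 hS) hπ⟩

end Similarity

-- Stitching as the inverse of extraction

section Stitching

variable {C D : Type} {S : Finset Addr} {F : DistFamily C D}

theorem Trace.program_append (s t : Trace C D) :
    Trace.program (s ++ t) = s.program ++ t.program := List.map_append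

theorem Trace.program_cons (a : Stmt C D (AExpr C D)) (t : Trace C D) :
    Trace.program (a :: t) = a.roll :: t.program := rfl

/-- What may differ between `a` and `b` are bodies of applications with operator in `S` and outcomes
of choices in `S`. Extraction leaves both inside the augmented expression, where rolling back erases
them; the inlined parts correspond by `Sim.transfer`. -/
theorem Sim.program_extract {σ σ' : Env C D} {π : Addr} {a b : AExpr C D} (h : Sim S π a b)
    (ha : a.Ok F σ π) (hb : b.Ok F σ' π) (hL : a.Loc S σ π) (hE : EnvRel S σ σ') :
    (b.extract S σ' π).1.program = (a.extract S σ π).1.program ∧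
      (b.extract S σ' π).2.expr = (a.extract S σ π).2.expr := by
  induction h generalizing σ σ' with
  | sym c => exact ⟨rfl, rfl⟩
  | var x => simp [AExpr.extract, hE.toName_eq]
  | lam b => simp [AExpr.extract, hE.toName_eq]
  | neut _ _ _ ih₁ ih₂ =>
    have i₁ := ih₁ ha.1 hb.1 hL.1 hE
    have i₂ := ih₂ ha.2.1 hb.2.1 hL.2.1 hE
    simp only [AExpr.extract, AExpr.expr, Trace.program_append, i₁, i₂, and_self]
  | @beta π a₁ a₂ a₃ b₁ b₂ b₃ hS h₁ h₂ h₃ ih₁ ih₂ ih₃ =>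
    obtain ⟨ok₁, ok₂, ρ, hρ, ok₃⟩ := ha
    obtain ⟨ok₁', ok₂', ρ', hρ', ok₃'⟩ := hb
    have i₁ := ih₁ ok₁ ok₁' hL.1 hE
    have i₂ := ih₂ ok₂ ok₂' hL.2.1 hE
    have hR := (h₁.transfer ok₁ ok₁' hL.1 hE).2 hS
    rw [hρ, hρ'] at hR
    obtain ⟨ρ'', e, hR⟩ := hR.exists_clo
    simp only [Val.clo.injEq] at e
    obtain ⟨-, rfl⟩ := e
    have i₃ := ih₃ ok₃ ok₃' ((hL.2.2.2 hS).2 _ _ hρ)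
      (VEnvRel.cons (h₂.transfer ok₂ ok₂' hL.2.1 hE).2 hR).toEnv
    rw [AExpr.extract_beta_of_notMem hS hρ, AExpr.extract_beta_of_notMem hS hρ']
    simp only [Trace.program_append, Trace.program_cons, Stmt.roll, i₁, i₂, i₃, and_self]
  | neut_neut _ _ _ ih₁ ih₂ =>
    have i₁ := ih₁ ha.1 hb.1 hL.1 hE
    have i₂ := ih₂ ha.2.1 hb.2.1 hL.2.1 hE
    simp only [AExpr.extract, AExpr.expr, Trace.program_append, i₁, i₂, and_self]
  | neut_beta hS _ _ ih₁ ih₂ =>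
    have i₁ := ih₁ ha.1 hb.1 hL.1 hE
    have i₂ := ih₂ ha.2.1 hb.2.1 hL.2.1 hE
    rw [AExpr.extract_beta_of_mem hS]
    simp only [AExpr.extract, AExpr.expr, Trace.program_append, i₁, i₂, and_self]
  | beta_neut hS _ _ ih₁ ih₂ =>
    have i₁ := ih₁ ha.1 hb.1 hL.1 hE
    have i₂ := ih₂ ha.2.1 hb.2.1 hL.2.1 hE
    rw [AExpr.extract_beta_of_mem hS]
    simp only [AExpr.extract, AExpr.expr, Trace.program_append, i₁, i₂, and_self]
  | beta_beta hS _ _ ih₁ ih₂ =>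
    have i₁ := ih₁ ha.1 hb.1 hL.1 hE
    have i₂ := ih₂ ha.2.1 hb.2.1 hL.2.1 hE
    rw [AExpr.extract_beta_of_mem hS, AExpr.extract_beta_of_mem hS]
    simp only [AExpr.expr, Trace.program_append, i₁, i₂, and_self]
  | dist_out hS _ h₂ ih ih' =>
    obtain ⟨ok₁, -, -, -, ok₂⟩ := ha
    obtain ⟨ok₁', -, -, -, ok₂'⟩ := hb
    have i₁ := ih ok₁ ok₁' hL.1 hE
    have i₂ := ih' ok₂ ok₂' (hL.2.2 hS).2 (hE.capture _).toEnv
    rw [AExpr.extract_dist_of_notMem hS, AExpr.extract_dist_of_notMem hS]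
    simp only [Trace.program_append, Trace.program_cons, Stmt.roll, i₁, i₂, and_self,
      hE.toName_eq, h₂.expr_eq]
  | dist_in hS _ ih =>
    have i₁ := ih ha.1 hb.1 hL.1 hE
    rw [AExpr.extract_dist_of_mem hS, AExpr.extract_dist_of_mem hS]
    simp only [AExpr.expr, i₁, hE.toName_eq, and_self]

theorem AExpr.length_extract (a : AExpr C D) (σ : Env C D) (π : Addr) :
    (a.extract S σ π).1.length = a.emitted S π := by
  induction a generalizing σ π with
  | sym c => rfl
  | var x => rfl
  | lam b => rfl
  | neut a₁ a₂ ih₁ ih₂ => simp only [AExpr.extract, AExpr.emitted, List.length_append, ih₁, ih₂]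
  | beta a₁ a₂ a₃ ih₁ ih₂ ih₃ =>
    simp only [AExpr.extract, AExpr.emitted]
    split_ifs <;> simp only [List.length_append, List.length_cons, ih₁, ih₂, ih₃]
    omega
  | dist k xs a a' ih ih' =>
    simp only [AExpr.extract, AExpr.emitted]
    split_ifs <;> simp only [List.length_append, List.length_cons, ih, ih']
    omega

theorem Sim.emitted_eq {π : Addr} {a b : AExpr C D} (h : Sim S π a b) :
    a.emitted S π = b.emitted S π := by
  induction h <;> simp_all [AExpr.emitted]

/-- Purely syntactic: similar expressions emit equally many statements, so the counts computed from
`a` cut the statement list of `b` at the right places. -/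
theorem Sim.stitch_extract {π : Addr} {a b : AExpr C D} (h : Sim S π a b) (σ : Env C D) :
    a.stitch S π (b.extract S σ π).1 (b.extract S σ π).2 = b := by
  have T : ∀ {π : Addr} {a b : AExpr C D}, Sim S π a b → ∀ (σ : Env C D) (t : Trace C D),
      ((b.extract S σ π).1 ++ t).take (a.emitted S π) = (b.extract S σ π).1 := fun h σ t =>
    List.take_left' (by rw [AExpr.length_extract, h.emitted_eq])
  have R : ∀ {π : Addr} {a b : AExpr C D}, Sim S π a b → ∀ (σ : Env C D) (t : Trace C D),
      ((b.extract S σ π).1 ++ t).drop (a.emitted S π) = t := fun h σ t =>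
    List.drop_left' (by rw [AExpr.length_extract, h.emitted_eq])
  induction h generalizing σ with
  | sym c => rfl
  | var x => rfl
  | lam b => rfl
  | neut hS h₁ h₂ ih₁ ih₂ => simp only [AExpr.extract, AExpr.stitch, T h₁, R h₁, ih₁, ih₂]
  | beta hS h₁ h₂ h₃ ih₁ ih₂ ih₃ =>
    simp only [AExpr.extract, AExpr.stitch, hS, if_false, T h₁, R h₁, T h₂, R h₂, ih₁, ih₂, ih₃]
  | neut_neut hS h₁ h₂ ih₁ ih₂ =>
    simp only [AExpr.extract, AExpr.stitch, T h₁, R h₁, ih₁, ih₂]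
  | neut_beta hS h₁ h₂ ih₁ ih₂ =>
    simp only [AExpr.extract, AExpr.stitch, hS, if_true, T h₁, R h₁, ih₁, ih₂]
  | beta_neut hS h₁ h₂ ih₁ ih₂ =>
    simp only [AExpr.extract, AExpr.stitch, hS, if_true, T h₁, R h₁, ih₁, ih₂]
  | beta_beta hS h₁ h₂ ih₁ ih₂ =>
    simp only [AExpr.extract, AExpr.stitch, hS, if_true, T h₁, R h₁, ih₁, ih₂]
  | dist_out hS h₁ h₂ ih ih' =>
    simp only [AExpr.extract, AExpr.stitch, hS, if_false, T h₁, R h₁, ih, ih']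
  | dist_in hS h₁ ih => simp only [AExpr.extract, AExpr.stitch, hS, if_true, ih]

theorem Trace.program_eq_append {s : Trace C D} {p q : Program C D} (h : s.program = p ++ q) :
    ∃ s₁ s₂, s = s₁ ++ s₂ ∧ Trace.program s₁ = p ∧ Trace.program s₂ = q :=
  List.map_eq_append_iff.1 h

theorem Trace.program_eq_assume {s : Trace C D} {x : Addr} {e : Expr C D} {p : Program C D}
    (h : s.program = .assume x e :: p) :
    ∃ b t, s = .assume x b :: t ∧ b.expr = e ∧ Trace.program t = p := by
  obtain ⟨st, t, rfl, h₁, h₂⟩ := List.map_eq_cons_iff.1 h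
  cases st with
  | assume y b =>
    simp only [Stmt.roll, Stmt.assume.injEq] at h₁
    exact ⟨b, t, by rw [h₁.1], h₁.2, h₂⟩
  | observe k xs b d => simp [Stmt.roll] at h₁

theorem Trace.program_eq_observe {s : Trace C D} {k : D} {xs : List Var} {e d : Expr C D}
    {p : Program C D} (h : s.program = .observe k xs e d :: p) :
    ∃ b t, s = .observe k xs b d :: t ∧ b.expr = e ∧ Trace.program t = p := by
  obtain ⟨st, t, rfl, h₁, h₂⟩ := List.map_eq_cons_iff.1 h
  cases st with
  | assume y b => simp [Stmt.roll] at h₁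
  | observe k' xs' b d' =>
    simp only [Stmt.roll, Stmt.observe.injEq] at h₁
    obtain ⟨rfl, rfl, h₁, rfl⟩ := h₁
    exact ⟨b, t, rfl, h₁, h₂⟩

theorem AExpr.names_of_program {a : AExpr C D} {σ : Env C D} {π : Addr} {s : Trace C D}
    (h : s.program = (a.extract S σ π).1.program) : ∀ q ∈ stmtNames s, Under π q := by
  rw [← stmtNames_program, h, stmtNames_program]
  exact a.names_extract σ π

theorem AExpr.emitted_of_program {a : AExpr C D} {σ : Env C D} {π : Addr} {s : Trace C D}
    (h : s.program = (a.extract S σ π).1.program) : s.length = a.emitted S π := by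
  rw [← a.length_extract σ]
  simpa [Trace.program] using congrArg List.length h

/-- `u` is valid, differs from `a` only in `S`, and its extraction is `r`. -/
structure StitchedFrom (F : DistFamily C D) (S : Finset Addr) (a : AExpr C D) (π : Addr)
    (σ : Env C D) (u : AExpr C D) (r : Trace C D × AExpr C D) : Prop where
  sim : Sim S π a u
  ok : u.Ok F σ π
  extract : u.extract S σ π = r

theorem StitchedFrom.extractsTo {a u : AExpr C D} {π : Addr} {σ σ' τ : Env C D}
    {r : Trace C D × AExpr C D} {P : Addr → Prop} (h : StitchedFrom F S a π σ' u r)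
    (ha : a.Ok F σ π) (hL : a.Loc S σ π) (hE : EnvRel S σ σ') (hσ : EnvWf P σ') (hP : Fresh P π)
    (hK : EnvKnown S τ σ') (j : ℕ) : ExtractsTo F S P u σ' π τ j r := by
  have := AExpr.extract_spec h.ok hσ hP (h.sim.transfer ha h.ok hL hE).1 hK j
  rwa [h.extract] at this

/-- Surjectivity of extraction. The given run is cut along the program extracted from `a`, and the
pieces are stitched recursively. Each stitched piece satisfies `AExpr.extract_spec`, which
translates the validity of the next piece from the state of the subtrace back to the original
environment. -/
theorem AExpr.stitch_spec {a : AExpr C D} {σ σ' τ : Env C D} {P : Addr → Prop} {π : Addr}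
    (ha : a.Ok F σ π) (hL : a.Loc S σ π) (hE : EnvRel S σ σ') (hσ : EnvWf P σ') (hP : Fresh P π)
    (hK : EnvKnown S τ σ') {j : ℕ} {s : Trace C D} {b : AExpr C D}
    (hp : s.program = (a.extract S σ π).1.program) (he : b.expr = (a.extract S σ π).2.expr)
    (hs : Runs F τ j s) {τ' : Env C D} {ϖ : Addr}
    (hA : (envAfter τ j s).Agree (fun q => P q ∨ Under π q) τ') (hb : b.Ok F τ' ϖ) :
    StitchedFrom F S a π σ' (a.stitch S π s b) (s, b) := by
  induction a generalizing σ σ' τ P π j s b τ' ϖ with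
  | sym c =>
    have hs : s = [] := List.map_eq_nil_iff.1 hp
    subst hs
    cases b <;> simp_all only [AExpr.extract, AExpr.expr, reduceCtorEq, Expr.sym.injEq]
    exact ⟨.sym c, trivial, rfl⟩
  | var x =>
    have hs : s = [] := List.map_eq_nil_iff.1 hp
    subst hs
    cases b <;> simp only [AExpr.extract, AExpr.expr, reduceCtorEq, Expr.var.injEq] at he
    subst he
    exact ⟨.var x, hE.isSome ha, by simp only [AExpr.stitch, AExpr.extract, hE.toName_eq]⟩
  | lam b =>
    have hs : s = [] := List.map_eq_nil_iff.1 hp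
    subst hs
    cases b <;> simp only [AExpr.extract, AExpr.expr, reduceCtorEq, Expr.lam.injEq] at he
    subst he
    exact ⟨.lam b, fun x hx => hE.isSome (ha x hx),
      by simp only [AExpr.stitch, AExpr.extract, hE.toName_eq]⟩
  | neut a₁ a₂ ih₁ ih₂ =>
    obtain ⟨ok₁, ok₂, hn⟩ := ha
    obtain ⟨L₁, L₂, l₁, l₂⟩ := hL
    simp only [AExpr.extract, Trace.program_append] at hp he
    obtain ⟨s₁, s₂, rfl, p₁, p₂⟩ := Trace.program_eq_append hp
    have n₁ := AExpr.names_of_program p₁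
    have n₂ := AExpr.names_of_program p₂
    have e₁ := AExpr.emitted_of_program p₁
    rw [runs_append] at hs
    rw [envAfter_append] at hA
    have A₁ := agree_second hP n₂ hA
    have A₂ := hA.mono fun q => Or.imp_right (Under.of_cons (i := 2) (π := π) (q := q))
    have K₂ := hK.congr hσ (agree_first (j := j) hP n₁)
    have St₁ : ∀ {b₁ : AExpr C D}, b₁.expr = (a₁.extract S σ (1 :: π)).2.expr →
        b₁.Ok F τ' (1 :: ϖ) → StitchedFrom F S a₁ (1 :: π) σ' (a₁.stitch S (1 :: π) s₁ b₁)
          (s₁, b₁) :=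
      fun h hb => ih₁ ok₁ L₁ hE hσ (hP.cons 1) hK p₁ h hs.1 A₁ hb
    have St₂ : ∀ {b₂ : AExpr C D}, b₂.expr = (a₂.extract S σ (2 :: π)).2.expr →
        b₂.Ok F τ' (2 :: ϖ) → StitchedFrom F S a₂ (2 :: π) σ' (a₂.stitch S (2 :: π) s₂ b₂)
          (s₂, b₂) :=
      fun h hb => ih₂ ok₂ L₂ hE hσ (hP.cons 2) K₂ p₂ h hs.2 A₂ hb
    cases b with
    | neut b₁ b₂ =>
      simp only [AExpr.expr, Expr.app.injEq] at he
      have t₁ := St₁ he.1 hb.1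
      have t₂ := St₂ he.2 hb.2.1
      have x₁ := t₁.extractsTo ok₁ L₁ hE hσ (hP.cons 1) hK j
      simp only [AExpr.stitch, List.take_left' e₁, List.drop_left' e₁]
      refine ⟨?_, ⟨t₁.ok, t₂.ok, fun c ρ hc => ?_⟩, ?_⟩
      · by_cases hS : 1 :: π ∈ S
        · exact .neut_neut hS t₁.sim t₂.sim
        · exact .neut hS t₁.sim t₂.sim
      · have := x₁.bare A₁ (1 :: ϖ)
        rw [hc] at this
        obtain ⟨ρ', h', -⟩ := Val.clo_of_bare this
        exact hb.2.2 _ _ h'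
      · simp only [AExpr.extract, t₁.extract, t₂.extract]
    | beta b₁ b₂ b₃ =>
      simp only [AExpr.expr, Expr.app.injEq] at he
      obtain ⟨hb₁, hb₂, ρ, hρ, hb₃⟩ := hb
      have t₁ := St₁ he.1 hb₁
      have t₂ := St₂ he.2 hb₂
      have x₁ := t₁.extractsTo ok₁ L₁ hE hσ (hP.cons 1) hK j
      have x₂ := t₂.extractsTo ok₂ L₂ hE hσ (hP.cons 2) K₂ (j + s₁.length)
      have hv := x₁.bare A₁ (1 :: ϖ)
      rw [hρ] at hv
      obtain ⟨ρ', hρ', hbare⟩ := Val.clo_of_bare hv.symm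
      -- In `a` the operator is stuck, in the new run it is a closure. Outside `S` related values
      -- have the same shape, so the operator must belong to `S`.
      have hS : 1 :: π ∈ S := by
        by_contra hS
        have := (t₁.sim.transfer ok₁ t₁.ok L₁ hE).2 hS
        rw [hρ'] at this
        obtain ⟨ρ'', h⟩ := this.exists_clo_left
        exact hn _ _ h
      simp only [AExpr.stitch, List.take_left' e₁, List.drop_left' e₁, hS, if_true]
      refine ⟨.neut_beta hS t₁.sim t₂.sim, ⟨t₁.ok, t₂.ok, ρ', hρ', hb₃.congr ?_ _⟩, ?_⟩
      · refine VEnv.toEnv_bares ?_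
        simp only [VEnv.bare, hbare, x₂.bare A₂]
      · rw [AExpr.extract_beta_of_mem hS, t₁.extract, t₂.extract]
    | sym c => simp [AExpr.expr] at he
    | var c => simp [AExpr.expr] at he
    | lam c => simp [AExpr.expr] at he
    | dist k xs c c' => simp [AExpr.expr] at he
  | beta a₁ a₂ a₃ ih₁ ih₂ ih₃ =>
    obtain ⟨ok₁, ok₂, ρ, hρ, ok₃⟩ := ha
    obtain ⟨L₁, L₂, l₁, L₃⟩ := hL
    by_cases hS : 1 :: π ∈ S
    · simp only [AExpr.extract_beta_of_mem hS, Trace.program_append] at hp he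
      obtain ⟨s₁, s₂, rfl, p₁, p₂⟩ := Trace.program_eq_append hp
      have n₁ := AExpr.names_of_program p₁
      have n₂ := AExpr.names_of_program p₂
      have e₁ := AExpr.emitted_of_program p₁
      rw [runs_append] at hs
      rw [envAfter_append] at hA
      have A₁ := agree_second hP n₂ hA
      have A₂ := hA.mono fun q => Or.imp_right (Under.of_cons (i := 2) (π := π) (q := q))
      have K₂ := hK.congr hσ (agree_first (j := j) hP n₁)
      have St₁ : ∀ {b₁ : AExpr C D}, b₁.expr = (a₁.extract S σ (1 :: π)).2.expr →
          b₁.Ok F τ' (1 :: ϖ) → StitchedFrom F S a₁ (1 :: π) σ' (a₁.stitch S (1 :: π) s₁ b₁)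
            (s₁, b₁) :=
        fun h hb => ih₁ ok₁ L₁ hE hσ (hP.cons 1) hK p₁ h hs.1 A₁ hb
      have St₂ : ∀ {b₂ : AExpr C D}, b₂.expr = (a₂.extract S σ (2 :: π)).2.expr →
          b₂.Ok F τ' (2 :: ϖ) → StitchedFrom F S a₂ (2 :: π) σ' (a₂.stitch S (2 :: π) s₂ b₂)
            (s₂, b₂) :=
        fun h hb => ih₂ ok₂ L₂ hE hσ (hP.cons 2) K₂ p₂ h hs.2 A₂ hb
      cases b with
      | neut b₁ b₂ =>
        simp only [AExpr.expr, Expr.app.injEq] at he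
        have t₁ := St₁ he.1 hb.1
        have t₂ := St₂ he.2 hb.2.1
        have x₁ := t₁.extractsTo ok₁ L₁ hE hσ (hP.cons 1) hK j
        simp only [AExpr.stitch, List.take_left' e₁, List.drop_left' e₁, hS, if_true]
        refine ⟨.beta_neut hS t₁.sim t₂.sim, ⟨t₁.ok, t₂.ok, fun c ρ hc => ?_⟩, ?_⟩
        · have := x₁.bare A₁ (1 :: ϖ)
          rw [hc] at this
          obtain ⟨ρ', h', -⟩ := Val.clo_of_bare this
          exact hb.2.2 _ _ h'
        · simp only [AExpr.extract, t₁.extract, t₂.extract]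
      | beta b₁ b₂ b₃ =>
        simp only [AExpr.expr, Expr.app.injEq] at he
        obtain ⟨hb₁, hb₂, ρ₀, hρ₀, hb₃⟩ := hb
        have t₁ := St₁ he.1 hb₁
        have t₂ := St₂ he.2 hb₂
        have x₁ := t₁.extractsTo ok₁ L₁ hE hσ (hP.cons 1) hK j
        have x₂ := t₂.extractsTo ok₂ L₂ hE hσ (hP.cons 2) K₂ (j + s₁.length)
        have hv := x₁.bare A₁ (1 :: ϖ)
        rw [hρ₀] at hv
        obtain ⟨ρ', hρ', hbare⟩ := Val.clo_of_bare hv.symm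
        simp only [AExpr.stitch, List.take_left' e₁, List.drop_left' e₁, hS, if_true]
        refine ⟨.beta_beta hS t₁.sim t₂.sim, ⟨t₁.ok, t₂.ok, ρ', hρ', hb₃.congr ?_ _⟩, ?_⟩
        · refine VEnv.toEnv_bares ?_
          simp only [VEnv.bare, hbare, x₂.bare A₂]
        · rw [AExpr.extract_beta_of_mem hS, t₁.extract, t₂.extract]
      | sym c => simp [AExpr.expr] at he
      | var c => simp [AExpr.expr] at he
      | lam c => simp [AExpr.expr] at he
      | dist k xs c c' => simp [AExpr.expr] at he
    · obtain ⟨l₃, L₃⟩ := L₃ hS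
      simp only [AExpr.extract_beta_of_notMem hS hρ, Trace.program_append, Trace.program_cons,
        Stmt.roll] at hp he
      obtain ⟨s₁, s, rfl, p₁, hp⟩ := Trace.program_eq_append hp
      obtain ⟨b₁, s, rfl, q₁, hp⟩ := Trace.program_eq_assume hp
      obtain ⟨s₂, s, rfl, p₂, hp⟩ := Trace.program_eq_append hp
      obtain ⟨b₂, s₃, rfl, q₂, p₃⟩ := Trace.program_eq_assume hp
      have n₁ := AExpr.names_of_program p₁
      have n₂ := AExpr.names_of_program p₂
      have e₁ := AExpr.emitted_of_program p₁
      have e₂ := AExpr.emitted_of_program p₂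
      simp only [runs_append, Runs] at hs
      obtain ⟨hs₁, hb₁, hs₂, hb₂, hs₃⟩ := hs
      simp only [envAfter_append, envAfter] at hA
      have t₁ := ih₁ ok₁ L₁ hE hσ (hP.cons 1) hK p₁ q₁ hs₁ (.refl _ _) hb₁
      have x₁ := t₁.extractsTo ok₁ L₁ hE hσ (hP.cons 1) hK j
      have K₂ := hK.congr hσ (agree_first_assign (j := j) (a := [j + s₁.length])
        (v := b₁.val (envAfter τ j s₁) [j + s₁.length]) hP n₁)
      have t₂ := ih₂ ok₂ L₂ hE hσ (hP.cons 2) K₂ p₂ q₂ hs₂ (.refl _ _) hb₂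
      have x₂ := t₂.extractsTo ok₂ L₂ hE hσ (hP.cons 2) K₂ (j + s₁.length + 1)
      -- The operator is outside `S`, so the stitched operator evaluates to a closure with the old
      -- code, and the inlined statements are a run of that same body.
      have hR := (t₁.sim.transfer ok₁ t₁.ok L₁ hE).2 hS
      rw [hρ] at hR
      obtain ⟨ρ', hρ', hR⟩ := hR.exists_clo
      have w₁ := t₁.ok.val_wf hσ (hP.cons 1)
      have w₂ := t₂.ok.val_wf hσ (hP.cons 2)
      have k₁ := x₁.known (.refl _ _) hS
      rw [hρ'] at w₁ k₁
      have t₃ := ih₃ ok₃ (L₃ _ _ hρ)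
        (VEnvRel.cons (t₂.sim.transfer ok₂ t₂.ok L₂ hE).2 hR).toEnv
        (VEnv.Wf.body hP w₁ w₂).toEnv hP.body
        (ExtractsTo.known_body (r₂ := (s₂, b₂)) hP n₂ w₁ w₂ k₁ x₂) p₃ he hs₃
        (hA.mono fun q hq => hq.elim BodyScope.scope fun h => .inr h.of_cons) hb
      simp only [AExpr.stitch, List.take_left' e₁, List.drop_left' e₁, hS, if_false,
        List.take_left' e₂, List.drop_left' e₂]
      refine ⟨.beta hS t₁.sim t₂.sim t₃.sim, ⟨t₁.ok, t₂.ok, ρ', ?_, t₃.ok⟩, ?_⟩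
      · rw [hρ', t₃.sim.expr_eq]
      · rw [AExpr.extract_beta_of_notMem hS hρ', t₁.extract, t₂.extract, t₃.extract]
  | dist k xs a a' ih ih' =>
    obtain ⟨ok₁, hnd, hbd, hd, ok₂⟩ := ha
    obtain ⟨L₁, l₁, L₂⟩ := hL
    by_cases hS : 0 :: π ∈ S
    · simp only [AExpr.extract_dist_of_mem hS] at hp he
      have n₁ := AExpr.names_of_program hp
      cases b with
      | dist k' xs' b b' =>
        simp only [AExpr.expr, Expr.dist.injEq] at he
        obtain ⟨rfl, rfl, he⟩ := he
        obtain ⟨hb₁, -, -, hd', hb₂⟩ := hb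
        have A₁ := hA.mono fun q => Or.imp_right (Under.of_cons (i := 1) (π := π) (q := q))
        have t₁ := ih ok₁ L₁ hE hσ (hP.cons 1) hK hp he hs A₁ hb₁
        have x₁ := t₁.extractsTo ok₁ L₁ hE hσ (hP.cons 1) hK j
        have K : EnvKnown S τ' σ' := hK.congr hσ ((agree_first (j := j) hP n₁).trans
          (hA.mono fun _ => .inl))
        simp only [AExpr.stitch, hS, if_true]
        refine ⟨.dist_in hS t₁.sim, ⟨t₁.ok, hnd, fun x hx => hE.isSome (hbd x hx), ?_,
          hb₂.congr (VEnv.toEnv_bares ?_) _⟩, ?_⟩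
        · rwa [← x₁.bare A₁ (1 :: ϖ)]
        · rw [← hE.toName_eq]
          exact Env.capture_map_bare fun x hx =>
            EnvKnown.bares_toName K (hE.isSome (hbd x hx))
        · rw [AExpr.extract_dist_of_mem hS, t₁.extract, hE.toName_eq]
      | neut b₁ b₂ => simp [AExpr.expr] at he
      | beta b₁ b₂ b₃ => simp [AExpr.expr] at he
      | sym c => simp [AExpr.expr] at he
      | var c => simp [AExpr.expr] at he
      | lam c => simp [AExpr.expr] at he
    · obtain ⟨l₂, L₂⟩ := L₂ hS
      simp only [AExpr.extract_dist_of_notMem hS, Trace.program_append, Trace.program_cons,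
        Stmt.roll] at hp he
      obtain ⟨s₁, s, rfl, p₁, hp⟩ := Trace.program_eq_append hp
      obtain ⟨b₁, s₂, rfl, q₁, p₂⟩ := Trace.program_eq_observe hp
      have n₁ := AExpr.names_of_program p₁
      have e₁ := AExpr.emitted_of_program p₁
      simp only [runs_append, Runs] at hs
      obtain ⟨hs₁, hb₁, hd', hs₂⟩ := hs
      simp only [envAfter_append, envAfter] at hA
      have t₁ := ih ok₁ L₁ hE hσ (hP.cons 1) hK p₁ q₁ hs₁ (.refl _ _) hb₁
      have x₁ := t₁.extractsTo ok₁ L₁ hE hσ (hP.cons 1) hK j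
      have t₂ := ih' ok₂ L₂ (hE.capture xs).toEnv (hσ.capture hnd).toEnv (hP.cons 2)
        (EnvKnown.capture (hK.congr hσ (agree_first (j := j) hP n₁)) xs).toEnv p₂ he hs₂
        (hA.mono fun q => Or.imp_right (Under.of_cons (i := 2) (π := π) (q := q))) hb
      simp only [AExpr.stitch, List.take_left' e₁, List.drop_left' e₁, hS, if_false]
      refine ⟨.dist_out hS t₁.sim t₂.sim, ⟨t₁.ok, hnd, fun x hx => hE.isSome (hbd x hx), ?_,
        t₂.ok⟩, ?_⟩
      · rw [t₂.sim.expr_eq, ← x₁.bare (.refl _ _) [1, j + s₁.length]]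
        exact hd'
      · rw [AExpr.extract_dist_of_notMem hS, t₁.extract, t₂.extract, t₂.sim.expr_eq,
          hE.toName_eq]

end Stitching

-- Extraction and stitching of whole traces

section Traces

variable {C D : Type} {S : Finset Addr} {F : DistFamily C D}

/-- Positions in the statements before the one with number `j`. -/
def Scope (j : ℕ) (q : Addr) : Prop := ∃ i < j, [i] <:+ q

theorem fresh_scope (j : ℕ) : Fresh (Scope j) [j] := by
  rintro q ⟨i, hi, h⟩ h'
  exact not_suffix_of_ne hi.ne h h'

theorem Scope.succ {j : ℕ} {q : Addr} (h : Scope j q) : Scope (j + 1) q :=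
  let ⟨i, hi, h⟩ := h
  ⟨i, hi.trans j.lt_succ_self, h⟩

theorem scope_succ_of_suffix {j : ℕ} {q : Addr} (h : [j] <:+ q) : Scope (j + 1) q :=
  ⟨j, j.lt_succ_self, h⟩

theorem not_scope_self (j : ℕ) : ¬ Scope j [j] := fun h => fresh_scope j _ h (List.suffix_refl _)

/-- The part of validity of the subproblem `S` that concerns the statements of a trace. -/
def LocFrom (S : Finset Addr) : Env C D → ℕ → Trace C D → Prop
  | _, _, [] => True
  | σ, j, .assume x a :: t =>
    a.Loc S σ [j] ∧ LocFrom S (σ.assign x [j] (a.val σ [j])) (j + 1) t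
  | σ, j, .observe _ _ a _ :: t => a.Loc S σ [1, j] ∧ LocFrom S σ (j + 1) t

theorem EnvWf.assign_scope {σ : Env C D} {j : ℕ} {a : AExpr C D} (hσ : EnvWf (Scope j) σ)
    (ha : a.Ok F σ [j]) (x : Addr) : EnvWf (Scope (j + 1)) (σ.assign x [j] (a.val σ [j])) :=
  (hσ.assign (not_scope_self j) (ha.val_wf hσ (fresh_scope j))).mono fun _ hq =>
    hq.elim Scope.succ scope_succ_of_suffix

theorem ExtractsTo.known_assign {a : AExpr C D} {σ τ : Env C D} {j i l : ℕ}
    {r : Trace C D × AExpr C D} (h : ExtractsTo F S (Scope j) a σ [j] τ i r) (ha : a.Ok F σ [j])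
    (hσ : EnvWf (Scope j) σ) (hK : EnvKnown S τ σ) (hn : ∀ q ∈ stmtNames r.1, Under [j] q)
    (x : Addr) :
    EnvKnown S ((envAfter τ i r.1).assign [j] [l] (r.2.val (envAfter τ i r.1) [l]))
      (σ.assign x [j] (a.val σ [j])) :=
  (hK.congr hσ (agree_of_under hn (fresh_scope j))).assign hσ (not_scope_self j)
    (h.bare (.refl _ _) _) (ha.val_wf hσ (fresh_scope j)) (h.known (.refl _ _))

/-- The statement counters `j` and `i` drift apart because inlining inserts statements. This is
harmless: the counter in the extracted trace affects identifiers only, and variables are named by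
their original positions. -/
theorem extractFrom_spec {t : Trace C D} {σ τ : Env C D} {j : ℕ} (ht : Runs F σ j t)
    (hσ : EnvWf (Scope j) σ) (hL : LocFrom S σ j t) (hK : EnvKnown S τ σ) (i : ℕ) :
    Runs F τ i (extractFrom S σ j t) ∧
      densityFrom F τ i (extractFrom S σ j t) = densityFrom F σ j t := by
  induction t generalizing σ τ j i with
  | nil => exact ⟨trivial, rfl⟩
  | cons st t ih =>
    cases st with
    | assume x a =>
      have e := AExpr.extract_spec ht.1 hσ (fresh_scope j) hL.1 hK i
      have ih := ih ht.2 (hσ.assign_scope ht.1 x) hL.2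
        (e.known_assign (l := i + (a.extract S σ [j]).1.length) ht.1 hσ hK
          (a.names_extract σ [j]) x) (i + (a.extract S σ [j]).1.length + 1)
      constructor
      · simp only [extractFrom, runs_append, Runs]
        exact ⟨e.runs, e.ok (.refl _ _) _, ih.1⟩
      · simp only [extractFrom, densityFrom_append, densityFrom]
        rw [ih.2, ← mul_assoc, e.density (.refl _ _)]
    | observe k xs a d =>
      have e := AExpr.extract_spec ht.1 hσ ((fresh_scope j).cons 1) hL.1 hK i
      have ih := ih ht.2.2 (hσ.mono fun _ => Scope.succ) hL.2
        (hK.congr hσ (agree_of_under (j := i) (a.names_extract (S := S) σ [1, j])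
          ((fresh_scope j).cons 1))) (i + (a.extract S σ [1, j]).1.length + 1)
      constructor
      · simp only [extractFrom, runs_append, Runs]
        refine ⟨e.runs, e.ok (.refl _ _) _, ?_, ih.1⟩
        rw [e.bare (.refl _ _)]
        exact ht.2.1
      · simp only [extractFrom, densityFrom_append, densityFrom]
        rw [ih.2, ← e.density (.refl _ _) [1, i + (a.extract S σ [1, j]).1.length],
          e.bare (.refl _ _)]
        ring

theorem SimFrom.program_eq {j : ℕ} {t u : Trace C D} (h : SimFrom S j t u) :
    u.program = t.program := by
  induction h with
  | nil => rfl
  | assume h _ ih => rw [Trace.program_cons, Trace.program_cons, ih, Stmt.roll, Stmt.roll, h.expr_eq]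
  | observe h _ ih =>
    rw [Trace.program_cons, Trace.program_cons, ih, Stmt.roll, Stmt.roll, h.expr_eq]

theorem SimFrom.transfer {j : ℕ} {t u : Trace C D} {σ σ' : Env C D} (h : SimFrom S j t u)
    (ht : Runs F σ j t) (hu : Runs F σ' j u) (hL : LocFrom S σ j t) (hE : EnvRel S σ σ') :
    LocFrom S σ' j u ∧
      (extractFrom S σ' j u).program = (extractFrom S σ j t).program := by
  induction h generalizing σ σ' with
  | nil => exact ⟨trivial, rfl⟩
  | assume h _ ih =>
    have tr := h.transfer ht.1 hu.1 hL.1 hE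
    have p := h.program_extract ht.1 hu.1 hL.1 hE
    have ih := ih ht.2 hu.2 hL.2 (hE.assign tr.2)
    refine ⟨⟨tr.1, ih.1⟩, ?_⟩
    simp only [extractFrom, Trace.program_append, Trace.program_cons, Stmt.roll, p, ih.2]
  | observe h _ ih =>
    have tr := h.transfer ht.1 hu.1 hL.1 hE
    have p := h.program_extract ht.1 hu.1 hL.1 hE
    have ih := ih ht.2.2 hu.2.2 hL.2 hE
    refine ⟨⟨tr.1, ih.1⟩, ?_⟩
    simp only [extractFrom, Trace.program_append, Trace.program_cons, Stmt.roll, p, ih.2,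
      hE.toName_eq]

theorem SimFrom.stitch_extract {j : ℕ} {t u : Trace C D} (h : SimFrom S j t u) (σ : Env C D) :
    stitchFrom S j t (extractFrom S σ j u) = u := by
  induction h generalizing σ with
  | nil => rfl
  | @assume j x a b t u h _ ih =>
    have e : (b.extract S σ [j]).1.length = a.emitted S [j] := by
      rw [AExpr.length_extract, h.emitted_eq]
    simp only [extractFrom, stitchFrom, List.take_left' e, List.drop_left' e, ih, h.stitch_extract]
  | @observe j k xs a b d t u h _ ih =>
    have e : (b.extract S σ [1, j]).1.length = a.emitted S [1, j] := by
      rw [AExpr.length_extract, h.emitted_eq]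
    simp only [extractFrom, stitchFrom, List.take_left' e, List.drop_left' e, ih, h.stitch_extract]

/-- Two environments of the original program are needed: `σ` for the old trace `t`, which fixes the
subprogram, and `σ'` for the stitched trace, whose earlier statements may already have other values.
-/
theorem stitchFrom_spec {t : Trace C D} {σ σ' τ : Env C D} {j i : ℕ} {s : Trace C D}
    (ht : Runs F σ j t) (hL : LocFrom S σ j t) (hE : EnvRel S σ σ') (hσ : EnvWf (Scope j) σ')
    (hK : EnvKnown S τ σ') (hp : s.program = (extractFrom S σ j t).program)
    (hs : Runs F τ i s) :
    SimFrom S j t (stitchFrom S j t s) ∧ Runs F σ' j (stitchFrom S j t s) ∧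
      extractFrom S σ' j (stitchFrom S j t s) = s := by
  induction t generalizing σ σ' τ j i s with
  | nil =>
    have hs : s = [] := List.map_eq_nil_iff.1 hp
    subst hs
    exact ⟨.nil, trivial, rfl⟩
  | cons st t ih =>
    cases st with
    | assume x a =>
      simp only [extractFrom, Trace.program_append, Trace.program_cons, Stmt.roll] at hp
      obtain ⟨s₁, s, rfl, p₁, hp⟩ := Trace.program_eq_append hp
      obtain ⟨b, s₂, rfl, q, p₂⟩ := Trace.program_eq_assume hp
      have e₁ := AExpr.emitted_of_program p₁
      simp only [runs_append, Runs] at hs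
      obtain ⟨hs₁, hb, hs₂⟩ := hs
      have st := AExpr.stitch_spec ht.1 hL.1 hE hσ (fresh_scope j) hK p₁ q hs₁ (.refl _ _) hb
      have ex := st.extractsTo ht.1 hL.1 hE hσ (fresh_scope j) hK i
      have ih := ih ht.2 hL.2 (hE.assign (st.sim.transfer ht.1 st.ok hL.1 hE).2)
        (hσ.assign_scope st.ok x) (ex.known_assign (l := i + s₁.length) st.ok hσ hK
          (AExpr.names_of_program p₁) x) p₂ hs₂
      simp only [stitchFrom, List.take_left' e₁, List.drop_left' e₁]
      refine ⟨.assume st.sim ih.1, ⟨st.ok, ih.2.1⟩, ?_⟩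
      simp only [extractFrom, st.extract, ih.2.2]
    | observe k xs a d =>
      simp only [extractFrom, Trace.program_append, Trace.program_cons, Stmt.roll] at hp
      obtain ⟨s₁, s, rfl, p₁, hp⟩ := Trace.program_eq_append hp
      obtain ⟨b, s₂, rfl, q, p₂⟩ := Trace.program_eq_observe hp
      have e₁ := AExpr.emitted_of_program p₁
      simp only [runs_append, Runs] at hs
      obtain ⟨hs₁, hb, hd, hs₂⟩ := hs
      have hP := (fresh_scope j).cons 1
      have st := AExpr.stitch_spec ht.1 hL.1 hE hσ hP hK p₁ q hs₁ (.refl _ _) hb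
      have ex := st.extractsTo ht.1 hL.1 hE hσ hP hK i
      have ih := ih ht.2.2 hL.2 hE (hσ.mono fun _ => Scope.succ)
        (hK.congr hσ (agree_of_under (j := i) (AExpr.names_of_program p₁) hP)) p₂ hs₂
      simp only [stitchFrom, List.take_left' e₁, List.drop_left' e₁]
      refine ⟨.observe st.sim ih.1, ⟨st.ok, ?_, ih.2.1⟩, ?_⟩
      · rw [← ex.bare (.refl _ _) [1, i + s₁.length]]
        exact hd
      · simp only [extractFrom, st.extract, ih.2.2, hE.toName_eq]

end Traces

-- From dependence graphs to local conditions

section Graphs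

variable {C D : Type} {S : Finset Addr} {F : DistFamily C D}

/-- Positions of evaluated subexpressions (as opposed to sample nodes). -/
def IsExprPos (π : Addr) : Prop := ∀ i l, π ≠ 0 :: i :: l

theorem isExprPos_cons {i : ℕ} (hi : i ≠ 0) (π : Addr) : IsExprPos (i :: π) := by
  rintro j l h
  simp only [List.cons.injEq] at h
  exact hi h.1

/-- The data dependence edges that leave `S` end at sample nodes. -/
def DepGraph.DataValid (S : Finset Addr) (G : DepGraph) : Prop :=
  ∀ q r, (q, r) ∈ G.data → IsExprPos r → q ∈ S → r ∈ S

theorem DepGraph.DataValid.left {G H : DepGraph} (h : (G.union H).DataValid S) : G.DataValid S :=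
  fun q r hq => h q r (List.mem_append_left _ hq)

theorem DepGraph.DataValid.right {G H : DepGraph} (h : (G.union H).DataValid S) : H.DataValid S :=
  fun q r hq => h q r (List.mem_append_right _ hq)

theorem AExpr.loc_of_dataValid {a : AExpr C D} {σ : Env C D} {π : Addr} (hπ : IsExprPos π)
    (h : (a.graph σ π).DataValid S) : a.Loc S σ π := by
  induction a generalizing σ π with
  | sym c => trivial
  | var x =>
    intro a v hx ha
    refine h a π ?_ hπ ha
    simp [AExpr.graph, hx]
  | lam b => trivial
  | neut a₁ a₂ ih₁ ih₂ =>
    simp only [AExpr.graph] at h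
    exact ⟨ih₁ (isExprPos_cons (by decide) π) h.left.left,
      ih₂ (isExprPos_cons (by decide) π) h.left.right,
      h.right _ _ (by simp) hπ, h.right _ _ (by simp) hπ⟩
  | beta a₁ a₂ a₃ ih₁ ih₂ ih₃ =>
    simp only [AExpr.graph] at h
    refine ⟨ih₁ (isExprPos_cons (by decide) π) h.left.left.left,
      ih₂ (isExprPos_cons (by decide) π) h.left.left.right,
      h.right _ _ (by simp) hπ, fun _ => ⟨h.right _ _ (by simp) hπ, fun b ρ hρ => ?_⟩⟩
    have := h.left.right
    rw [hρ] at this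
    exact ih₃ (isExprPos_cons (by decide) π) this
  | dist k xs a a' ih ih' =>
    simp only [AExpr.graph] at h
    exact ⟨ih (isExprPos_cons (by decide) π) h.left.left, h.right _ _ (by simp) hπ,
      fun _ => ⟨h.right _ _ (by simp) hπ, ih' (isExprPos_cons (by decide) π) h.left.right⟩⟩

/-- Sample nodes are `0 :: π` with `π` nonempty. The address `[0]` of the expression in the first
statement also begins with `0`, so the length matters. -/
theorem AExpr.not_isExprPos_of_sample {a : AExpr C D} {σ : Env C D} {π q : Addr} (hπ : π ≠ [])
    (h : q ∈ (a.graph σ π).samples) : ¬ IsExprPos q := by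
  induction a generalizing σ π with
  | sym c => simp [AExpr.graph] at h
  | var x =>
    simp only [AExpr.graph] at h
    split at h <;> simp at h
  | lam b => simp [AExpr.graph] at h
  | neut a₁ a₂ ih₁ ih₂ =>
    simp only [AExpr.graph, DepGraph.union, List.mem_append, List.not_mem_nil, or_false] at h
    exact h.elim (ih₁ (by simp)) (ih₂ (by simp))
  | beta a₁ a₂ a₃ ih₁ ih₂ ih₃ =>
    simp only [AExpr.graph, DepGraph.union, List.mem_append, List.not_mem_nil, or_false] at h
    rcases h with (h | h) | h
    · exact ih₁ (by simp) h
    · exact ih₂ (by simp) h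
    · exact ih₃ (by simp) h
  | dist k xs a a' ih ih' =>
    simp only [AExpr.graph, DepGraph.union, List.mem_append, List.mem_singleton] at h
    rcases h with (h | h) | rfl
    · exact ih (by simp) h
    · exact ih' (by simp) h
    · obtain ⟨i, l, rfl⟩ := List.exists_cons_of_ne_nil hπ
      exact fun h => h i l rfl

theorem not_isExprPos_of_sampleFrom {t : Trace C D} {σ : Env C D} {j : ℕ} {q : Addr}
    (h : q ∈ (graphFrom σ j t).samples) : ¬ IsExprPos q := by
  induction t generalizing σ j with
  | nil => simp [graphFrom] at h
  | cons st t ih =>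
    cases st with
    | assume x a =>
      simp only [graphFrom, DepGraph.union, List.mem_append] at h
      exact h.elim (AExpr.not_isExprPos_of_sample (by simp)) ih
    | observe k xs a d =>
      simp only [graphFrom, DepGraph.union, List.mem_append, List.mem_singleton] at h
      rcases h with (h | rfl) | h
      · exact AExpr.not_isExprPos_of_sample (by simp) h
      · exact fun h => h j [] rfl
      · exact ih h

theorem locFrom_of_dataValid {t : Trace C D} {σ : Env C D} {j : ℕ}
    (h : (graphFrom σ j t).DataValid S) : LocFrom S σ j t := by
  induction t generalizing σ j with
  | nil => trivial
  | cons st t ih =>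
    cases st with
    | assume x a =>
      simp only [graphFrom] at h
      exact ⟨AExpr.loc_of_dataValid (by intro i l h; simp at h) h.left, ih h.right⟩
    | observe k xs a d =>
      simp only [graphFrom] at h
      exact ⟨AExpr.loc_of_dataValid (isExprPos_cons (by decide) _) h.left.left, ih h.right⟩

/-- A data edge that leaves `S` ends at a sample node, and sample nodes are not expression
positions; so edges into expression positions stay in `S`. -/
theorem ValidSubproblem.locFrom {t : Trace C D} (h : ValidSubproblem t S) :
    LocFrom S Env.empty 0 t := by
  refine locFrom_of_dataValid fun q r hqr hr hq => ?_
  by_contra hS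
  exact not_isExprPos_of_sampleFrom (h.data q hq r hqr hS) hr

theorem AExpr.suffix_of_node {a : AExpr C D} {σ : Env C D} {π q : Addr}
    (h : q ∈ (a.graph σ π).nodes) : π <:+ q := by
  induction a generalizing σ π with
  | sym c => simp [AExpr.graph] at h; simp [h]
  | var x =>
    simp only [AExpr.graph] at h
    split at h <;> simp at h <;> simp [h]
  | lam b => simp [AExpr.graph] at h; simp [h]
  | neut a₁ a₂ ih₁ ih₂ =>
    simp only [AExpr.graph, DepGraph.union, List.mem_append, List.mem_singleton] at h
    rcases h with (h | h) | rfl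
    · exact (List.suffix_cons _ _).trans (ih₁ h)
    · exact (List.suffix_cons _ _).trans (ih₂ h)
    · exact List.suffix_refl _
  | beta a₁ a₂ a₃ ih₁ ih₂ ih₃ =>
    simp only [AExpr.graph, DepGraph.union, List.mem_append, List.mem_singleton] at h
    rcases h with ((h | h) | h) | rfl
    · exact (List.suffix_cons _ _).trans (ih₁ h)
    · exact (List.suffix_cons _ _).trans (ih₂ h)
    · exact (List.suffix_cons _ _).trans (ih₃ h)
    · exact List.suffix_refl _
  | dist k xs a a' ih ih' =>
    simp only [AExpr.graph, DepGraph.union, List.mem_append, List.mem_cons, List.not_mem_nil,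
      or_false] at h
    rcases h with (h | h) | rfl | rfl
    · exact (List.suffix_cons _ _).trans (ih h)
    · exact (List.suffix_cons _ _).trans (ih' h)
    · exact List.suffix_refl _
    · exact List.suffix_cons _ _

theorem AExpr.self_mem_nodes (a : AExpr C D) (σ : Env C D) (π : Addr) :
    π ∈ (a.graph σ π).nodes := by
  cases a with
  | var x => simp only [AExpr.graph]; split <;> simp
  | _ => simp [AExpr.graph, DepGraph.union]

theorem AExpr.under_of_exist {a : AExpr C D} {σ : Env C D} {π q r : Addr}
    (h : (q, r) ∈ (a.graph σ π).exist) : Under π q ∧ Under π r := by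
  induction a generalizing σ π with
  | sym c => simp [AExpr.graph] at h
  | var x =>
    simp only [AExpr.graph] at h
    split at h <;> simp at h
  | lam b => simp [AExpr.graph] at h
  | neut a₁ a₂ ih₁ ih₂ =>
    simp only [AExpr.graph, DepGraph.union, List.mem_append, List.not_mem_nil, or_false] at h
    exact h.elim (fun h => (ih₁ h).imp Under.of_cons Under.of_cons)
      fun h => (ih₂ h).imp Under.of_cons Under.of_cons
  | beta a₁ a₂ a₃ ih₁ ih₂ ih₃ =>
    simp only [AExpr.graph, DepGraph.union, List.mem_append, List.mem_map, Prod.mk.injEq] at h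
    rcases h with ((h | h) | h) | ⟨n, hn, rfl, rfl⟩
    · exact (ih₁ h).imp Under.of_cons Under.of_cons
    · exact (ih₂ h).imp Under.of_cons Under.of_cons
    · exact (ih₃ h).imp Under.of_cons Under.of_cons
    · exact ⟨under_cons _ _, under_of_cons_suffix (AExpr.suffix_of_node hn)⟩
  | dist k xs a a' ih ih' =>
    simp only [AExpr.graph, DepGraph.union, List.mem_append, List.mem_map, Prod.mk.injEq] at h
    rcases h with (h | h) | ⟨n, hn, rfl, rfl⟩
    · exact (ih h).imp Under.of_cons Under.of_cons
    · exact (ih' h).imp Under.of_cons Under.of_cons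
    · exact ⟨under_cons _ _, under_of_cons_suffix (AExpr.suffix_of_node hn)⟩

theorem suffix_of_existFrom {t : Trace C D} {σ : Env C D} {j : ℕ} {q r : Addr}
    (h : (q, r) ∈ (graphFrom σ j t).exist) : ∃ i ≥ j, [i] <:+ q ∧ [i] <:+ r := by
  induction t generalizing σ j with
  | nil => simp [graphFrom] at h
  | cons st t ih =>
    cases st with
    | assume x a =>
      simp only [graphFrom, DepGraph.union, List.mem_append] at h
      rcases h with h | h
      · have := AExpr.under_of_exist h
        exact ⟨j, le_rfl, this.1.1, this.2.1⟩
      · obtain ⟨i, hi, h⟩ := ih h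
        exact ⟨i, by omega, h⟩
    | observe k xs a d =>
      simp only [graphFrom, DepGraph.union, List.mem_append, List.not_mem_nil, or_false] at h
      rcases h with h | h
      · have := AExpr.under_of_exist h
        exact ⟨j, le_rfl, this.1.of_cons.1, this.2.of_cons.1⟩
      · obtain ⟨i, hi, h⟩ := ih h
        exact ⟨i, by omega, h⟩

/-- The subproblems `S` and `S'` agree on the nodes with an outgoing existential edge that do not
depend existentially on `S`. -/
def DepGraph.Agree (S S' : Finset Addr) (G : DepGraph) : Prop :=
  ∀ q, (∃ r, (q, r) ∈ G.exist) → (¬ ∃ s ∈ S, (s, q) ∈ G.exist) → (q ∈ S ↔ q ∈ S')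

/-- Passing to a part of the graph weakens the requirement of not depending on `S`. The hypothesis
`hin` compensates: no existential edge from `S` enters a controlling node of the part from outside
it. -/
theorem DepGraph.Agree.sub {S S' : Finset Addr} {G H : DepGraph} (h : G.Agree S S')
    (hsub : ∀ e ∈ H.exist, e ∈ G.exist)
    (hin : ∀ q r s, (q, r) ∈ H.exist → (s, q) ∈ G.exist → s ∈ S → (s, q) ∈ H.exist) :
    H.Agree S S' := by
  rintro q ⟨r, hr⟩ hq
  refine h q ⟨r, hsub _ hr⟩ ?_
  rintro ⟨s, hs, hsq⟩
  exact hq ⟨s, hs, hin q r s hr hsq hs⟩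

/-- Extraction consults `S` only at operators of closure applications and at stochastic choices, and
it does not enter a body or a sampled expression controlled from `S`. These are exactly the nodes on
which `DepGraph.Agree` compares the two sets. -/
theorem AExpr.extract_congr {S S' : Finset Addr} {a : AExpr C D} {σ : Env C D} {π : Addr}
    (h : (a.graph σ π).Agree S S') : a.extract S σ π = a.extract S' σ π := by
  induction a generalizing σ π with
  | sym c => rfl
  | var x => rfl
  | lam b => rfl
  | neut a₁ a₂ ih₁ ih₂ =>
    have h₁ : (a₁.graph σ (1 :: π)).Agree S S' := by
      refine h.sub (fun e he => by simp [AExpr.graph, DepGraph.union, he]) fun q r s hq hs _ => ?_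
      simp only [AExpr.graph, DepGraph.union, List.mem_append, List.not_mem_nil, or_false] at hs
      refine hs.resolve_right fun h => ?_
      exact not_suffix_of_ne (by decide) (AExpr.under_of_exist hq).1.1
        (AExpr.under_of_exist h).2.1
    have h₂ : (a₂.graph σ (2 :: π)).Agree S S' := by
      refine h.sub (fun e he => by simp [AExpr.graph, DepGraph.union, he]) fun q r s hq hs _ => ?_
      simp only [AExpr.graph, DepGraph.union, List.mem_append, List.not_mem_nil, or_false] at hs
      refine hs.resolve_left fun h => ?_
      exact not_suffix_of_ne (by decide) (AExpr.under_of_exist hq).1.1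
        (AExpr.under_of_exist h).2.1
    simp only [AExpr.extract, ih₁ h₁, ih₂ h₂]
  | beta a₁ a₂ a₃ ih₁ ih₂ ih₃ =>
    obtain ⟨ρ, hρ, hx⟩ : ∃ ρ, (AExpr.beta a₁ a₂ a₃).graph σ π =
        (((a₁.graph σ (1 :: π)).union (a₂.graph σ (2 :: π))).union
          (a₃.graph (VEnv.cons (2 :: π) (a₂.val σ (2 :: π)) ρ).toEnv (3 :: π))).union
        ⟨[π], [], [(1 :: π, π), (3 :: π, π)],
          (a₃.graph (VEnv.cons (2 :: π) (a₂.val σ (2 :: π)) ρ).toEnv (3 :: π)).nodes.map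
            fun n => (1 :: π, n)⟩ ∧
        ∀ S : Finset Addr, (AExpr.beta a₁ a₂ a₃).extract S σ π =
          if 1 :: π ∈ S then ((a₁.extract S σ (1 :: π)).1 ++ (a₂.extract S σ (2 :: π)).1,
            .beta (a₁.extract S σ (1 :: π)).2 (a₂.extract S σ (2 :: π)).2 a₃)
          else ((a₁.extract S σ (1 :: π)).1 ++ .assume (1 :: π) (a₁.extract S σ (1 :: π)).2 ::
            ((a₂.extract S σ (2 :: π)).1 ++ .assume (2 :: π) (a₂.extract S σ (2 :: π)).2 ::
            (a₃.extract S (VEnv.cons (2 :: π) (a₂.val σ (2 :: π)) ρ).toEnv (3 :: π)).1),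
            (a₃.extract S (VEnv.cons (2 :: π) (a₂.val σ (2 :: π)) ρ).toEnv (3 :: π)).2) :=
      ⟨_, rfl, fun _ => rfl⟩
    set G₃ := a₃.graph (VEnv.cons (2 :: π) (a₂.val σ (2 :: π)) ρ).toEnv (3 :: π) with hG₃
    have hG : ∀ e, e ∈ ((AExpr.beta a₁ a₂ a₃).graph σ π).exist ↔
        e ∈ (a₁.graph σ (1 :: π)).exist ∨ e ∈ (a₂.graph σ (2 :: π)).exist ∨ e ∈ G₃.exist ∨
          ∃ n ∈ G₃.nodes, (1 :: π, n) = e := by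
      intro e
      simp only [hρ, DepGraph.union, List.mem_append, List.mem_map, or_assoc]
    have h₁ : (a₁.graph σ (1 :: π)).Agree S S' := by
      refine h.sub (fun e he => (hG e).2 (.inl he)) fun q r s hq hs _ => ?_
      have hq := (AExpr.under_of_exist hq).1.1
      rcases (hG _).1 hs with h | h | h | ⟨n, hn, e⟩
      · exact h
      · exact absurd (AExpr.under_of_exist h).2.1 (not_suffix_of_ne (by decide) hq)
      · exact absurd (AExpr.under_of_exist h).2.1 (not_suffix_of_ne (by decide) hq)
      · simp only [Prod.mk.injEq] at e
        exact absurd (e.2 ▸ AExpr.suffix_of_node hn) (not_suffix_of_ne (by decide) hq)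
    have h₂ : (a₂.graph σ (2 :: π)).Agree S S' := by
      refine h.sub (fun e he => (hG e).2 (.inr (.inl he))) fun q r s hq hs _ => ?_
      have hq := (AExpr.under_of_exist hq).1.1
      rcases (hG _).1 hs with h | h | h | ⟨n, hn, e⟩
      · exact absurd (AExpr.under_of_exist h).2.1 (not_suffix_of_ne (by decide) hq)
      · exact h
      · exact absurd (AExpr.under_of_exist h).2.1 (not_suffix_of_ne (by decide) hq)
      · simp only [Prod.mk.injEq] at e
        exact absurd (e.2 ▸ AExpr.suffix_of_node hn) (not_suffix_of_ne (by decide) hq)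
    -- The root of the operator controls the body, and within this graph no existential edge ends at
    -- it, so the two sets must agree there.
    have hS : 1 :: π ∈ S ↔ 1 :: π ∈ S' := by
      refine h _ ⟨3 :: π, (hG _).2 (.inr (.inr (.inr ⟨_, AExpr.self_mem_nodes _ _ _, rfl⟩)))⟩ ?_
      rintro ⟨s, -, hs⟩
      rcases (hG _).1 hs with h | h | h | ⟨n, hn, e⟩
      · exact (AExpr.under_of_exist h).2.2 rfl
      · exact not_suffix_of_ne (by decide) (AExpr.under_of_exist h).2.1 (List.suffix_refl _)
      · exact not_suffix_of_ne (by decide) (AExpr.under_of_exist h).2.1 (List.suffix_refl _)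
      · simp only [Prod.mk.injEq] at e
        exact not_suffix_of_ne (by decide) (e.2 ▸ AExpr.suffix_of_node hn) (List.suffix_refl _)
    by_cases hm : 1 :: π ∈ S
    · simp only [hx, ih₁ h₁, ih₂ h₂, hm, hS.1 hm, if_true]
    -- The only edges into the body from outside it start at `1 :: π`, which is not in `S` in this
    -- case.
    · have h₃ : G₃.Agree S S' := by
        refine h.sub (fun e he => (hG e).2 (.inr (.inr (.inl he)))) fun q r s hq hs hsS => ?_
        have hq := (AExpr.under_of_exist hq).1.1
        rcases (hG _).1 hs with h | h | h | ⟨n, hn, e⟩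
        · exact absurd (AExpr.under_of_exist h).2.1 (not_suffix_of_ne (by decide) hq)
        · exact absurd (AExpr.under_of_exist h).2.1 (not_suffix_of_ne (by decide) hq)
        · exact h
        · simp only [Prod.mk.injEq] at e
          exact absurd (e.1 ▸ hsS) hm
      simp only [hx, ih₁ h₁, ih₂ h₂, hm, hS.not.1 hm, if_false, ih₃ h₃]
  | dist k xs a a' ih ih' =>
    have hG : ∀ e, e ∈ ((AExpr.dist k xs a a').graph σ π).exist ↔
        e ∈ (a.graph σ (1 :: π)).exist ∨ e ∈ (a'.graph (σ.capture xs).toEnv (2 :: π)).exist ∨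
          ∃ n ∈ (a'.graph (σ.capture xs).toEnv (2 :: π)).nodes, (0 :: π, n) = e := by
      intro e
      simp only [AExpr.graph, DepGraph.union, List.mem_append, List.mem_map, or_assoc]
    have h₁ : (a.graph σ (1 :: π)).Agree S S' := by
      refine h.sub (fun e he => (hG e).2 (.inl he)) fun q r s hq hs _ => ?_
      have hq := (AExpr.under_of_exist hq).1.1
      rcases (hG _).1 hs with h | h | ⟨n, hn, e⟩
      · exact h
      · exact absurd (AExpr.under_of_exist h).2.1 (not_suffix_of_ne (by decide) hq)
      · simp only [Prod.mk.injEq] at e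
        exact absurd (e.2 ▸ AExpr.suffix_of_node hn) (not_suffix_of_ne (by decide) hq)
    have hS : 0 :: π ∈ S ↔ 0 :: π ∈ S' := by
      refine h _ ⟨2 :: π, (hG _).2 (.inr (.inr ⟨_, AExpr.self_mem_nodes _ _ _, rfl⟩))⟩ ?_
      rintro ⟨s, -, hs⟩
      rcases (hG _).1 hs with h | h | ⟨n, hn, e⟩
      · exact not_suffix_of_ne (by decide) (AExpr.under_of_exist h).2.1 (List.suffix_refl _)
      · exact not_suffix_of_ne (by decide) (AExpr.under_of_exist h).2.1 (List.suffix_refl _)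
      · simp only [Prod.mk.injEq] at e
        exact not_suffix_of_ne (by decide) (e.2 ▸ AExpr.suffix_of_node hn) (List.suffix_refl _)
    by_cases hm : 0 :: π ∈ S
    · simp only [AExpr.extract, ih h₁, hm, hS.1 hm, if_true]
    · have h₂ : (a'.graph (σ.capture xs).toEnv (2 :: π)).Agree S S' := by
        refine h.sub (fun e he => (hG e).2 (.inr (.inl he))) fun q r s hq hs hsS => ?_
        have hq := (AExpr.under_of_exist hq).1.1
        rcases (hG _).1 hs with h | h | ⟨n, hn, e⟩
        · exact absurd (AExpr.under_of_exist h).2.1 (not_suffix_of_ne (by decide) hq)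
        · exact h
        · simp only [Prod.mk.injEq] at e
          exact absurd (e.1 ▸ hsS) hm
      simp only [AExpr.extract, ih h₁, hm, hS.not.1 hm, if_false, ih' h₂]

theorem extractFrom_congr {S S' : Finset Addr} {t : Trace C D} {σ : Env C D} {j : ℕ}
    (h : (graphFrom σ j t).Agree S S') : extractFrom S σ j t = extractFrom S' σ j t := by
  induction t generalizing σ j with
  | nil => rfl
  | cons st t ih =>
    cases st with
    | assume x a =>
      have h₁ : (a.graph σ [j]).Agree S S' := by
        refine h.sub (fun e he => by simp [graphFrom, DepGraph.union, he]) fun q r s hq hs _ => ?_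
        simp only [graphFrom, DepGraph.union, List.mem_append] at hs
        refine hs.resolve_right fun h => ?_
        obtain ⟨i, hi, -, h⟩ := suffix_of_existFrom h
        exact not_suffix_of_ne (by omega) (AExpr.under_of_exist hq).1.1 h
      have h₂ : (graphFrom (σ.assign x [j] (a.val σ [j])) (j + 1) t).Agree S S' := by
        refine h.sub (fun e he => by simp [graphFrom, DepGraph.union, he]) fun q r s hq hs _ => ?_
        simp only [graphFrom, DepGraph.union, List.mem_append] at hs
        refine hs.resolve_left fun h => ?_
        obtain ⟨i, hi, hq, -⟩ := suffix_of_existFrom hq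
        exact not_suffix_of_ne (by omega) (AExpr.under_of_exist h).2.1 hq
      simp only [extractFrom, AExpr.extract_congr h₁, ih h₂]
    | observe k xs a d =>
      have h₁ : (a.graph σ [1, j]).Agree S S' := by
        refine h.sub (fun e he => by simp [graphFrom, DepGraph.union, he]) fun q r s hq hs _ => ?_
        simp only [graphFrom, DepGraph.union, List.mem_append, List.not_mem_nil, or_false] at hs
        refine hs.resolve_right fun h => ?_
        obtain ⟨i, hi, -, h⟩ := suffix_of_existFrom h
        exact not_suffix_of_ne (by omega) (AExpr.under_of_exist hq).1.of_cons.1 h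
      have h₂ : (graphFrom σ (j + 1) t).Agree S S' := by
        refine h.sub (fun e he => by simp [graphFrom, DepGraph.union, he]) fun q r s hq hs _ => ?_
        simp only [graphFrom, DepGraph.union, List.mem_append, List.not_mem_nil, or_false] at hs
        refine hs.resolve_left fun h => ?_
        obtain ⟨i, hi, hq, -⟩ := suffix_of_existFrom hq
        exact not_suffix_of_ne (by omega) (AExpr.under_of_exist h).2.of_cons.1 hq
      simp only [extractFrom, AExpr.extract_congr h₁, ih h₂]

end Graphs

-- Ergodicity of transition matrices

section Discrete

theorem exists_ne_zero_of_tsum_eq_one {T : Type*} {m : T → ℝ≥0∞} (hm : ∑' t, m t = 1) : ∃ t, m t ≠ 0 := by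
  by_contra! h
  simp [h] at hm

variable {T : Type*} [MeasurableSpace T] [DiscreteMeasurableSpace T]

/-- The measure with the given point masses. -/
noncomputable def massMeasure (m : T → ℝ≥0∞) : Measure T :=
  Measure.sum fun t => m t • Measure.dirac t

/-- The kernel with the given transition matrix. -/
noncomputable def matrixKernel (k : T → T → ℝ≥0∞) : Kernel T T where
  toFun t := massMeasure (k t)
  measurable' := .of_discrete

theorem lintegral_massMeasure (m f : T → ℝ≥0∞) :
    ∫⁻ t, f t ∂massMeasure m = ∑' t, m t * f t := by
  simp [massMeasure, lintegral_sum_measure, lintegral_smul_measure]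

theorem massMeasure_singleton (m : T → ℝ≥0∞) (u : T) : massMeasure m {u} = m u := by
  rw [massMeasure, Measure.sum_apply _ (.of_discrete), tsum_eq_single u]
  · simp
  · intro t ht
    simp [ht]

theorem massMeasure_univ (m : T → ℝ≥0∞) : massMeasure m Set.univ = ∑' t, m t := by
  rw [massMeasure, Measure.sum_apply _ (.of_discrete)]
  simp

theorem massMeasure_eq_zero {m : T → ℝ≥0∞} {A : Set T} :
    massMeasure m A = 0 ↔ ∀ t ∈ A, m t = 0 := by
  rw [massMeasure, Measure.sum_apply _ (.of_discrete), ENNReal.tsum_eq_zero]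
  refine forall_congr' fun t => ?_
  by_cases h : t ∈ A <;> simp [h]

theorem massMeasure_eq_one {m : T → ℝ≥0∞} (hm : ∑' t, m t = 1) {A : Set T} :
    massMeasure m A = 1 ↔ ∀ t, m t ≠ 0 → t ∈ A := by
  have : IsProbabilityMeasure (massMeasure m) := ⟨by rw [massMeasure_univ, hm]⟩
  rw [← prob_compl_eq_zero_iff (.of_discrete), massMeasure_eq_zero]
  exact forall_congr' fun t => not_imp_comm

theorem massMeasure_bind (m : T → ℝ≥0∞) (k : T → T → ℝ≥0∞) :
    (massMeasure m).bind (matrixKernel k) = massMeasure fun u => ∑' t, m t * k t u := by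
  refine Measure.ext fun A _ => ?_
  rw [Measure.bind_apply (.of_discrete) (Kernel.aemeasurable _), lintegral_massMeasure]
  have e : ∀ m' : T → ℝ≥0∞, massMeasure m' A = ∑' u, m' u * A.indicator 1 u := fun m' => by
    rw [massMeasure, Measure.sum_apply _ (.of_discrete)]
    simp
  change ∑' t, m t * massMeasure (k t) A = _
  simp only [e, ← ENNReal.tsum_mul_left, ← ENNReal.tsum_mul_right, mul_assoc]
  exact ENNReal.tsum_comm

theorem matrixKernel_pow_succ (k : T → T → ℝ≥0∞) (n : ℕ) (t : T) (A : Set T) :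
    (matrixKernel k ^ (n + 1)) t A = ∑' u, k t u * (matrixKernel k ^ n) u A := by
  rw [pow_succ]
  change ((matrixKernel k ^ n) ∘ₖ matrixKernel k) t A = _
  rw [Kernel.comp_apply' _ _ _ (.of_discrete)]
  exact lintegral_massMeasure _ _

theorem transGen_of_pow {k : T → T → ℝ≥0∞} {n : ℕ} {t u : T}
    (h : (matrixKernel k ^ (n + 1)) t {u} ≠ 0) : Relation.TransGen (fun t u => k t u ≠ 0) t u := by
  induction n generalizing t with
  | zero =>
    rw [zero_add, pow_one] at h
    exact .single (by rwa [← massMeasure_singleton (k t) u])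
  | succ n ih =>
    rw [matrixKernel_pow_succ] at h
    obtain ⟨v, hv⟩ : ∃ v, k t v * (matrixKernel k ^ (n + 1)) v {u} ≠ 0 := by
      by_contra! hc
      exact h (ENNReal.tsum_eq_zero.2 hc)
    exact .head (left_ne_zero_of_mul hv) (ih (right_ne_zero_of_mul hv))

theorem exists_pow_of_transGen {k : T → T → ℝ≥0∞} {t u : T}
    (h : Relation.TransGen (fun t u => k t u ≠ 0) t u) :
    ∃ n : ℕ, (matrixKernel k ^ (n + 1)) t {u} ≠ 0 := by
  induction h using Relation.TransGen.head_induction_on with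
  | single h =>
    refine ⟨0, ?_⟩
    rw [zero_add, pow_one]
    exact (massMeasure_singleton _ _).trans_ne h
  | @head t v h _ ih =>
    obtain ⟨n, hn⟩ := ih
    refine ⟨n + 1, fun h0 => ?_⟩
    rw [matrixKernel_pow_succ, ENNReal.tsum_eq_zero] at h0
    exact mul_ne_zero h hn (h0 v)

/-- Irreducible, aperiodic transition matrices with stationary point masses `m`. -/
structure IsErgodicMatrix (k : T → T → ℝ≥0∞) (m : T → ℝ≥0∞) : Prop where
  tsum_eq_one : ∀ t, ∑' u, k t u = 1
  transGen : ∀ t u, Relation.TransGen (fun t u => k t u ≠ 0) t u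
  aperiodic : ∀ d : ℕ, 2 ≤ d → ∀ f : T → ZMod d, ¬ ∀ t u, k t u ≠ 0 → f u = f t + 1
  stationary : ∀ u, ∑' t, m t * k t u = m u

/-- With all masses positive the exceptional null set is empty, and a cyclic partition is the same
as a function to `ZMod d` that grows by one along every transition. Such a function restricts to
subsets and needs no check that its fibres are nonempty. -/
theorem aperiodic_iff [Nonempty T] {k : T → T → ℝ≥0∞} {m : T → ℝ≥0∞} (hm : ∀ t, m t ≠ 0)
    (hk : ∀ t, ∑' u, k t u = 1) : Aperiodic (matrixKernel k) (massMeasure m) ↔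
      ∀ d : ℕ, 2 ≤ d → ∀ f : T → ZMod d, ¬ ∀ t u, k t u ≠ 0 → f u = f t + 1 := by
  constructor
  · intro h d hd f hf
    have : NeZero d := ⟨by omega⟩
    refine h ⟨d, fun i => {t | f t = (i : ZMod d)}, ∅, hd, fun _ _ => .of_discrete, .of_discrete,
      ?_, ?_, by simp, ?_, ?_, by simp⟩
    · intro i hi
      obtain ⟨t₀⟩ := ‹Nonempty T›
      -- Every row has a nonzero entry, so a path from `t₀` can be continued forever and visits
      -- every residue; hence all fibres are nonempty.
      have step : ∀ n : ℕ, ∃ t, f t = f t₀ + n := by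
        intro n
        induction n with
        | zero => exact ⟨t₀, by simp⟩
        | succ n ih =>
          obtain ⟨t, ht⟩ := ih
          obtain ⟨u, hu⟩ := exists_ne_zero_of_tsum_eq_one (hk t)
          exact ⟨u, by rw [hf t u hu, ht]; push_cast; ring⟩
      obtain ⟨t, ht⟩ := step ((i : ZMod d) - f t₀).val
      exact ⟨t, by rw [Set.mem_ofPred_eq, ht, ZMod.natCast_zmod_val]; ring⟩
    · intro i hi j hj hij
      refine Set.disjoint_left.2 fun t ht ht' => hij ?_
      have := ht.symm.trans ht'
      rwa [ZMod.natCast_eq_natCast_iff', Nat.mod_eq_of_lt hi, Nat.mod_eq_of_lt hj] at this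
    · rw [Set.union_empty, Set.eq_univ_iff_forall]
      intro t
      simp only [Set.mem_iUnion]
      exact ⟨(f t).val, ZMod.val_lt _, (ZMod.natCast_zmod_val _).symm⟩
    · intro i hi t ht
      refine (massMeasure_eq_one (hk t)).2 fun u hu => ?_
      rw [Set.mem_ofPred_eq, hf t u hu, ht, ZMod.natCast_mod]
      push_cast
      rfl
  · rintro h ⟨d, E, N, hd, hE⟩
    have hN : ∀ t, t ∉ N := fun t ht => hm t (massMeasure_eq_zero.1 hE.null t ht)
    have hc : ∀ t, ∃ i < d, t ∈ E i := by
      intro t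
      have ht : t ∈ (⋃ i < d, E i) ∪ N := hE.cover ▸ Set.mem_univ t
      simpa [hN t] using ht
    choose g hg hgE using hc
    refine h d hd (fun t => g t) fun t u hu => ?_
    have hu := (massMeasure_eq_one (hk t)).1 (hE.step _ (hg t) t (hgE t)) u hu
    have e : g u = (g t + 1) % d := by
      by_contra hne
      exact Set.disjoint_left.1 (hE.disjoint _ (hg u) _ (Nat.mod_lt _ (by omega)) hne) (hgE u) hu
    rw [e, ZMod.natCast_mod]
    push_cast
    rfl

theorem isErgodicFor_iff [Nonempty T] {k : T → T → ℝ≥0∞} {m : T → ℝ≥0∞} (hm : ∀ t, m t ≠ 0) :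
    IsErgodicFor (matrixKernel k) (massMeasure m) ↔ IsErgodicMatrix k m := by
  have hstat : (matrixKernel k).Invariant (massMeasure m) ↔
      ∀ u, ∑' t, m t * k t u = m u := by
    rw [Kernel.Invariant, massMeasure_bind]
    constructor
    · intro h u
      rw [← massMeasure_singleton m u, ← h, massMeasure_singleton]
    · intro h
      rw [funext h]
  have hirr : PiIrreducible (matrixKernel k) (massMeasure m) ↔
      ∀ t u, Relation.TransGen (fun t u => k t u ≠ 0) t u := by
    constructor
    · intro h t u
      obtain ⟨n, hn, hp⟩ := h t {u} .of_discrete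
        (by rw [massMeasure_singleton]; exact pos_iff_ne_zero.2 (hm u))
      obtain ⟨n, rfl⟩ := Nat.exists_eq_add_of_le' hn
      exact transGen_of_pow hp.ne'
    · intro h t A _ hA
      obtain ⟨u, hu⟩ : A.Nonempty := Set.nonempty_iff_ne_empty.2 fun e => by simp [e] at hA
      obtain ⟨n, hn⟩ := exists_pow_of_transGen (h t u)
      exact ⟨n + 1, by omega, (pos_iff_ne_zero.2 hn).trans_le
        (measure_mono (Set.singleton_subset_iff.2 hu))⟩
  constructor
  · rintro ⟨h₁, h₂, h₃, h₄⟩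
    have hk : ∀ t, ∑' u, k t u = 1 := fun t => by
      rw [← massMeasure_univ]
      exact (h₁.isProbabilityMeasure t).measure_univ
    exact ⟨hk, hirr.1 h₂, (aperiodic_iff hm hk).1 h₃, hstat.1 h₄⟩
  · rintro ⟨hk, h₂, h₃, h₄⟩
    exact ⟨⟨fun t => ⟨(massMeasure_univ _).trans (hk t)⟩⟩, hirr.2 h₂, (aperiodic_iff hm hk).2 h₃,
      hstat.2 h₄⟩

end Discrete

-- Equivalence classes and subprograms

section Subproblems

variable {C D : Type} {F : DistFamily C D} {p : Program C D}

instance : DiscreteMeasurableSpace (TraceSpace F p) := ⟨fun _ => trivial⟩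

theorem TraceSpace.program_and_runs (t : TraceSpace F p) :
    t.1.program = p ∧ Runs F Env.empty 0 t.1 :=
  execProg_and_density_iff.1 t.2

/-- A trace that runs, as an element of the trace space of its program. -/
def TraceSpace.mk {t : Trace C D} (hp : t.program = p) (ht : Runs F Env.empty 0 t) :
    TraceSpace F p :=
  ⟨t, execProg_and_density_iff.2 ⟨hp, ht⟩⟩

theorem envWf_empty (P : Addr → Prop) : EnvWf P (Env.empty : Env C D) :=
  ⟨fun h => by simp [Env.empty] at h, fun h => by simp [Env.empty] at h⟩

theorem envKnown_empty (S : Finset Addr) (τ : Env C D) : EnvKnown S τ (Env.empty : Env C D) :=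
  fun _ _ _ h => by simp [Env.empty] at h

theorem envRel_empty (S : Finset Addr) : EnvRel S (Env.empty : Env C D) Env.empty :=
  fun _ => .none

variable (SS : Strategy F)

/-- The trace extracted from `t` for the subproblem selected by `SS`. -/
def Strategy.sub (t : Trace C D) : Trace C D := extractTrace t (SS.sel t)

theorem Strategy.loc (t : TraceSpace F p) : LocFrom (SS.sel t.1) Env.empty 0 t.1 :=
  (SS.valid p t.1 t.2.1).locFrom

/-- The extracted trace, as an element of the trace space of its program. -/
def Strategy.subTrace (t : TraceSpace F p) : TraceSpace F (SS.sub t.1).program :=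
  .mk rfl (extractFrom_spec t.program_and_runs.2 (envWf_empty _) (SS.loc t) (envKnown_empty _ _)
    0).1

theorem Strategy.density_sub (t : TraceSpace F p) : (SS.sub t.1).density F = t.1.density F :=
  (extractFrom_spec t.program_and_runs.2 (envWf_empty _) (SS.loc t) (envKnown_empty _ Env.empty)
    0).2

variable {SS}

theorem Strategy.Reversible.symm (h : SS.Reversible p) {t u : TraceSpace F p}
    (htu : SS.Rel t.1 u.1) : SS.Rel u.1 t.1 := by
  refine h 1 (fun i => if i = 0 then t else u) fun i hi => ?_
  obtain rfl : i = 0 := by omega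
  exact htu

theorem Strategy.Reversible.trans (h : SS.Reversible p) {t u v : TraceSpace F p}
    (htu : SS.Rel t.1 u.1) (huv : SS.Rel u.1 v.1) : SS.Rel t.1 v.1 := by
  -- Reversibility for a chain of two steps relates the end to the start, so symmetry is applied
  -- once more.
  refine h.symm (h 2 (fun i => if i = 0 then t else if i = 1 then u else v) fun i hi => ?_)
  obtain rfl | rfl : i = 0 ∨ i = 1 := by omega
  · exact htu
  · exact huv

theorem Strategy.Reversible.refl (h : SS.Reversible p) (t : TraceSpace F p) :
    SS.Rel t.1 t.1 :=
  h 0 (fun _ => t) (by simp)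

variable (hr : SS.Reversible p) (hc : SS.Consistent p)
include hr hc

/-- Consistency is used from `u` to `t`: it concerns nodes of its first trace, and the extraction of
`u` inspects nodes of `u`. -/
theorem Strategy.sub_eq_extract {t u : TraceSpace F p} (htu : SS.Rel t.1 u.1) :
    SS.sub u.1 = extractTrace u.1 (SS.sel t.1) :=
  extractFrom_congr (hc u t (hr.symm htu))

theorem Strategy.program_sub {t u : TraceSpace F p} (htu : SS.Rel t.1 u.1) :
    (SS.sub u.1).program = (SS.sub t.1).program := by
  rw [SS.sub_eq_extract hr hc htu]
  exact (SimFrom.transfer htu t.program_and_runs.2 u.program_and_runs.2 (SS.loc t)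
    (envRel_empty _)).2

theorem Strategy.stitch_sub {t u : TraceSpace F p} (htu : SS.Rel t.1 u.1) :
    stitchTrace t.1 (SS.sub u.1) (SS.sel t.1) = u.1 := by
  rw [SS.sub_eq_extract hr hc htu]
  exact SimFrom.stitch_extract htu _

/-- `stitchFrom_spec` recovers `s` by extracting with the subproblem of `t`; consistency replaces it
by the subproblem selected at the stitched trace. -/
theorem Strategy.exists_stitch (t : TraceSpace F p) (s : TraceSpace F (SS.sub t.1).program) :
    ∃ u : TraceSpace F p, u.1 = stitchTrace t.1 s.1 (SS.sel t.1) ∧ SS.Rel t.1 u.1 ∧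
      SS.sub u.1 = s.1 := by
  obtain ⟨h₁, h₂, h₃⟩ := stitchFrom_spec t.program_and_runs.2 (SS.loc t) (envRel_empty _)
    (envWf_empty _) (envKnown_empty _ Env.empty) s.program_and_runs.1 s.program_and_runs.2
  let u : TraceSpace F p := .mk (h₁.program_eq.trans t.program_and_runs.1) h₂
  have hu : SS.Rel t.1 u.1 := h₁
  exact ⟨u, rfl, hu, (SS.sub_eq_extract hr hc hu).trans h₃⟩

/-- Extraction is a bijection from the class of `t` to the traces of the extracted program. -/
noncomputable def Strategy.classEquiv (t : TraceSpace F p) :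
    {u : TraceSpace F p // SS.Rel t.1 u.1} ≃ TraceSpace F (SS.sub t.1).program :=
  Equiv.ofBijective (fun u => ⟨SS.sub u.1.1, SS.program_sub hr hc u.2 ▸ (SS.subTrace u.1).2⟩) <| by
    constructor
    · intro u v huv
      have huv : SS.sub u.1.1 = SS.sub v.1.1 := congrArg Subtype.val huv
      refine Subtype.ext (Subtype.ext ?_)
      rw [← SS.stitch_sub hr hc u.2, huv, SS.stitch_sub hr hc v.2]
    · intro s
      obtain ⟨u, -, hu, hs⟩ := SS.exists_stitch hr hc t s
      exact ⟨⟨u, hu⟩, Subtype.ext hs⟩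

/-- Along the bijection the normalizing constant of the subprogram is the sum of the densities over
the class of `t`. It is bounded by that of `p`, and nonzero because `t` itself contributes. -/
theorem Strategy.hasPosterior_sub (hp : HasPosterior F p) (t : TraceSpace F p) :
    HasPosterior F (SS.sub t.1).program := by
  constructor
  · intro h
    exact (SS.subTrace t).2.2 (ENNReal.tsum_eq_zero.1 h (SS.subTrace t))
  · have e : partition F (SS.sub t.1).program =
        ∑' u : {u : TraceSpace F p // SS.Rel t.1 u.1}, u.1.1.density F := by
      rw [partition, ← (SS.classEquiv hr hc t).tsum_eq]
      exact tsum_congr fun u => SS.density_sub u.1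
    rw [e]
    exact ne_top_of_le_ne_top hp.2
      (ENNReal.tsum_comp_le_tsum_of_injective Subtype.val_injective
        fun u : TraceSpace F p => u.1.density F)

end Subproblems

-- The posterior as a positive mass function

section Posterior

variable {C D : Type} {F : DistFamily C D} {p : Program C D}

theorem HasPosterior.nonempty (hp : HasPosterior F p) : Nonempty (TraceSpace F p) := by
  by_contra h
  rw [not_nonempty_iff] at h
  exact hp.1 (by simp [partition])

theorem HasPosterior.mass_ne_zero (hp : HasPosterior F p) (t : TraceSpace F p) :
    t.1.density F / partition F p ≠ 0 :=
  ENNReal.div_ne_zero.2 ⟨t.2.2, hp.2⟩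

theorem posterior_eq_zero (hp : HasPosterior F p) {A : Set (TraceSpace F p)} :
    posterior F p A = 0 ↔ A = ∅ := by
  rw [Set.eq_empty_iff_forall_notMem]
  exact massMeasure_eq_zero.trans
    (forall_congr' fun t => ⟨fun h ht => hp.mass_ne_zero t (h ht), fun h ht => absurd ht h⟩)

/-- Only stationarity involves `m`, and it is homogeneous. Unnormalized densities can thus be
compared between a program and its subprograms, whose normalizing constants differ. -/
theorem isErgodicMatrix_div {T : Type*} {k : T → T → ℝ≥0∞} {m : T → ℝ≥0∞} {Z : ℝ≥0∞} (h₀ : Z ≠ 0)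
    (h₁ : Z ≠ ∞) : IsErgodicMatrix k (fun t => m t / Z) ↔ IsErgodicMatrix k m := by
  have e : (∀ u, ∑' t, m t / Z * k t u = m u / Z) ↔ ∀ u, ∑' t, m t * k t u = m u := by
    refine forall_congr' fun u => ?_
    simp only [div_eq_mul_inv, mul_right_comm _ Z⁻¹]
    rw [ENNReal.tsum_mul_right]
    exact ENNReal.mul_left_inj (by simpa using h₁) (by simpa using h₀)
  exact ⟨fun h => ⟨h.1, h.2, h.3, e.1 h.4⟩, fun h => ⟨h.1, h.2, h.3, e.2 h.4⟩⟩

theorem isErgodicFor_posterior_iff (hp : HasPosterior F p) {K : Trace C D → PMF (Trace C D)} :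
    IsErgodicFor (kernelOn F K p) (posterior F p) ↔
      IsErgodicMatrix (fun t u : TraceSpace F p => K t.1 u.1) (fun t => t.1.density F) := by
  have := hp.nonempty
  rw [← isErgodicMatrix_div hp.1 hp.2]
  exact isErgodicFor_iff hp.mass_ne_zero

end Posterior

-- A single `infer` statement

section Infer

variable {C D : Type} {F : DistFamily C D} {p : Program C D}

/-- Metaprograms act on raw traces; a row sum of one over the trace space shows that the inner
kernel never leaves it. -/
theorem PMF.mem_of_tsum_subtype {α : Type*} {q : PMF α} {P : α → Prop}
    (h : ∑' x : {x // P x}, q x = 1) {x : α} (hx : q x ≠ 0) : P x := by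
  have e : ∑' x : {x // P x}, q x = ∑' x, {x | P x}.indicator q x := tsum_subtype {x | P x} q
  have : q.toOuterMeasure {x | P x} = 1 := by rw [PMF.toOuterMeasure_apply, ← e, h]
  exact (PMF.toOuterMeasure_apply_eq_one_iff q _).1 this ((PMF.mem_support_iff _ _).2 hx)

theorem PMF.tsum_subtype_eq_one {α : Type*} {q : PMF α} {P : α → Prop}
    (h : ∀ x, q x ≠ 0 → P x) : ∑' x : {x // P x}, q x = 1 := by
  have e : ∑' x : {x // P x}, q x = ∑' x, {x | P x}.indicator q x := tsum_subtype {x | P x} q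
  rw [e, ← PMF.toOuterMeasure_apply, PMF.toOuterMeasure_apply_eq_one_iff]
  exact fun x hx => h x ((PMF.mem_support_iff _ _).1 hx)

/-- Running `K` on the subtrace extracted for `SS` and stitching the result back. -/
noncomputable def Strategy.lift (SS : Strategy F) (K : Trace C D → PMF (Trace C D))
    (t : Trace C D) : PMF (Trace C D) :=
  (K (SS.sub t)).map fun s => stitchTrace t s (SS.sel t)

variable {SS : Strategy F} {K : Trace C D → PMF (Trace C D)}

/-- `K` is irreducible, aperiodic and stationary on the programs extracted for `SS` from the traces
of `p`. -/
def Strategy.SubErgodic (SS : Strategy F) (K : Trace C D → PMF (Trace C D)) (p : Program C D) :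
    Prop :=
  ∀ t : TraceSpace F p, IsErgodicMatrix
    (fun s s' : TraceSpace F (SS.sub t.1).program => K s.1 s'.1) (fun s => s.1.density F)

variable (hr : SS.Reversible p) (hc : SS.Consistent p) (hK : SS.SubErgodic K p)
include hr hc hK

theorem Strategy.lift_support {t : TraceSpace F p} {u : Trace C D} (h : SS.lift K t.1 u ≠ 0) :
    ∃ v : TraceSpace F p, v.1 = u ∧ SS.Rel t.1 v.1 := by
  obtain ⟨s, hs, hu⟩ := (PMF.mem_support_map_iff _ _ _).1 ((PMF.mem_support_iff _ _).2 h)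
  have hs := PMF.mem_of_tsum_subtype ((hK t).tsum_eq_one (SS.subTrace t))
    ((PMF.mem_support_iff _ _).1 hs)
  obtain ⟨v, hv, hR, -⟩ := SS.exists_stitch hr hc t ⟨s, hs⟩
  exact ⟨v, hv.trans hu, hR⟩

theorem Strategy.lift_of_not_rel {t u : TraceSpace F p} (h : ¬ SS.Rel t.1 u.1) :
    SS.lift K t.1 u.1 = 0 := by
  by_contra hne
  obtain ⟨v, hv, hR⟩ := SS.lift_support hr hc hK hne
  exact h (hv ▸ hR)

/-- Stitching into `t` is injective on traces of the subprogram, because extraction recovers them.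
So exactly one outcome `s` of the inner kernel leads to `u`, namely the extraction of `u`. -/
theorem Strategy.lift_of_rel {t u : TraceSpace F p} (h : SS.Rel t.1 u.1) :
    SS.lift K t.1 u.1 = K (SS.sub t.1) (SS.sub u.1) := by
  rw [Strategy.lift, PMF.map_apply, tsum_eq_single (SS.sub u.1)]
  · rw [if_pos (SS.stitch_sub hr hc h).symm]
  · intro s hs
    split_ifs with hu
    · by_contra hne
      have hs' := PMF.mem_of_tsum_subtype ((hK t).tsum_eq_one (SS.subTrace t)) hne
      obtain ⟨v, hv, -, hsv⟩ := SS.exists_stitch hr hc t ⟨s, hs'⟩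
      exact hs (by rw [hu, ← hv, hsv])
    · rfl

theorem Strategy.lift_classEquiv (t : TraceSpace F p)
    (u v : {u : TraceSpace F p // SS.Rel t.1 u.1}) :
    SS.lift K u.1.1 v.1.1 = K (SS.classEquiv hr hc t u).1 (SS.classEquiv hr hc t v).1 :=
  SS.lift_of_rel hr hc hK (hr.trans (hr.symm u.2) v.2)

theorem Strategy.lift_transGen {t u : TraceSpace F p} (h : SS.Rel t.1 u.1) :
    Relation.TransGen (fun t u : TraceSpace F p => SS.lift K t.1 u.1 ≠ 0) t u := by
  have := Relation.TransGen.lift (p := fun t u : TraceSpace F p => SS.lift K t.1 u.1 ≠ 0)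
    (r := fun s s' : TraceSpace F (SS.sub t.1).program => K s.1 s'.1 ≠ 0)
    (fun s => ((SS.classEquiv hr hc t).symm s).1) (fun s s' hs => by
      change SS.lift K _ _ ≠ 0
      rw [SS.lift_classEquiv hr hc hK t]
      simpa using hs) _ _
    ((hK t).transGen (SS.classEquiv hr hc t ⟨t, hr.refl t⟩) (SS.classEquiv hr hc t ⟨u, h⟩))
  simpa [Function.onFun] using this

/-- A cyclic function on the trace space would restrict to the class of `t` and, through the
bijection, be cyclic for the inner kernel. -/
theorem Strategy.lift_aperiodic (t : TraceSpace F p) {d : ℕ} (hd : 2 ≤ d)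
    (f : TraceSpace F p → ZMod d) :
    ¬ ∀ t u : TraceSpace F p, SS.lift K t.1 u.1 ≠ 0 → f u = f t + 1 := by
  intro h
  refine (hK t).aperiodic d hd (fun s => f ((SS.classEquiv hr hc t).symm s).1) fun s s' hs =>
    h _ _ ?_
  rw [SS.lift_classEquiv hr hc hK t]
  simpa using hs

/-- No mass enters `u` from outside its class. Within the class the sum is the stationarity equation
of the inner kernel, because extraction preserves the density. -/
theorem Strategy.lift_stationary (u : TraceSpace F p) :
    ∑' t : TraceSpace F p, t.1.density F * SS.lift K t.1 u.1 = u.1.density F := by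
  have e : ∑' t : {t : TraceSpace F p // SS.Rel u.1 t.1}, t.1.1.density F * SS.lift K t.1.1 u.1 =
      ∑' t : TraceSpace F p, t.1.density F * SS.lift K t.1 u.1 := by
    refine tsum_subtype_eq_of_support_subset
      (f := fun t : TraceSpace F p => t.1.density F * SS.lift K t.1 u.1)
      (s := {t | SS.Rel u.1 t.1}) fun t ht => ?_
    by_contra hn
    exact right_ne_zero_of_mul ht
      (SS.lift_of_not_rel hr hc hK fun h => hn (hr.symm h))
  rw [← e]
  have st := (hK u).stationary (SS.classEquiv hr hc u ⟨u, hr.refl u⟩)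
  rw [← (SS.classEquiv hr hc u).tsum_eq] at st
  refine Eq.trans (tsum_congr fun t => ?_) (st.trans (SS.density_sub u))
  rw [SS.lift_classEquiv hr hc hK u t ⟨u, hr.refl u⟩]
  exact congrArg (· * _) (SS.density_sub t.1).symm

end Infer

-- Mixtures and induction on metaprograms

section Main

variable {C D : Type} {F : DistFamily C D} {p : Program C D}

theorem Strategy.Reversible.preimage_image_cls {SS : Strategy F} (hr : SS.Reversible p)
    {A : Set (TraceSpace F p)} (hA : ∀ t u : TraceSpace F p, t ∈ A → SS.Rel t.1 u.1 → u ∈ A) :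
    SS.cls p ⁻¹' (SS.cls p '' A) = A := by
  refine Set.Subset.antisymm ?_ (Set.subset_preimage_image _ _)
  rintro u ⟨t, ht, e⟩
  have hu : u ∈ SS.cls p u := hr.refl u
  rw [← e] at hu
  exact hA t u ht hu

/-- A set closed under every relation equals its saturation for each strategy, so the premise of
`Connects` holds trivially. The conclusion of full measure means the whole space, since null sets
are empty. -/
theorem Connects.eq_univ {k : ℕ} {SS : Fin k → Strategy F} (h : Connects SS p)
    (hp : HasPosterior F p) (hr : ∀ i, (SS i).Reversible p) {A : Set (TraceSpace F p)}
    (hne : A.Nonempty)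
    (hA : ∀ i, ∀ t u : TraceSpace F p, t ∈ A → (SS i).Rel t.1 u.1 → u ∈ A) : A = Set.univ := by
  obtain ⟨i, hi⟩ := h A hne fun i j => by
    rw [Set.preimage_compl, (hr i).preimage_image_cls (hA i), (hr j).preimage_image_cls (hA j),
      Set.inter_compl_self]
    exact measure_empty
  rw [Set.preimage_compl, (hr i).preimage_image_cls (hA i), posterior_eq_zero hp] at hi
  exact Set.compl_empty_iff.1 hi

theorem isErgodicMatrix_mixture {k : ℕ} {w : PMF (Fin k)} (hw : ∀ i, w i ≠ 0)
    {SS : Fin k → Strategy F} {K : Fin k → Trace C D → PMF (Trace C D)} (hp : HasPosterior F p)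
    (hr : ∀ i, (SS i).Reversible p) (hc : ∀ i, (SS i).Consistent p) (hco : Connects SS p)
    (hK : ∀ i, (SS i).SubErgodic (K i) p) :
    IsErgodicMatrix
      (fun t u : TraceSpace F p => (w.bind fun i => (SS i).lift (K i) t.1) u.1)
      (fun t => t.1.density F) := by
  have step : ∀ i (t u : TraceSpace F p), (SS i).lift (K i) t.1 u.1 ≠ 0 →
      (w.bind fun i => (SS i).lift (K i) t.1) u.1 ≠ 0 := fun i t u h =>
    (PMF.mem_support_iff _ _).1 ((PMF.mem_support_bind_iff _ _ _).2
      ⟨i, (PMF.mem_support_iff _ _).2 (hw i), (PMF.mem_support_iff _ _).2 h⟩)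
  have one : ∀ t : TraceSpace F p,
      ∑' u : TraceSpace F p, (w.bind fun i => (SS i).lift (K i) t.1) u.1 = 1 := fun t =>
    PMF.tsum_subtype_eq_one fun u hu => by
      obtain ⟨i, -, hi⟩ := (PMF.mem_support_bind_iff _ _ _).1 ((PMF.mem_support_iff _ _).2 hu)
      obtain ⟨v, rfl, -⟩ := (SS i).lift_support (hr i) (hc i) (hK i)
        ((PMF.mem_support_iff _ _).1 hi)
      exact v.2
  refine ⟨one, fun t u => ?_, fun d hd f hf => ?_, fun u => ?_⟩
  -- The set of traces reachable from `t` in at least one step. It is closed under every relation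
  -- because a lifted kernel connects any two traces of a class.
  · set A : Set (TraceSpace F p) := {u | Relation.TransGen (fun t u : TraceSpace F p =>
      (w.bind fun i => (SS i).lift (K i) t.1) u.1 ≠ 0) t u} with hA
    obtain ⟨v, hv⟩ := exists_ne_zero_of_tsum_eq_one (one t)
    have : A = Set.univ := hco.eq_univ hp hr ⟨v, .single hv⟩ fun i a b ha hab =>
      Relation.TransGen.trans ha
        (Relation.TransGen.mono (fun _ _ => step i _ _) _ _
          ((SS i).lift_transGen (hr i) (hc i) (hK i) hab))
    have hu : u ∈ A := this ▸ Set.mem_univ u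
    exact hu
  -- One component suffices: its transitions are transitions of the mixture, so a cyclic function
  -- for the mixture is cyclic for it.
  · obtain ⟨i, -⟩ := w.support_nonempty
    obtain ⟨t⟩ := hp.nonempty
    exact (SS i).lift_aperiodic (hr i) (hc i) (hK i) t hd f fun a b h => hf a b (step i a b h)
  · simp only [PMF.bind_apply, ← ENNReal.tsum_mul_left]
    rw [ENNReal.tsum_comm]
    simp only [mul_left_comm _ (w _), ENNReal.tsum_mul_left]
    simp only [(SS _).lift_stationary (hr _) (hc _) (hK _), ENNReal.tsum_mul_right, w.tsum_coe,
      one_mul]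

/-- The program varies in the induction, since the inner metaprograms run on extracted subprograms,
which inherit a posterior from `p`. -/
theorem MetaProg.isErgodicFor (ip : MetaProg F) (hp : HasPosterior F p) (ha : ip.Admissible p) :
    IsErgodicFor (kernelOn F ip.run p) (posterior F p) := by
  induction ip generalizing p with
  | blackBox K hK => exact hK p hp
  | infer k w hw SS ip ih =>
    obtain ⟨hrc, hco, hin⟩ := ha
    exact (isErgodicFor_posterior_iff hp).2 (isErgodicMatrix_mixture hw hp (fun i => (hrc i).1)
      (fun i => (hrc i).2) hco fun i t =>
        have hp' := (SS i).hasPosterior_sub (hrc i).1 (hrc i).2 hp t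
        (isErgodicFor_posterior_iff hp').1 (ih i hp' (hin i t)))

end Main

end InferMeta

/-- On the trace space of every program `p` on which the strategies of the metaprogram `ip` are
reversible, consistent and connecting, `ip` induces a Markov kernel that is irreducible and aperiodic
and has the posterior distribution of `p` as stationary distribution; in particular, if this is so
for all programs, then `ip` implements a generalized Markov kernel. -/
theorem mainTheorem1 {C D : Type} [Countable C] [Countable D] (F : InferMeta.DistFamily C D)
    (ip : InferMeta.MetaProg F) :
    (∀ p : InferMeta.Program C D, InferMeta.HasPosterior F p → ip.Admissible p →
      InferMeta.IsErgodicFor (InferMeta.kernelOn F ip.run p) (InferMeta.posterior F p)) ∧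
    ((∀ p : InferMeta.Program C D, InferMeta.HasPosterior F p → ip.Admissible p) →
      InferMeta.IsGeneralizedMarkovKernel F ip.run) :=
  ⟨fun _ hp ha => ip.isErgodicFor hp ha, fun h p hp => ip.isErgodicFor hp (h p hp)⟩
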